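/- Let $m$ be a number of variables, $a,b\in\mathbb C$ and $c=(c_1,\dots,c_m)\in\mathbb C^m$ with $$a-\sum_{k=1}^m i_kc_k\notin\mathbb Z,\qquad b-\sum_{k=1}^m i_kc_k\notin\mathbb Z\qquad\text{for all } I=(i_1,\dots,i_m)\in\{0,1\}^m .$$ The $c_k$ may be integers. Let $E_C(a,b,c)$ be the system $$\bigl[\theta_k(\theta_k+c_k-1)-x_k(\theta+a)(\theta+b)\bigr]f(x)=0\quad(k=1,\dots,m),\qquad \theta_k=x_k\frac{\partial}{\partial x_k},\quad \theta=\sum_{k=1}^m\theta_k .$$ Let $D_C=\{x\in\mathbb C^m:\sum_k\sqrt{|x_k|}<1\}$ and $S=\{\prod_k x_k\cdot R(x)=0\}$ with $R(x)=\prod_{\varepsilon\in\{\pm1\}^m}(1+\sum_k\varepsilon_k\sqrt{x_k})$. Fix a point $\dot x\in D_C\setminus S$ (for instance $\dot x=(\frac1{2m^2},\dots,\frac1{2m^2})$ if $m\ge1$) and, for each $k$, a branch of $\log x_k$ near $\dot x$; put $x_k^{s}=\exp(s\log x_k)$. These branches are holomorphic on $U=\{x\in D_C: x_k/\dot x_k\notin(-\infty,0]\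 \text{for all }k\}$. Let $\mathrm{Sol}_{\dot x}(a,b,c)$ be the complex vector space of germs at $\dot x$ of holomorphic solutions of $E_C(a,b,c)$. Let $F_C(a,b,c;x)=\sum_{n\in\mathbb N^m}\frac{(a)_{|n|}(b)_{|n|}}{\prod_k (c_k)_{n_k}\,n_k!}\prod_k x_k^{n_k}$ with $|n|=\sum_k n_k$ and $(s)_j=s(s+1)\cdots(s+j-1)$. For a parameter vector $c'\in(\mathbb C\setminus\mathbb Z)^m$ and $I\in\{0,1\}^m$ put $a^I=a+\sum_k i_k(1-c'_k)$, $b^I=b+\sum_k i_k(1-c'_k)$, $c'^I=(c'_k+2i_k(1-c'_k))_k$, $$F_I(c';x)=\frac{\prod_{k}\Gamma\bigl((-1)^{i_k}(1-c'_k)\bigr)}{\Gamma(1-a^I)\Gamma(1-b^I)}\prod_{k}x_k^{i_k(1-c'_k)}\cdot F_C(a^I,b^I,c'^I;x),$$ and let $\mathbf F(c';x)=(F_I(c';x))_I$ be the corresponding row vector. Let $P_m(c')=Q_1\otimes\cdots\otimes Q_m$ with $Q_k=\begin{pmatrix}1-\gamma_k&1\\0&1\end{pmatrix}$, $\gamma_k=e^{2\pi\sqrt{-1}\,c'_k}$;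 that is, $P_m(c')_{J,I}=\prod_k (Q_k)_{j_k,i_k}$. Then: 1. For every $I$ the limit $$\tilde F_I(x)=\lim_{c'\to c,\ c'\in(\mathbb C\setminus\mathbb Z)^m}\bigl(\mathbf F(c';x)\cdot P_m(c')\bigr)_I$$ exists, locally uniformly for $x\in U$; if $c_1,\dots,c_m\notin\mathbb Z$, then $\tilde F_I(x)=(\mathbf F(c;x)\cdot P_m(c))_I$ on $U$. 2. The germs of the $2^m$ functions $\tilde F_I$ at $\dot x$ form a basis of $\mathrm{Sol}_{\dot x}(a,b,c)$. 3. If $c_k\in\mathbb Z$ and $i_k=1$, then $\tilde F_I$ contains a logarithmic term in $x_k$: on $U$ one has $\tilde F_I(x)=h(x)+\log x_k\cdot g(x)$ with $g,h$ holomorphic on $\{x\in D_C: x_k\ne0,\ x_j/\dot x_j\notin(-\infty,0]\ \text{for all } j\ne k\}$ (hence single-valued around $x_k=0$) and $g$ not identically zero near $\dot x$. -/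

import Mathlib

open Filter Topology

namespace LauricellaFC

noncomputable section

/-! ### The series and its domain of convergence -/

/-- Lauricella's series `F_C(a, b, c; x)`; `(a, n)` is the rising factorial
`a (a + 1) ⋯ (a + n - 1)`. -/
def FC {m : ℕ} (a b : ℂ) (c x : Fin m → ℂ) : ℂ :=
  ∑' n : Fin m → ℕ,
    (ascPochhammer ℂ (∑ k, n k)).eval a * (ascPochhammer ℂ (∑ k, n k)).eval b /
      ((∏ k, (ascPochhammer ℂ (n k)).eval (c k)) * ∏ k, ((n k).factorial : ℂ)) *
      ∏ k, x k ^ n k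

/-- The domain `D_C`. -/
def convDomain (m : ℕ) : Set (Fin m → ℂ) :=
  {x | ∑ k, Real.sqrt ‖x k‖ < 1}

/-- `R(x) = ∏_{ε} (1 + ∑ ε_k √x_k)`, the product over all sign vectors `ε ∈ {±1}^m`; the value
does not depend on the choice of the square roots. -/
def discr {m : ℕ} (x : Fin m → ℂ) : ℂ :=
  ∏ ε : Fin m → ℤˣ, (1 + ∑ k, ((ε k : ℤ) : ℂ) * x k ^ (1 / 2 : ℂ))

/-- The singular locus `S`. -/
def singularLocus (m : ℕ) : Set (Fin m → ℂ) :=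
  {x | (∏ k, x k) * discr x = 0}

/-! ### The differential equations and their local solutions -/

/-- The operator `θ_k = x_k ∂/∂x_k`. -/
def theta {m : ℕ} (k : Fin m) (f : (Fin m → ℂ) → ℂ) : (Fin m → ℂ) → ℂ :=
  fun x => x k * fderiv ℂ f x (Pi.single k 1)

/-- The Euler operator `θ = ∑_k θ_k`. -/
def euler {m : ℕ} (f : (Fin m → ℂ) → ℂ) : (Fin m → ℂ) → ℂ :=
  fun x => ∑ k, theta k f x

/-- The operator `θ_k (θ_k + c_k - 1) - x_k (θ + a) (θ + b)`. -/
def opEC {m : ℕ} (a b : ℂ) (c : Fin m → ℂ) (k : Fin m) (f : (Fin m → ℂ) → ℂ) :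
    (Fin m → ℂ) → ℂ :=
  fun x =>
    theta k (fun y => theta k f y + (c k - 1) * f y) x
      - x k * (euler (fun y => euler f y + b * f y) x + a * (euler f x + b * f x))

theorem theta_analyticAt {m : ℕ} (k : Fin m) {f : (Fin m → ℂ) → ℂ} {x : Fin m → ℂ}
    (hf : AnalyticAt ℂ f x) : AnalyticAt ℂ (theta k f) x := by
  have h1 : AnalyticAt ℂ (fun y : Fin m → ℂ => y k) x :=
    (ContinuousLinearMap.proj (R := ℂ) (φ := fun _ : Fin m => ℂ) k).analyticAt x
  have h2 : AnalyticAt ℂ (fun y => fderiv ℂ f y (Pi.single k 1)) x :=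
    ((ContinuousLinearMap.apply ℂ ℂ (Pi.single k (1 : ℂ) : Fin m → ℂ)).analyticAt _).comp
      hf.fderiv
  exact h1.mul h2

theorem euler_analyticAt {m : ℕ} {f : (Fin m → ℂ) → ℂ} {x : Fin m → ℂ}
    (hf : AnalyticAt ℂ f x) : AnalyticAt ℂ (euler f) x := by
  unfold euler
  exact Finset.analyticAt_fun_sum _ fun k _ => theta_analyticAt k hf

theorem theta_lin {m : ℕ} (k : Fin m) {f g : (Fin m → ℂ) → ℂ} {x : Fin m → ℂ}
    (hf : AnalyticAt ℂ f x) (hg : AnalyticAt ℂ g x) (r : ℂ) :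
    theta k (fun y => f y + r * g y) x = theta k f x + r * theta k g x := by
  unfold theta
  rw [fderiv_fun_add hf.differentiableAt (hg.differentiableAt.const_mul r),
    fderiv_const_mul hg.differentiableAt]
  simp
  ring

theorem euler_lin {m : ℕ} {f g : (Fin m → ℂ) → ℂ} {x : Fin m → ℂ}
    (hf : AnalyticAt ℂ f x) (hg : AnalyticAt ℂ g x) (r : ℂ) :
    euler (fun y => f y + r * g y) x = euler f x + r * euler g x := by
  unfold euler
  simp only [theta_lin _ hf hg, Finset.sum_add_distrib, Finset.mul_sum]

theorem opEC_lin {m : ℕ} (a b : ℂ) (c : Fin m → ℂ) (k : Fin m) {f g : (Fin m → ℂ) → ℂ}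
    {x : Fin m → ℂ} (hf : AnalyticAt ℂ f x) (hg : AnalyticAt ℂ g x) (r : ℂ) :
    opEC a b c k (fun y => f y + r * g y) x = opEC a b c k f x + r * opEC a b c k g x := by
  have hfe := euler_analyticAt hf
  have hge := euler_analyticAt hg
  have hft := theta_analyticAt k hf
  have hgt := theta_analyticAt k hg
  unfold opEC
  rw [theta_lin k hft hf, theta_lin k hgt hg, euler_lin hfe hf, euler_lin hge hg]
  have hfg : AnalyticAt ℂ (fun y => f y + r * g y) x := hf.add (analyticAt_const.mul hg)
  rw [theta_lin k (theta_analyticAt k hfg) hfg, euler_lin (euler_analyticAt hfg) hfg]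
  have e1 : theta k (fun y => f y + r * g y) =ᶠ[𝓝 x]
      fun y => theta k f y + r * theta k g y := by
    filter_upwards [hf.eventually_analyticAt, hg.eventually_analyticAt] with y h1 h2
    exact theta_lin k h1 h2 r
  have e2 : euler (fun y => f y + r * g y) =ᶠ[𝓝 x]
      fun y => euler f y + r * euler g y := by
    filter_upwards [hf.eventually_analyticAt, hg.eventually_analyticAt] with y h1 h2
    exact euler_lin h1 h2 r
  have e3 : theta k (theta k (fun y => f y + r * g y)) x
      = theta k (theta k f) x + r * theta k (theta k g) x := by
    rw [← theta_lin k hft hgt]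
    unfold theta at e1 ⊢
    rw [e1.fderiv_eq]
  have e4 : euler (euler (fun y => f y + r * g y)) x
      = euler (euler f) x + r * euler (euler g) x := by
    rw [← euler_lin hfe hge]
    conv_lhs => unfold euler theta
    conv_rhs => unfold euler theta
    refine Finset.sum_congr rfl fun j _ => ?_
    have := e2.fderiv_eq (𝕜 := ℂ)
    unfold euler theta at this
    rw [this]
  change theta k (theta k (fun y => f y + r * g y)) x
      + (c k - 1) * theta k (fun y => f y + r * g y) x
      - x k * (euler (euler (fun y => f y + r * g y)) x
        + b * euler (fun y => f y + r * g y) x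
        + a * (euler (fun y => f y + r * g y) x + b * (f x + r * g x))) = _
  rw [e3, e4, theta_lin k hf hg, euler_lin hf hg]
  ring

/-- The local solution space of `E_C(a, b, c)` at `x₀`: the complex vector space of all germs
at `x₀` of functions holomorphic near `x₀` that satisfy the `m` differential equations near
`x₀`. -/
def localSol {m : ℕ} (a b : ℂ) (c x₀ : Fin m → ℂ) : Submodule ℂ (Germ (𝓝 x₀) ℂ) where
  carrier := {φ | ∃ f : (Fin m → ℂ) → ℂ, φ = (f : Germ (𝓝 x₀) ℂ) ∧ AnalyticAt ℂ f x₀ ∧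
    ∀ k, ∀ᶠ x in 𝓝 x₀, opEC a b c k f x = 0}
  zero_mem' := by
    refine ⟨fun _ => 0, rfl, analyticAt_const, fun k => Eventually.of_forall fun x => ?_⟩
    simp [opEC, theta, euler]
  add_mem' := by
    rintro _ _ ⟨f, rfl, hf, hf'⟩ ⟨g, rfl, hg, hg'⟩
    refine ⟨fun y => f y + 1 * g y, ?_, hf.add (analyticAt_const.mul hg), fun k => ?_⟩
    · simp only [one_mul]
      rfl
    · filter_upwards [hf.eventually_analyticAt, hg.eventually_analyticAt, hf' k, hg' k]
        with y h1 h2 h3 h4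
      rw [opEC_lin a b c k h1 h2, h3, h4]
      simp
  smul_mem' := by
    rintro r _ ⟨f, rfl, hf, hf'⟩
    refine ⟨fun y => (fun _ => (0 : ℂ)) y + r * f y, ?_,
      analyticAt_const.add (analyticAt_const.mul hf), fun k => ?_⟩
    · simp only [zero_add]
      rfl
    · filter_upwards [hf.eventually_analyticAt, hf' k] with y h1 h2
      rw [opEC_lin a b c k analyticAt_const h1, h2]
      simp [opEC, theta, euler]

/-! ### Branches of the logarithms near the base point -/

/-- The branch of `log x_k` near `x₀` that takes the value `ℓ_k` at `x₀`
(where `exp ℓ_k = x₀_k`). -/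
def logBr {m : ℕ} (x₀ ℓ : Fin m → ℂ) (k : Fin m) (x : Fin m → ℂ) : ℂ :=
  ℓ k + Complex.log (x k / x₀ k)

/-- The part of `D_C` where all the branches `logBr x₀ ℓ k` are holomorphic: every `x_k` lies
off the ray from the origin opposite to `x₀_k`. It is an open neighbourhood of `x₀`. -/
def slitDomain {m : ℕ} (x₀ : Fin m → ℂ) : Set (Fin m → ℂ) :=
  {x | x ∈ convDomain m ∧ ∀ k, x k / x₀ k ∈ Complex.slitPlane}

/-- The same as `slitDomain`, but in the `k`-th variable only the origin is removed, so that
`x_k` may turn around `0`. -/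
def loopDomain {m : ℕ} (x₀ : Fin m → ℂ) (k : Fin m) : Set (Fin m → ℂ) :=
  {x | x ∈ convDomain m ∧ x k ≠ 0 ∧ ∀ j, j ≠ k → x j / x₀ j ∈ Complex.slitPlane}

/-! ### The series solutions and the modified vector

The index set `{0, 1}^m` is `Fin m → Fin 2`. -/

/-- `a^I = a + ∑_k i_k (1 - c_k)`. -/
def shiftPar {m : ℕ} (a : ℂ) (c : Fin m → ℂ) (I : Fin m → Fin 2) : ℂ :=
  a + ∑ k, ((I k : ℕ) : ℂ) * (1 - c k)

/-- `c^I = (c_k + 2 i_k (1 - c_k))_k`. -/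
def shiftC {m : ℕ} (c : Fin m → ℂ) (I : Fin m → Fin 2) : Fin m → ℂ :=
  fun k => c k + 2 * ((I k : ℕ) : ℂ) * (1 - c k)

/-- The row vector `𝐅(x) = (F_I(x))_I` of series solutions, where
`x_k ^ (i_k (1 - c_k)) = exp (i_k (1 - c_k) log x_k)` for the chosen branch of `log x_k`. -/
def vecF {m : ℕ} (a b : ℂ) (x₀ ℓ c x : Fin m → ℂ) (I : Fin m → Fin 2) : ℂ :=
  (∏ k, Complex.Gamma ((-1) ^ (I k : ℕ) * (1 - c k))) /
      (Complex.Gamma (1 - shiftPar a c I) * Complex.Gamma (1 - shiftPar b c I)) *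
    (∏ k, Complex.exp (((I k : ℕ) : ℂ) * (1 - c k) * logBr x₀ ℓ k x)) *
    FC (shiftPar a c I) (shiftPar b c I) (shiftC c I) x

/-- `γ_k = exp (2 π √-1 c_k)`. -/
def gam {m : ℕ} (c : Fin m → ℂ) (k : Fin m) : ℂ :=
  Complex.exp (2 * Real.pi * Complex.I * c k)

/-- The matrix `Q_k`. -/
def matQ {m : ℕ} (c : Fin m → ℂ) (k : Fin m) : Matrix (Fin 2) (Fin 2) ℂ :=
  !![1 - gam c k, 1; 0, 1]

/-- The tensor product `P_m = Q_1 ⊗ ⋯ ⊗ Q_m`: its entry in row `J` and column `I` is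
`∏_k (Q_k)_{j_k, i_k}`. -/
def matP {m : ℕ} (c : Fin m → ℂ) : Matrix (Fin m → Fin 2) (Fin m → Fin 2) ℂ :=
  Matrix.of fun J I => ∏ k, matQ c k (J k) (I k)

/-- The parameter vectors `c` none of whose entries is an integer. -/
def nonInt (m : ℕ) : Set (Fin m → ℂ) :=
  {c | ∀ k, ∀ n : ℤ, c k ≠ n}

/-- The entries of the product `𝐅(x) · P_m`. It is meaningful for `c ∈ nonInt m`. -/
def vecFP {m : ℕ} (a b : ℂ) (x₀ ℓ c x : Fin m → ℂ) (I : Fin m → Fin 2) : ℂ :=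
  Matrix.vecMul (vecF a b x₀ ℓ c x) (matP c) I

/-- The modified vector for arbitrary `c`: the limit of `𝐅(x) · P_m` as the parameter vector
tends to `c` through vectors without integral entries. -/
def vecFt {m : ℕ} (a b : ℂ) (x₀ ℓ c x : Fin m → ℂ) (I : Fin m → Fin 2) : ℂ :=
  limUnder (𝓝[nonInt m] c) fun c' => vecFP a b x₀ ℓ c' x I

end

end LauricellaFC

open LauricellaFC

namespace LauricellaFC

noncomputable section

/-! ### Osgood's lemma -/

/-! In the coordinates `t_k = log x_k` the operator `θ_k` is `∂/∂t_k`, `D_C` is the convex set `∑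
exp (Re t_k / 2) < 1`, and a loop around `x_k = 0` is the translation of `t_k` by `2πi`. By the
reflection formula, `F_J` is `∏ ± π / sin (π c_k)` times a Frobenius series `frobSer` whose
coefficients are products of values of `1 / Γ`, hence entire in `c` (`vecF_eq`). The series
converges locally normally in `(c, t)` jointly (`locNormal_frobTerm`) and solves the system for
every `c` (`opLog_frobSer`).

Column 0 of `Q_k` contains `1 - γ_k`, which cancels the pole of `π / sin (π c_k)`; column 1 leaves a
simple pole along `c_k ∈ ℤ`. Its numerator is a difference of the series with `j_k = 0` and `j_k =
1`, and these coincide for integral `c_k` (`frobSer_update`). So the numerator is divisible by the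
product of the sines (`exists_div_prod_sin`), and the quotient `modSol` is analytic in `(c, t)`.
Existence of the limit, the equations and the monodromy formulas follow by continuity from
nonintegral `c`. The monodromy in `x_k` is triangular with eigenvalues `1` and `γ_k⁻¹`; for `γ_k =
1` it is a Jordan block, which produces the logarithm.

Linear independence: the local monodromies turn a nontrivial relation into one whose coefficients
are a common eigenvector (`exists_eigVec_relation`). Such a relation says that one Frobenius series
vanishes identically, which the nonintegrality conditions on `a` and `b` exclude
(`exists_frobSer_ne_zero`).

Upper bound for the rank: to highest order the equations read `∂_k² = exp (t_k) (∑ ∂_i)²`. With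
weights `√|x_k|` this is a contraction because `∑ √|x_k| < 1`, so a solution is determined by its `2
^ m` square-free derivatives at the base point (`pdWord_eq_zero_of_nodup`).

Analyticity of sums and quotients in several variables is reduced to one variable by Osgood's lemma.
-/

theorem hasSum_pi_geometric {n : ℕ} (w : Fin n → ℂ) (hw : ∀ k, ‖w k‖ < 1) :
    HasSum (fun α : Fin n → ℕ => ∏ k, w k ^ α k) (∏ k, (1 - w k)⁻¹) ∧
      Summable fun α : Fin n → ℕ => ‖∏ k, w k ^ α k‖ := by
  induction n with
  | zero =>
    refine ⟨?_, (hasSum_fintype _).summable⟩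
    simp
  | succ n ih =>
    obtain ⟨h1, h2⟩ := ih (fun k => w k.succ) fun k => hw _
    have h0 := hasSum_geometric_of_norm_lt_one (hw 0)
    have h0' : Summable fun i : ℕ => ‖w 0 ^ i‖ := by
      simpa using summable_geometric_of_lt_one (norm_nonneg _) (hw 0)
    have hs := summable_mul_of_summable_norm h0' h2
    have hsn := h0'.mul_norm h2
    have hp := h0.mul h1 hs
    constructor
    · rw [← (Fin.consEquiv (fun _ => ℕ)).hasSum_iff, Fin.prod_univ_succ]
      refine hp.congr_fun fun p => ?_
      simp [Fin.consEquiv, Fin.prod_univ_succ]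
    · rw [← (Fin.consEquiv (fun _ => ℕ)).summable_iff]
      convert hsn using 1
      ext p
      simp [Fin.consEquiv, Fin.prod_univ_succ]

theorem norm_torusMap_zero_apply {n : ℕ} {R : ℝ} (hR : 0 ≤ R) (θ : Fin n → ℝ) (k : Fin n) :
    ‖torusMap (0 : Fin n → ℂ) (fun _ => R) θ k‖ = R := by
  simp [torusMap, abs_of_nonneg hR]

theorem continuous_torusMap {n : ℕ} (c : Fin n → ℂ) (R : Fin n → ℝ) :
    Continuous (torusMap c R) := by
  unfold torusMap
  fun_prop

theorem torusMap_mem_closedBall {n : ℕ} {R : ℝ} (hR : 0 ≤ R) (θ : Fin n → ℝ) :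
    torusMap (0 : Fin n → ℂ) (fun _ => R) θ ∈ Metric.closedBall (0 : Fin n → ℂ) R := by
  rw [mem_closedBall_zero_iff, pi_norm_le_iff_of_nonneg hR]
  exact fun k => (norm_torusMap_zero_apply hR θ k).le

/-- Induction on the number of variables: the one-variable Cauchy formula on the first circle is
applied to the result of the others. Continuity makes the integrand integrable on the torus, so that
it may be integrated iteratively. -/
theorem torusIntegral_cauchy {n : ℕ} {f : (Fin n → ℂ) → ℂ} {R : ℝ} (hR : 0 < R)
    (hc : ContinuousOn f (Metric.closedBall 0 R))
    (hl : ∀ z ∈ Metric.closedBall (0 : Fin n → ℂ) R, ∀ k,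
      DifferentiableAt ℂ (fun w => f (Function.update z k w)) (z k))
    {w : Fin n → ℂ} (hw : ∀ k, ‖w k‖ < R) :
    torusIntegral (fun ζ => (∏ k, (ζ k - w k)⁻¹) * f ζ) 0 (fun _ => R)
      = (2 * Real.pi * Complex.I) ^ n * f w := by
  induction n with
  | zero =>
    rw [torusIntegral_dim0]
    simp [Subsingleton.elim (0 : Fin 0 → ℂ) w]
  | succ n ih =>
    have hint : TorusIntegrable (fun ζ => (∏ k, (ζ k - w k)⁻¹) * f ζ) 0 (fun _ => R) := by
      refine ContinuousOn.integrableOn_compact isCompact_Icc (Continuous.continuousOn ?_)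
      refine Continuous.mul (continuous_finsetProd _ fun k _ => Continuous.inv₀ ?_ ?_) ?_
      · have := continuous_torusMap (0 : Fin (n + 1) → ℂ) (fun _ => R)
        exact ((continuous_apply k).comp this).sub continuous_const
      · intro θ h0
        have h1 := norm_torusMap_zero_apply hR.le θ k
        rw [sub_eq_zero.1 h0] at h1
        exact (hw k).ne h1
      · exact hc.comp_continuous (continuous_torusMap _ _) (torusMap_mem_closedBall hR.le)
    rw [torusIntegral_succ hint]
    have hcons : ∀ {x : ℂ} {y : Fin n → ℂ}, ‖x‖ ≤ R → ‖y‖ ≤ R →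
        (Fin.cons x y : Fin (n + 1) → ℂ) ∈ Metric.closedBall 0 R := by
      intro x y hx hy
      rw [mem_closedBall_zero_iff, pi_norm_le_iff_of_nonneg hR.le]
      intro k
      refine Fin.cases hx (fun j => ?_) k
      exact (norm_le_pi_norm y j).trans hy
    have hwn : ‖fun k : Fin n => w k.succ‖ ≤ R :=
      (pi_norm_le_iff_of_nonneg hR.le).2 fun k => (hw _).le
    have hin : ∀ x ∈ Metric.sphere (0 : ℂ) R,
        torusIntegral (fun y : Fin n → ℂ => (∏ k, ((Fin.cons x y : Fin (n + 1) → ℂ) k - w k)⁻¹) *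
          f (Fin.cons x y)) ((0 : Fin (n + 1) → ℂ) ∘ Fin.succ) ((fun _ => R) ∘ Fin.succ)
        = (x - w 0)⁻¹ • ((2 * Real.pi * Complex.I) ^ n * f (Fin.cons x fun k => w k.succ)) := by
      intro x hx
      have hx' : ‖x‖ ≤ R := by simpa using (mem_sphere_zero_iff_norm.1 hx).le
      have := ih (f := fun y => f (Fin.cons x y)) (w := fun k => w k.succ) ?_ ?_ fun k => hw _
      · simp only [Fin.prod_univ_succ, Fin.cons_zero, Fin.cons_succ, mul_assoc,
          torusIntegral_const_mul]
        rw [smul_eq_mul]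
        congr 1
        refine Eq.trans ?_ (this.trans (by rw [mul_assoc]))
        rfl
      · refine hc.comp (Continuous.continuousOn ?_) fun y hy => ?_
        · exact Continuous.finCons continuous_const continuous_id
        · exact hcons hx' (by simpa using hy)
      · intro z hz k
        have := hl (Fin.cons x z) (hcons hx' (by simpa using hz)) k.succ
        simpa [Fin.cons_update] using this
    have h00 : (0 : Fin (n + 1) → ℂ) 0 = 0 := rfl
    rw [h00, circleIntegral.integral_congr hR.le hin]
    have hd : ∀ x ∈ Metric.closedBall (0 : ℂ) R, DifferentiableAt ℂ
        (fun x => (2 * Real.pi * Complex.I) ^ n * f (Fin.cons x fun k => w k.succ)) x := by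
      intro x hx
      have := hl (Fin.cons x fun k => w k.succ) (hcons (by simpa using hx) hwn) 0
      simp only [Fin.update_cons_zero, Fin.cons_zero] at this
      exact this.const_mul _
    have := Complex.circleIntegral_sub_inv_smul_of_differentiable_on_off_countable (R := R)
      (c := 0) (w := w 0) Set.countable_empty (by simpa using hw 0)
      (fun x hx => (hd x hx).continuousAt.continuousWithinAt)
      fun x hx => hd x (Metric.ball_subset_closedBall hx.1)
    rw [this, smul_eq_mul, pow_succ]
    have hw' : (Fin.cons (w 0) fun k : Fin n => w k.succ : Fin (n + 1) → ℂ) = w :=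
      Fin.cons_self_tail w
    rw [hw']
    ring

/-- The Cauchy kernel is expanded in a geometric series under the torus integral. On the torus all
coordinates have modulus `R`, so each term has a bound independent of the angles, and these bounds
are summable. -/
theorem exists_coeff_of_separately_holomorphic {n : ℕ} {f : (Fin n → ℂ) → ℂ} {R : ℝ}
    (hR : 0 < R) (hc : ContinuousOn f (Metric.closedBall 0 R))
    (hl : ∀ z ∈ Metric.closedBall (0 : Fin n → ℂ) R, ∀ k,
      DifferentiableAt ℂ (fun w => f (Function.update z k w)) (z k)) :
    ∃ (A : (Fin n → ℕ) → ℂ) (C : ℝ), (∀ α, ‖A α‖ ≤ C * (R⁻¹) ^ (∑ k, α k)) ∧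
      ∀ w : Fin n → ℂ, (∀ k, ‖w k‖ < R) → HasSum (fun α => A α * ∏ k, w k ^ α k) (f w) := by
  obtain ⟨M, hM⟩ := (isCompact_closedBall (0 : Fin n → ℂ) R).exists_bound_of_continuousOn hc
  have h2pi : (2 * Real.pi * Complex.I : ℂ) ^ n ≠ 0 := pow_ne_zero _ (by simp [Real.pi_ne_zero])
  set D : ℝ := ‖((2 * Real.pi * Complex.I : ℂ) ^ n)⁻¹‖ with hD
  let T : (Fin n → ℝ) → (Fin n → ℂ) := torusMap (0 : Fin n → ℂ) (fun _ => R)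
  have hTn : ∀ θ k, ‖T θ k‖ = R := norm_torusMap_zero_apply hR.le
  have hT0 : ∀ θ k, T θ k ≠ 0 := fun θ k h => by
    have := hTn θ k
    rw [h, norm_zero] at this
    exact hR.ne this
  have hTc : ∀ k, Continuous fun θ => T θ k := fun k => by
    have := continuous_torusMap (0 : Fin n → ℂ) (fun _ => R)
    exact (continuous_apply k).comp this
  have hfT : Continuous fun θ => f (T θ) :=
    hc.comp_continuous (continuous_torusMap _ _) (torusMap_mem_closedBall hR.le)
  have hM' : ∀ θ, ‖f (T θ)‖ ≤ M := fun θ => hM _ (torusMap_mem_closedBall hR.le θ)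
  have hnorm : ∀ (α : Fin n → ℕ) θ, ‖∏ k, (T θ k ^ (α k + 1))⁻¹‖
      = R⁻¹ ^ n * R⁻¹ ^ (∑ k, α k) := by
    intro α θ
    have : ∀ k, ‖(T θ k ^ (α k + 1))⁻¹‖ = R⁻¹ * R⁻¹ ^ α k := fun k => by
      rw [norm_inv, norm_pow, hTn, ← inv_pow, pow_succ']
    simp only [norm_prod, this, Finset.prod_mul_distrib, Finset.prod_pow_eq_pow_sum,
      Finset.prod_const, Finset.card_univ, Fintype.card_fin]
  let A' : (Fin n → ℕ) → ℂ := fun α =>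
    torusIntegral (fun ζ => (∏ k, (ζ k ^ (α k + 1))⁻¹) * f ζ) 0 (fun _ => R)
  refine ⟨fun α => ((2 * Real.pi * Complex.I : ℂ) ^ n)⁻¹ * A' α,
    D * (((2 * Real.pi) ^ n * ∏ _k : Fin n, |R|) * (R⁻¹ ^ n * M)), fun α => ?_, fun w hw => ?_⟩
  · have : ‖A' α‖ ≤ ((2 * Real.pi) ^ n * ∏ _k : Fin n, |R|) *
        (R⁻¹ ^ n * R⁻¹ ^ (∑ k, α k) * M) := by
      refine norm_torusIntegral_le_of_norm_le_const fun θ => ?_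
      rw [norm_mul]
      exact mul_le_mul (hnorm α θ).le (hM' θ) (norm_nonneg _) (by positivity)
    calc _ = D * ‖A' α‖ := norm_mul _ _
      _ ≤ D * (((2 * Real.pi) ^ n * ∏ _k : Fin n, |R|) *
        (R⁻¹ ^ n * R⁻¹ ^ (∑ k, α k) * M)) := mul_le_mul_of_nonneg_left this (norm_nonneg _)
      _ = _ := by ring
  · have hwR : ∀ k, ‖w k / R‖ < 1 := fun k => by
      rw [norm_div, Complex.norm_real, Real.norm_of_nonneg hR.le, div_lt_one hR]
      exact hw k
    have hkey : HasSum (fun α => A' α * ∏ k, w k ^ α k) ((2 * Real.pi * Complex.I) ^ n * f w) := by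
      rw [← torusIntegral_cauchy hR hc hl hw]
      have : ∀ α, A' α * ∏ k, w k ^ α k =
          ∫ θ : Fin n → ℝ in Set.Icc 0 fun _ => 2 * Real.pi,
            (∏ i, (R : ℂ) * Complex.exp (θ i * Complex.I) * Complex.I : ℂ) •
              ((∏ k, w k ^ α k) * ((∏ k, (T θ k ^ (α k + 1))⁻¹) * f (T θ))) := fun α => by
        rw [mul_comm, ← torusIntegral_const_mul]
        rfl
      simp only [this]
      refine MeasureTheory.hasSum_integral_of_dominated_convergence
        (fun α _ => R ^ n * (‖∏ k, (w k / R) ^ α k‖ * (R⁻¹ ^ n * M))) (fun α => ?_) (fun α => ?_)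
        ?_ ?_ ?_
      · refine Continuous.aestronglyMeasurable ?_
        have h1 : Continuous fun θ : Fin n → ℝ =>
            ∏ i, (R : ℂ) * Complex.exp (θ i * Complex.I) * Complex.I := by fun_prop
        have h2 : Continuous fun θ => ∏ k, (T θ k ^ (α k + 1))⁻¹ :=
          continuous_finsetProd _ fun k _ =>
            ((hTc k).pow _).inv₀ fun θ => pow_ne_zero _ (hT0 θ k)
        exact h1.smul (continuous_const.mul (h2.mul hfT))
      · refine Eventually.of_forall fun θ => ?_
        rw [norm_smul, norm_mul, norm_mul, hnorm]
        have h1 : ‖∏ i, (R : ℂ) * Complex.exp (θ i * Complex.I) * Complex.I‖ = R ^ n := by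
          simp [norm_prod, abs_of_pos hR]
        have h2 : ‖∏ k, (w k / R) ^ α k‖ = ‖∏ k, w k ^ α k‖ * R⁻¹ ^ (∑ k, α k) := by
          rw [norm_prod, norm_prod, ← Finset.prod_pow_eq_pow_sum, ← Finset.prod_mul_distrib]
          refine Finset.prod_congr rfl fun k _ => ?_
          simp [abs_of_pos hR, div_eq_mul_inv, mul_pow]
        rw [h1, h2]
        have := mul_le_mul_of_nonneg_left (hM' θ)
          (by positivity : 0 ≤ R ^ n * (‖∏ k, w k ^ α k‖ * R⁻¹ ^ (∑ k, α k) * R⁻¹ ^ n))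
        calc _ = R ^ n * (‖∏ k, w k ^ α k‖ * R⁻¹ ^ (∑ k, α k) * R⁻¹ ^ n) * ‖f (T θ)‖ := by ring
          _ ≤ _ := this
          _ = _ := by ring
      · refine Eventually.of_forall fun θ => ?_
        exact ((hasSum_pi_geometric _ hwR).2.mul_right _).mul_left _
      · exact MeasureTheory.integrableOn_const isCompact_Icc.measure_lt_top.ne
      · refine Eventually.of_forall fun θ => ?_
        refine HasSum.const_smul _ ?_
        have hwT : ∀ k, ‖w k / T θ k‖ < 1 := fun k => by
          rw [norm_div, hTn, div_lt_one hR]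
          exact hw k
        have := ((hasSum_pi_geometric _ hwT).1.mul_right (f (T θ))).mul_left (∏ k, (T θ k)⁻¹)
        have e1 : ∀ α : Fin n → ℕ, (∏ k, (T θ k)⁻¹) * ((∏ k, (w k / T θ k) ^ α k) * f (T θ)) =
            (∏ k, w k ^ α k) * ((∏ k, (T θ k ^ (α k + 1))⁻¹) * f (T θ)) := fun α => by
          rw [← mul_assoc, ← mul_assoc, ← Finset.prod_mul_distrib, ← Finset.prod_mul_distrib]
          congr 1
          refine Finset.prod_congr rfl fun k _ => ?_
          rw [div_pow, pow_succ, mul_inv]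
          ring
        have e2 : (∏ k, (T θ k)⁻¹) * ((∏ k, (1 - w k / T θ k)⁻¹) * f (T θ)) =
            (∏ k, (T θ k - w k)⁻¹) * f (T θ) := by
          rw [← mul_assoc, ← Finset.prod_mul_distrib]
          congr 1
          refine Finset.prod_congr rfl fun k _ => ?_
          rw [← mul_inv, mul_sub, mul_one, mul_div_cancel₀ _ (hT0 θ k)]
        simp only [e1, e2] at this
        exact this
    have := hkey.mul_left ((2 * Real.pi * Complex.I : ℂ) ^ n)⁻¹
    rw [inv_mul_cancel_left₀ h2pi] at this
    simpa only [mul_assoc] using this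


/-- The monomial `v ↦ ∏ v_k ^ α_k` as a continuous multilinear map on the diagonal. -/
theorem exists_multilinear_monomial {n : ℕ} (N : ℕ) (α : Fin n → ℕ) (hα : ∑ k, α k = N) :
    ∃ p : ContinuousMultilinearMap ℂ (fun _ : Fin N => Fin n → ℂ) ℂ, ‖p‖ ≤ 1 ∧
      ∀ v : Fin n → ℂ, p (fun _ => v) = ∏ k, v k ^ α k := by
  subst hα
  -- The word in which each index `k` occurs `α k` times; multiplying coordinates along it gives the
  -- monomial.
  let σ : Fin (∑ k, α k) → Fin n := fun i => (finSigmaFinEquiv.symm i).1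
  refine ⟨(ContinuousMultilinearMap.mkPiAlgebra ℂ _ ℂ).compContinuousLinearMap
    fun i => ContinuousLinearMap.proj (σ i), ?_, fun v => ?_⟩
  · refine ContinuousMultilinearMap.opNorm_le_bound zero_le_one fun m => ?_
    simp only [ContinuousMultilinearMap.compContinuousLinearMap_apply,
      ContinuousMultilinearMap.mkPiAlgebra_apply, ContinuousLinearMap.proj_apply, norm_prod, one_mul]
    exact Finset.prod_le_prod (fun _ _ => norm_nonneg _) fun i _ => norm_le_pi_norm _ _
  · simp only [ContinuousMultilinearMap.compContinuousLinearMap_apply,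
      ContinuousMultilinearMap.mkPiAlgebra_apply, ContinuousLinearMap.proj_apply]
    rw [← finSigmaFinEquiv.prod_comp]
    simp [σ, Fintype.prod_sigma]

/-- Monomials of equal total degree are collected into one term of a formal multilinear series. The
bound on `A` gives absolute convergence at every radius `r < R`, which permits the regrouping. -/
theorem analyticAt_zero_of_hasSum_monomials {n : ℕ} {f : (Fin n → ℂ) → ℂ} {R : ℝ} (hR : 0 < R)
    {A : (Fin n → ℕ) → ℂ} {C : ℝ} (hA : ∀ α, ‖A α‖ ≤ C * (R⁻¹) ^ (∑ k, α k))
    (hf : ∀ w : Fin n → ℂ, (∀ k, ‖w k‖ < R) → HasSum (fun α => A α * ∏ k, w k ^ α k) (f w)) :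
    AnalyticAt ℂ f 0 := by
  choose! q hq1 hq2 using fun N => exists_multilinear_monomial (n := n) N
  let e := Equiv.sigmaFiberEquiv fun α : Fin n → ℕ => ∑ k, α k
  have hfin : ∀ N, Finite {α : Fin n → ℕ // ∑ k, α k = N} := fun N => by
    refine Set.Finite.subset (Set.finite_Iic fun _ : Fin n => N) fun α hα k => ?_
    have hα : ∑ k, α k = N := hα
    exact (Finset.single_le_sum (f := α) (fun _ _ => Nat.zero_le _) (Finset.mem_univ k)).trans hα.le
  have hft : ∀ N, Fintype {α : Fin n → ℕ // ∑ k, α k = N} := fun N => Fintype.ofFinite _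
  let p : FormalMultilinearSeries ℂ (Fin n → ℂ) ℂ := fun N =>
    ∑ α : {α : Fin n → ℕ // ∑ k, α k = N}, A α.1 • q N α.1
  obtain ⟨r, hr0, hrR⟩ := exists_between hR
  have hsum : Summable fun α : Fin n → ℕ => ‖A α‖ * r ^ (∑ k, α k) := by
    have := (hasSum_pi_geometric (fun _ : Fin n => ((r / R : ℝ) : ℂ)) fun k => by
      rw [Complex.norm_real, Real.norm_of_nonneg (by positivity), div_lt_one hR]
      exact hrR).2.mul_left C
    refine Summable.of_nonneg_of_le (fun α => by positivity) (fun α => ?_) this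
    have h1 : ‖∏ k, (((r / R : ℝ) : ℂ)) ^ α k‖ = R⁻¹ ^ (∑ k, α k) * r ^ (∑ k, α k) := by
      rw [Finset.prod_pow_eq_pow_sum, norm_pow, Complex.norm_real,
        Real.norm_of_nonneg (by positivity), div_eq_mul_inv, mul_pow, mul_comm]
    rw [h1, ← mul_assoc]
    exact mul_le_mul_of_nonneg_right (hA α) (by positivity)
  have hsum' : Summable fun N => ∑ α : {α : Fin n → ℕ // ∑ k, α k = N},
      ‖A α.1‖ * r ^ (∑ k, α.1 k) := by
    have h1 := (e.summable_iff.2 hsum)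
    have := (h1.hasSum.sigma (g := fun N => ∑ α : {α : Fin n → ℕ // ∑ k, α k = N},
      ‖A α.1‖ * r ^ (∑ k, α.1 k)) fun N => hasSum_fintype _).summable
    exact this
  have hball : HasFPowerSeriesOnBall f p 0 (ENNReal.ofReal r) := by
    refine ⟨?_, by simpa using hr0, fun {y} hy => ?_⟩
    · rw [ENNReal.ofReal]
      refine p.le_radius_of_summable ?_
      refine Summable.of_nonneg_of_le (fun N => by positivity) (fun N => ?_) hsum'
      rw [Real.coe_toNNReal _ hr0.le]
      calc ‖p N‖ * r ^ N ≤ (∑ α : {α : Fin n → ℕ // ∑ k, α k = N}, ‖A α.1‖) * r ^ N := by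
            refine mul_le_mul_of_nonneg_right ?_ (by positivity)
            refine norm_sum_le_of_le _ fun α _ => ?_
            rw [norm_smul]
            exact mul_le_of_le_one_right (norm_nonneg _) (hq1 N α.1 α.2)
        _ = _ := by
            rw [Finset.sum_mul]
            exact Finset.sum_congr rfl fun α _ => by rw [α.2]
    · have hy' : ∀ k, ‖y k‖ < R := fun k => by
        have : ‖y‖ < r := by simpa [hr0] using hy
        exact (norm_le_pi_norm y k).trans_lt (this.trans hrR)
      rw [zero_add]
      have h1 := (e.hasSum_iff.2 (hf y hy')).sigma
        (g := fun N => p N fun _ => y) fun N => ?_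
      · exact h1
      · have : (p N fun _ => y) = ∑ α : {α : Fin n → ℕ // ∑ k, α k = N},
            A α.1 * ∏ k, y k ^ α.1 k := by
          simp only [p, _root_.sum_apply, _root_.smul_apply,
            smul_eq_mul]
          exact Finset.sum_congr rfl fun α _ => by rw [hq2 N α.1 α.2]
        rw [this]
        exact hasSum_fintype _
  exact hball.analyticAt

/-- **Osgood's lemma**: a continuous function on an open set that is holomorphic along every
complex line is analytic. -/
theorem analyticOnNhd_of_continuousOn_of_lines {E : Type*} [NormedAddCommGroup E]
    [NormedSpace ℂ E] [FiniteDimensional ℂ E] {f : E → ℂ} {U : Set E} (hU : IsOpen U)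
    (hc : ContinuousOn f U)
    (hl : ∀ x ∈ U, ∀ v : E, DifferentiableAt ℂ (fun z : ℂ => f (x + z • v)) 0) :
    AnalyticOnNhd ℂ f U := by
  intro x hx
  let e : E ≃L[ℂ] (Fin (Module.finrank ℂ E) → ℂ) :=
    (Module.finBasis ℂ E).equivFunL
  let g : (Fin (Module.finrank ℂ E) → ℂ) → ℂ := fun y => f (x + e.symm y)
  have hV : IsOpen ((fun y => x + e.symm y) ⁻¹' U) := hU.preimage (by fun_prop)
  obtain ⟨R, hR, hRV⟩ := Metric.nhds_basis_closedBall.mem_iff.1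
    (hV.mem_nhds (x := 0) (by simpa using hx))
  have hgc : ContinuousOn g (Metric.closedBall 0 R) :=
    hc.comp (by fun_prop) fun y hy => hRV hy
  have hgl : ∀ z ∈ Metric.closedBall (0 : Fin (Module.finrank ℂ E) → ℂ) R, ∀ k,
      DifferentiableAt ℂ (fun w => g (Function.update z k w)) (z k) := by
    intro z hz k
    have h1 := hl _ (hRV hz) (e.symm (Pi.single k 1))
    have h2 : (fun w => g (Function.update z k w)) = (fun u : ℂ => f (x + e.symm z +
        u • e.symm (Pi.single k 1))) ∘ fun w => w - z k := by
      funext w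
      simp only [g, Function.comp]
      rw [add_assoc, ← map_smul, ← map_add]
      congr 3
      ext j
      by_cases h : j = k
      · subst h; simp
      · simp [h]
    rw [h2]
    refine DifferentiableAt.comp _ ?_ (by fun_prop)
    simpa using h1
  obtain ⟨A, C, hA, hs⟩ := exists_coeff_of_separately_holomorphic hR hgc hgl
  have hg := analyticAt_zero_of_hasSum_monomials hR hA hs
  have h3 : f = g ∘ fun y => e (y - x) := by
    funext y
    simp [g]
  rw [h3]
  refine AnalyticAt.comp_of_eq hg ?_ (by simp)
  exact (e.toContinuousLinearMap.analyticAt _).comp (analyticAt_id.sub analyticAt_const)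

/-! ### Locally normally summable families -/

/-- Local normal summability of a family of functions on a set. -/
def LocNormal {ι E : Type*} [TopologicalSpace E] (U : Set E) (f : ι → E → ℂ) : Prop :=
  ∀ p ∈ U, ∃ V ∈ 𝓝 p, ∃ u : ι → ℝ, Summable u ∧ ∀ i, ∀ q ∈ V, ‖f i q‖ ≤ u i

section

variable {ι E : Type*} [NormedAddCommGroup E] {U : Set E} {f : ι → E → ℂ}

theorem LocNormal.summable (hn : LocNormal U f) {p : E} (hp : p ∈ U) :
    Summable fun i => f i p := by
  obtain ⟨V, hV, u, hu, h⟩ := hn p hp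
  exact Summable.of_norm_bounded hu fun i => h i p (mem_of_mem_nhds hV)

theorem LocNormal.exists_ball (hU : IsOpen U) (hn : LocNormal U f) {p : E} (hp : p ∈ U) :
    ∃ δ > 0, Metric.ball p δ ⊆ U ∧ ∃ u : ι → ℝ, Summable u ∧
      ∀ i, ∀ q ∈ Metric.ball p δ, ‖f i q‖ ≤ u i := by
  obtain ⟨V, hV, u, hu, h⟩ := hn p hp
  obtain ⟨δ, hδ, hs⟩ := Metric.mem_nhds_iff.1 (inter_mem hV (hU.mem_nhds hp))
  exact ⟨δ, hδ, fun q hq => (hs hq).2, u, hu, fun i q hq => h i q (hs hq).1⟩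

end

section

variable {ι E : Type*} [NormedAddCommGroup E] [NormedSpace ℂ E] {U : Set E} {f : ι → E → ℂ}

theorem hasDerivAt_line_of_analyticAt {g : E → ℂ} {p v : E} {z : ℂ}
    (hg : AnalyticAt ℂ g (p + z • v)) :
    HasDerivAt (fun z : ℂ => g (p + z • v)) (fderiv ℂ g (p + z • v) v) z := by
  have h1 : HasDerivAt (fun z : ℂ => p + z • v) v z := by
    simpa using ((hasDerivAt_id z).smul_const v).const_add p
  exact hg.differentiableAt.hasFDerivAt.comp_hasDerivAt z h1

theorem isOpen_line_preimage {W : Set E} (hW : IsOpen W) (p v : E) :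
    IsOpen {z : ℂ | p + z • v ∈ W} :=
  hW.preimage (f := fun z : ℂ => p + z • v) (by fun_prop)

/-- On every complex line Weierstrass' theorem makes the sum holomorphic, uniform convergence makes
it continuous, and Osgood's lemma combines the two. -/
theorem LocNormal.analyticOnNhd_tsum [FiniteDimensional ℂ E] (hU : IsOpen U)
    (hf : ∀ i, AnalyticOnNhd ℂ (f i) U) (hn : LocNormal U f) :
    AnalyticOnNhd ℂ (fun p => ∑' i, f i p) U := by
  refine analyticOnNhd_of_continuousOn_of_lines hU (fun p hp => ?_) fun p hp v => ?_
  · obtain ⟨δ, hδ, hs, u, hu, h⟩ := hn.exists_ball hU hp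
    refine ContinuousAt.continuousWithinAt ?_
    exact (continuousOn_tsum (fun i => (hf i).continuousOn.mono hs) hu h).continuousAt
      (Metric.ball_mem_nhds p hδ)
  · obtain ⟨δ, hδ, hs, u, hu, h⟩ := hn.exists_ball hU hp
    have hS := isOpen_line_preimage (Metric.isOpen_ball (x := p) (ε := δ)) p v
    refine (Complex.differentiableOn_tsum_of_summable_norm hu (fun i z hz => ?_) hS
      fun i z hz => h i _ hz).differentiableAt (hS.mem_nhds ?_)
    · exact (hasDerivAt_line_of_analyticAt (hf i _ (hs hz))).differentiableAt.differentiableWithinAt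
    · simpa using hδ

theorem LocNormal.hasSum_fderiv [FiniteDimensional ℂ E] (hU : IsOpen U)
    (hf : ∀ i, AnalyticOnNhd ℂ (f i) U) (hn : LocNormal U f) {p : E} (hp : p ∈ U) (v : E) :
    HasSum (fun i => fderiv ℂ (f i) p v) (fderiv ℂ (fun p => ∑' i, f i p) p v) := by
  obtain ⟨δ, hδ, hs, u, hu, h⟩ := hn.exists_ball hU hp
  have hS := isOpen_line_preimage (Metric.isOpen_ball (x := p) (ε := δ)) p v
  have hp0 : p + (0 : ℂ) • v = p := by simp
  have := Complex.hasSum_deriv_of_summable_norm (F := fun i z => f i (p + z • v)) (z := 0) hu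
    (fun i z hz => (hasDerivAt_line_of_analyticAt
      (hf i _ (hs hz))).differentiableAt.differentiableWithinAt) hS
    (fun i z hz => h i _ hz) (show p + (0 : ℂ) • v ∈ Metric.ball p δ by simpa using hδ)
  have hd : ∀ {g : E → ℂ}, AnalyticAt ℂ g p →
      deriv (fun z : ℂ => g (p + z • v)) 0 = fderiv ℂ g p v := fun {g} hg => by
    have := (hasDerivAt_line_of_analyticAt (z := 0) (v := v) (by rwa [hp0])).deriv
    rwa [hp0] at this
  rw [hd (hn.analyticOnNhd_tsum hU hf p hp)] at this
  simpa only [hd (hf _ p hp)] using this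

theorem LocNormal.fderiv (hU : IsOpen U) (hf : ∀ i, AnalyticOnNhd ℂ (f i) U)
    (hn : LocNormal U f) (v : E) : LocNormal U fun i p => fderiv ℂ (f i) p v := by
  intro p hp
  obtain ⟨δ, hδ, hs, u, hu, h⟩ := hn.exists_ball hU hp
  -- Cauchy's estimate on discs in the direction `v`: for `q` in the half ball, the disc of radius
  -- `δ / 2 / (‖v‖ + 1)` stays in the full ball. The `+ 1` covers `v = 0`.
  refine ⟨Metric.ball p (δ / 2), Metric.ball_mem_nhds p (by positivity),
    fun i => u i / (δ / 2 / (‖v‖ + 1)), hu.div_const _, fun i q hq => ?_⟩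
  have hr : 0 < δ / 2 / (‖v‖ + 1) := by positivity
  have hmem : ∀ z ∈ Metric.closedBall (0 : ℂ) (δ / 2 / (‖v‖ + 1)),
      q + z • v ∈ Metric.ball p δ := fun z hz => by
    have h1 : ‖z‖ ≤ δ / 2 / (‖v‖ + 1) := by simpa using hz
    have h2 : ‖z • v‖ ≤ δ / 2 := by
      rw [norm_smul]
      calc _ ≤ δ / 2 / (‖v‖ + 1) * (‖v‖ + 1) := by gcongr; linarith
        _ = _ := by field_simp
    rw [mem_ball_iff_norm] at hq ⊢
    calc _ = ‖(q - p) + z • v‖ := by congr 1; abel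
      _ ≤ ‖q - p‖ + ‖z • v‖ := norm_add_le _ _
      _ < _ := by linarith
  have hd : ∀ z ∈ Metric.closedBall (0 : ℂ) (δ / 2 / (‖v‖ + 1)),
      DifferentiableAt ℂ (fun z : ℂ => f i (q + z • v)) z := fun z hz =>
    (hasDerivAt_line_of_analyticAt (hf i _ (hs (hmem z hz)))).differentiableAt
  have h1 := Complex.norm_deriv_le_of_forall_mem_sphere_norm_le (C := u i)
    (f := fun z : ℂ => f i (q + z • v)) (c := 0) hr
    (DifferentiableOn.diffContOnCl fun z hz => by
      rw [closure_ball _ hr.ne'] at hz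
      exact (hd z hz).differentiableWithinAt)
    fun z hz => h i _ (hmem z (Metric.sphere_subset_closedBall hz))
  have h0 := hf i q (hs (by simpa using hmem 0 (by simpa using hr.le)))
  have h2 := (hasDerivAt_line_of_analyticAt (g := f i) (p := q) (v := v) (z := 0)
    (by simpa using h0)).deriv
  rw [h2] at h1
  simpa using h1

/-! ### Division by the equation of a hyperplane -/

/-- The quotient extends over the hyperplane by the derivative in the transversal direction `v`. The
extension is continuous and holomorphic on lines, so Osgood's lemma applies. -/
theorem exists_analyticAt_div_linear [FiniteDimensional ℂ E] {f : E → ℂ} {p₀ v : E}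
    {φ : E →L[ℂ] ℂ} (hv : φ v = 1) (hf : AnalyticAt ℂ f p₀)
    (h0 : ∀ᶠ p in 𝓝 p₀, φ p = φ p₀ → f p = 0) :
    ∃ g : E → ℂ, AnalyticAt ℂ g p₀ ∧ ∀ᶠ p in 𝓝 p₀, f p = (φ p - φ p₀) * g p := by
  classical
  obtain ⟨δ, hδ, hB⟩ := Metric.mem_nhds_iff.1 (hf.eventually_analyticAt.and h0)
  set B := Metric.ball p₀ δ
  have hBo : IsOpen B := Metric.isOpen_ball
  have hBa : ∀ p ∈ B, AnalyticAt ℂ f p := fun p hp => (hB hp).1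
  have hB0 : ∀ p ∈ B, φ p = φ p₀ → f p = 0 := fun p hp => (hB hp).2
  let g : E → ℂ := fun p => if φ p = φ p₀ then fderiv ℂ f p v else f p / (φ p - φ p₀)
  have hoff : ∀ p ∈ B, φ p ≠ φ p₀ → DifferentiableAt ℂ g p := by
    intro p hp hne
    have h1 : g =ᶠ[𝓝 p] fun p => f p / (φ p - φ p₀) := by
      filter_upwards [φ.continuous.continuousAt.eventually_ne hne] with q hq
      exact if_neg hq
    refine DifferentiableAt.congr_of_eventuallyEq ?_ h1
    have h2 : AnalyticAt ℂ (fun p => φ p - φ p₀) p := (φ.analyticAt p).sub analyticAt_const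
    exact ((hBa p hp).fun_div h2 (sub_ne_zero.2 hne)).differentiableAt
  have hcont : ContinuousOn g B := by
    intro p hp
    refine ContinuousAt.continuousWithinAt ?_
    by_cases hne : φ p = φ p₀
    swap
    · exact (hoff p hp hne).continuousAt
    -- Projection to the hyperplane along `v`. As `f` vanishes at `π q`, strict differentiability at
    -- `p` compares `f q` with `(φ q - φ p₀) * fderiv ℂ f p v`.
    let π : E → E := fun q => q - (φ q - φ p₀) • v
    have hπ : Tendsto π (𝓝 p) (𝓝 p) := by
      have : Continuous π := by fun_prop
      simpa [π, hne] using this.tendsto p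
    have hφπ : ∀ q, φ (π q) = φ p₀ := fun q => by simp [π, hv]
    have hst := ((hBa p hp).hasStrictFDerivAt.isLittleO.comp_tendsto
      (tendsto_id.prodMk_nhds hπ : Tendsto (fun q => (q, π q)) (𝓝 p) (𝓝 (p, p))))
    have hfd : ContinuousAt (fun q => fderiv ℂ f q v) p :=
      (hBa p hp).fderiv.continuousAt.clm_apply continuousAt_const
    rw [Metric.continuousAt_iff']
    intro ε hε
    have hε' : 0 < ε / (2 * (‖v‖ + 1)) := by positivity
    filter_upwards [hst.def hε', Metric.continuousAt_iff'.1 hfd ε hε, hBo.mem_nhds hp,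
      hπ.eventually_mem (hBo.mem_nhds hp)] with q h1 h2 h3 h4
    have hgp : g p = fderiv ℂ f p v := if_pos hne
    rw [hgp]
    by_cases hq : φ q = φ p₀
    · have : g q = fderiv ℂ f q v := if_pos hq
      rw [this]
      exact h2
    · have hgq : g q = f q / (φ q - φ p₀) := if_neg hq
      have hq' := sub_ne_zero.2 hq
      simp only [Function.comp, hB0 _ h4 (hφπ q), sub_zero] at h1
      have e1 : q - π q = (φ q - φ p₀) • v := by simp [π]
      simp only [id] at h1
      rw [e1, map_smul, norm_smul, smul_eq_mul] at h1
      rw [hgq, dist_eq_norm]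
      have e2 : f q / (φ q - φ p₀) - fderiv ℂ f p v
          = (φ q - φ p₀)⁻¹ * (f q - (φ q - φ p₀) * fderiv ℂ f p v) := by
        field_simp
      rw [e2, norm_mul, norm_inv]
      have hpos : 0 < ‖φ q - φ p₀‖ := norm_pos_iff.2 hq'
      calc _ ≤ ‖φ q - φ p₀‖⁻¹ * (ε / (2 * (‖v‖ + 1)) * (‖φ q - φ p₀‖ * ‖v‖)) := by gcongr
        _ = ε / 2 * (‖v‖ / (‖v‖ + 1)) := by field_simp
        _ ≤ ε / 2 * 1 := by
          gcongr
          rw [div_le_one (by positivity)]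
          linarith
        _ < ε := by linarith
  refine ⟨g, analyticOnNhd_of_continuousOn_of_lines hBo hcont (fun x hx w => ?_) p₀
    (Metric.mem_ball_self hδ), ?_⟩
  · have hx0 : x + (0 : ℂ) • w = x := by simp
    have hline : ∀ {G : E → ℂ} {z : ℂ}, DifferentiableAt ℂ G (x + z • w) →
        DifferentiableAt ℂ (fun z : ℂ => G (x + z • w)) z := fun {G} z hG =>
      DifferentiableAt.comp z hG (by fun_prop)
    by_cases hne : φ x = φ p₀
    swap
    · exact hline (by rw [hx0]; exact hoff x hx hne)
    -- A line through a point of the hyperplane either stays in it, where `g` is a derivative of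
    -- `f`, or meets it only there, and then the singularity is removable by continuity.
    by_cases hw : φ w = 0
    · have : (fun z : ℂ => g (x + z • w)) = fun z : ℂ => fderiv ℂ f (x + z • w) v := by
        funext z
        exact if_pos (by simp [hw, hne])
      rw [this]
      refine hline (G := fun y => fderiv ℂ f y v) ?_
      rw [hx0]
      exact (hBa x hx).fderiv.differentiableAt.clm_apply (differentiableAt_const v)
    · refine (Complex.analyticAt_of_differentiable_on_punctured_nhds_of_continuousAt ?_
        ?_).differentiableAt
      · have hmem : ∀ᶠ z in 𝓝 (0 : ℂ), x + z • w ∈ B :=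
          (isOpen_line_preimage hBo x w).mem_nhds (by simpa using hx)
        filter_upwards [hmem.filter_mono nhdsWithin_le_nhds, self_mem_nhdsWithin] with z h1 h2
        refine hline (hoff _ h1 ?_)
        simpa [hne, hw] using h2
      · refine ContinuousAt.comp (g := g) (f := fun z : ℂ => x + z • w) ?_ (by fun_prop)
        rw [hx0]
        exact hcont.continuousAt (hBo.mem_nhds hx)
  · filter_upwards [hBo.mem_nhds (Metric.mem_ball_self hδ)] with p hp
    by_cases hne : φ p = φ p₀
    · rw [hB0 p hp hne, hne, sub_self, zero_mul]
    · have hgq : g p = f p / (φ p - φ p₀) := if_neg hne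
      rw [hgq, mul_div_cancel₀ _ (sub_ne_zero.2 hne)]

/-- Local quotients agree wherever `lam` does not vanish. Such points exist arbitrarily near every
point, so by continuity the quotients agree on overlaps and glue. -/
theorem exists_analyticOnNhd_div {f lam : E → ℂ}
    (hlam : ∀ p ∈ U, ∃ᶠ q in 𝓝 p, lam q ≠ 0) (hU : IsOpen U)
    (hloc : ∀ p ∈ U, ∃ g : E → ℂ, AnalyticAt ℂ g p ∧ ∀ᶠ q in 𝓝 p, f q = lam q * g q) :
    ∃ G : E → ℂ, AnalyticOnNhd ℂ G U ∧ ∀ p ∈ U, f p = lam p * G p := by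
  choose! g hg hfg using hloc
  refine ⟨fun p => g p p, fun p hp => ?_, fun p hp => (hfg p hp).self_of_nhds⟩
  refine (hg p hp).congr ?_
  filter_upwards [hU.mem_nhds hp, (hfg p hp).eventually_nhds, (hg p hp).eventually_analyticAt]
    with q hq h1 h2
  by_contra hne
  have h3 : ∀ᶠ x in 𝓝 q, g p x ≠ g q x := by
    have := (h2.continuousAt.sub (hg q hq).continuousAt).eventually_ne (sub_ne_zero.2 hne)
    filter_upwards [this] with x hx
    exact sub_ne_zero.1 hx
  obtain ⟨x, hx1, hx2, hx3, hx4⟩ := ((hlam q hq).and_eventually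
    (h3.and (h1.and (hfg q hq)))).exists
  rw [hx3] at hx4
  exact hx2 (mul_left_cancel₀ hx1 hx4)

/-! ### Division by `sin (π φ)`. -/

theorem sin_pi_mul_eq_zero_iff (z : ℂ) :
    Complex.sin (Real.pi * z) = 0 ↔ ∃ n : ℤ, z = n := by
  have hpi : (Real.pi : ℂ) ≠ 0 := by exact_mod_cast Real.pi_ne_zero
  rw [Complex.sin_eq_zero_iff]
  refine exists_congr fun n => ?_
  rw [mul_comm (n : ℂ), mul_right_inj' hpi]

theorem eventually_sin_pi_mul_add_ne_zero (z : ℂ) :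
    ∀ᶠ w in 𝓝[≠] (0 : ℂ), Complex.sin (Real.pi * (z + w)) ≠ 0 := by
  have han : AnalyticAt ℂ (fun w : ℂ => Complex.sin (Real.pi * (z + w))) 0 := by fun_prop
  rcases han.eventually_eq_zero_or_eventually_ne_zero with h | h
  · exfalso
    have hA : AnalyticOnNhd ℂ (fun w : ℂ => Complex.sin (Real.pi * (z + w))) Set.univ :=
      fun w _ => by fun_prop
    have := hA.eqOn_zero_of_preconnected_of_eventuallyEq_zero isPreconnected_univ
      (Set.mem_univ 0) h (Set.mem_univ (1 / 2 - z))
    have h2 : (Real.pi : ℂ) * (z + (1 / 2 - z)) = Real.pi / 2 := by ring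
    simp only [h2, Complex.sin_pi_div_two, Pi.zero_apply, one_ne_zero] at this
  · exact h

/-- The zeros of `sin (π z)` are simple: near each of them the sine is a linear factor times a
function without zeros, so division by the linear factor suffices. -/
theorem exists_analyticOnNhd_div_sin [FiniteDimensional ℂ E] {f : E → ℂ} (hU : IsOpen U)
    {v : E} {φ : E →L[ℂ] ℂ} (hv : φ v = 1) (hf : AnalyticOnNhd ℂ f U)
    (h0 : ∀ p ∈ U, ∀ n : ℤ, φ p = n → f p = 0) :
    ∃ G : E → ℂ, AnalyticOnNhd ℂ G U ∧ ∀ p ∈ U, f p = Complex.sin (Real.pi * φ p) * G p := by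
  refine exists_analyticOnNhd_div (lam := fun p => Complex.sin (Real.pi * φ p)) (fun p _ => ?_)
    hU fun p hp => ?_
  · have h1 := (eventually_sin_pi_mul_add_ne_zero (φ p)).frequently
    have h2 : Tendsto (fun z : ℂ => p + z • v) (𝓝[≠] 0) (𝓝 p) := by
      have : Continuous fun z : ℂ => p + z • v := by fun_prop
      simpa using (this.tendsto 0).mono_left nhdsWithin_le_nhds
    refine h2.frequently (h1.mono fun z hz => ?_)
    simpa [hv] using hz
  · have hφ : AnalyticAt ℂ (fun q => φ q) p := φ.analyticAt p
    by_cases hs : Complex.sin (Real.pi * φ p) = 0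
    · obtain ⟨n, hn⟩ := (sin_pi_mul_eq_zero_iff _).1 hs
      obtain ⟨g, hg, hfg⟩ := exists_analyticAt_div_linear hv (hf p hp)
        (by filter_upwards [hU.mem_nhds hp] with q hq h using h0 q hq n (h.trans hn))
      let σ : ℂ → ℂ := fun z => Complex.sin (Real.pi * z)
      let s : ℂ → ℂ := dslope σ (φ p)
      have hσ : Differentiable ℂ σ := by fun_prop
      have hs : AnalyticAt ℂ s (φ p) := by
        have : DifferentiableOn ℂ s Set.univ :=
          (Complex.differentiableOn_dslope univ_mem).2 hσ.differentiableOn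
        exact this.analyticAt univ_mem
      have hs0 : s (φ p) ≠ 0 := by
        have h1 : HasDerivAt σ (Complex.cos (Real.pi * φ p) * Real.pi) (φ p) := by
          have := ((hasDerivAt_id (φ p)).const_mul (Real.pi : ℂ)).csin
          simpa using this
        simp only [s, dslope_same, h1.deriv]
        refine mul_ne_zero (fun hc => ?_) (by exact_mod_cast Real.pi_ne_zero)
        have := Complex.sin_sq_add_cos_sq (Real.pi * φ p)
        rw [hc, ‹Complex.sin (Real.pi * φ p) = 0›] at this
        norm_num at this
      have hsφ : AnalyticAt ℂ (fun q => s (φ q)) p := AnalyticAt.fun_comp hs hφ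
      refine ⟨fun q => g q / s (φ q), hg.fun_div hsφ hs0, ?_⟩
      filter_upwards [hfg, hsφ.continuousAt.eventually_ne hs0] with q h1 h2
      have h3 : σ (φ q) = (φ q - φ p) * s (φ q) := by
        have := sub_smul_dslope σ (φ p) (φ q)
        rw [smul_eq_mul] at this
        change _ = (φ q - φ p) * dslope σ (φ p) (φ q)
        rw [this]
        simp only [σ, ‹Complex.sin (Real.pi * φ p) = 0›, sub_zero]
      change f q = σ (φ q) * _
      rw [h1, h3]
      field_simp
    · have hsin : AnalyticAt ℂ (fun q => Complex.sin (Real.pi * φ q)) p := by fun_prop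
      refine ⟨fun q => f q / Complex.sin (Real.pi * φ q), (hf p hp).fun_div hsin hs, ?_⟩
      filter_upwards [hsin.continuousAt.eventually_ne hs] with q hq
      rw [mul_div_cancel₀ _ hq]

end

/-! ### Bounds for the coefficients -/

/-- The ratio test, uniformly on `K`; the sum of the first bounds covers the indices before the
ratio estimate sets in. -/
theorem exists_bound_of_ratio {X : Type*} {K : Set X} {f : ℕ → X → ℂ} {q : ℝ} (hq : 1 ≤ q)
    {n₀ : ℕ} (hb : ∀ n, ∃ C : ℝ, ∀ x ∈ K, ‖f n x‖ ≤ C)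
    (hr : ∀ n ≥ n₀, ∀ x ∈ K, ‖f (n + 1) x‖ ≤ q * ‖f n x‖) :
    ∃ C ≥ 0, ∀ n, ∀ x ∈ K, ‖f n x‖ ≤ C * q ^ n := by
  choose B hB using hb
  have hC : 0 ≤ ∑ i ∈ Finset.range (n₀ + 1), |B i| := Finset.sum_nonneg fun _ _ => abs_nonneg _
  refine ⟨∑ i ∈ Finset.range (n₀ + 1), |B i|, hC, fun n x hx => ?_⟩
  have hsmall : ∀ n ≤ n₀, ‖f n x‖ ≤ (∑ i ∈ Finset.range (n₀ + 1), |B i|) * q ^ n := by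
    intro n hn
    calc ‖f n x‖ ≤ |B n| := (hB n x hx).trans (le_abs_self _)
      _ ≤ ∑ i ∈ Finset.range (n₀ + 1), |B i| :=
        Finset.single_le_sum (f := fun i => |B i|) (fun _ _ => abs_nonneg _)
          (Finset.mem_range.2 (by omega))
      _ ≤ _ := le_mul_of_one_le_right hC (one_le_pow₀ hq)
  rcases le_total n n₀ with hn | hn
  · exact hsmall n hn
  · induction n, hn using Nat.le_induction with
    | base => exact hsmall _ le_rfl
    | succ n hn ih =>
      calc _ ≤ q * ‖f n x‖ := hr n hn x hx
        _ ≤ q * ((∑ i ∈ Finset.range (n₀ + 1), |B i|) * q ^ n) := by gcongr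
        _ = _ := by ring

theorem inv_Gamma_eq (s : ℂ) : (Complex.Gamma s)⁻¹ = s * (Complex.Gamma (s + 1))⁻¹ :=
  Complex.one_div_Gamma_eq_self_mul_one_div_Gamma_add_one s

theorem continuous_inv_Gamma : Continuous fun s : ℂ => (Complex.Gamma s)⁻¹ :=
  Complex.differentiable_one_div_Gamma.continuous

/-- By the functional equation, `n! / Γ(w + n)` has successive ratios `(n + 1) / (w + n)`, which
tend to 1 uniformly on compact sets. Hence any `q > 1` serves. -/
theorem exists_bound_inv_Gamma_add {K : Set ℂ} (hK : IsCompact K) {q : ℝ} (hq : 1 < q) :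
    ∃ C ≥ 0, ∀ n : ℕ, ∀ w ∈ K, ‖(Complex.Gamma (w + n))⁻¹‖ ≤ C * q ^ n / n.factorial := by
  obtain ⟨M, hM⟩ := hK.exists_bound_of_continuousOn continuousOn_id
  -- From here on `n + 1 ≤ q * (n - |M|)`, while `‖w‖ ≤ |M|` on `K`.
  obtain ⟨n₀, hn₀⟩ := exists_nat_gt ((1 + q * |M|) / (q - 1))
  have hq1 : 0 < q - 1 := by linarith
  rw [div_lt_iff₀ hq1] at hn₀
  have hr : ∀ n ≥ n₀, ∀ w ∈ K, ‖(Complex.Gamma (w + (n + 1 : ℕ)))⁻¹ * ((n + 1).factorial : ℂ)‖ ≤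
      q * ‖(Complex.Gamma (w + n))⁻¹ * (n.factorial : ℂ)‖ := by
    intro n hn w hw
    have hn' : (n₀ : ℝ) ≤ n := by exact_mod_cast hn
    have hMw : ‖w‖ ≤ |M| := (hM w hw).trans (le_abs_self _)
    have h1 : ‖w + n‖ ≥ n - |M| := by
      have := norm_sub_norm_le (n : ℂ) (-w)
      rw [norm_neg, sub_neg_eq_add, Complex.norm_natCast, add_comm] at this
      linarith
    have h2 : (n : ℝ) + 1 ≤ q * (n - |M|) := by nlinarith
    have h3 : 0 < (n : ℝ) - |M| := by
      have : (0 : ℝ) < n + 1 := by positivity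
      by_contra hcon
      nlinarith
    have h4 : (w + n) * ((Complex.Gamma (w + (n + 1 : ℕ)))⁻¹ * ((n + 1).factorial : ℂ))
        = (n + 1) * ((Complex.Gamma (w + n))⁻¹ * (n.factorial : ℂ)) := by
      rw [inv_Gamma_eq (w + n), Nat.factorial_succ]
      push_cast
      rw [add_assoc]
      ring
    have h5 := congrArg norm h4
    rw [norm_mul, norm_mul ((n : ℂ) + 1)] at h5
    have h6 : ‖(n : ℂ) + 1‖ = n + 1 := by
      rw [← Nat.cast_succ, Complex.norm_natCast, Nat.cast_succ]
    rw [h6] at h5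
    refine le_of_mul_le_mul_left ?_ h3
    calc _ ≤ ‖w + n‖ * ‖(Complex.Gamma (w + (n + 1 : ℕ)))⁻¹ * ((n + 1).factorial : ℂ)‖ := by
          gcongr
      _ = _ := h5
      _ ≤ q * (n - |M|) * ‖(Complex.Gamma (w + n))⁻¹ * (n.factorial : ℂ)‖ := by gcongr
      _ = _ := by ring
  obtain ⟨C, hC, h⟩ := exists_bound_of_ratio (K := K) (n₀ := n₀)
    (f := fun n w => (Complex.Gamma (w + n))⁻¹ * n.factorial) hq.le
    (fun n => hK.exists_bound_of_continuousOn (Continuous.continuousOn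
      ((continuous_inv_Gamma.comp (by fun_prop : Continuous fun w : ℂ => w + n)).mul
      continuous_const))) hr
  refine ⟨C, hC, fun n w hw => ?_⟩
  rw [le_div_iff₀ (by positivity)]
  simpa using h n w hw

/-- To the left `1 / Γ` grows like a factorial: after division by `n!` the ratios are `(w - (n + 1))
/ (n + 1)`, of modulus tending to 1. -/
theorem exists_bound_inv_Gamma_sub {K : Set ℂ} (hK : IsCompact K) {q : ℝ} (hq : 1 < q) :
    ∃ C ≥ 0, ∀ n : ℕ, ∀ w ∈ K, ‖(Complex.Gamma (w - n))⁻¹‖ ≤ C * q ^ n * n.factorial := by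
  obtain ⟨M, hM⟩ := hK.exists_bound_of_continuousOn continuousOn_id
  obtain ⟨n₀, hn₀⟩ := exists_nat_gt (|M| / (q - 1))
  have hq1 : 0 < q - 1 := by linarith
  rw [div_lt_iff₀ hq1] at hn₀
  have hr : ∀ n ≥ n₀, ∀ w ∈ K, ‖(Complex.Gamma (w - (n + 1 : ℕ)))⁻¹ * ((n + 1).factorial : ℂ)⁻¹‖ ≤
      q * ‖(Complex.Gamma (w - n))⁻¹ * (n.factorial : ℂ)⁻¹‖ := by
    intro n hn w hw
    have hn' : (n₀ : ℝ) ≤ n := by exact_mod_cast hn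
    have hMw : ‖w‖ ≤ |M| := (hM w hw).trans (le_abs_self _)
    have h6 : ‖(n : ℂ) + 1‖ = n + 1 := by
      rw [← Nat.cast_succ, Complex.norm_natCast, Nat.cast_succ]
    have h1 : ‖w - (n + 1)‖ ≤ q * (n + 1) := by
      calc _ ≤ ‖w‖ + ‖(n : ℂ) + 1‖ := norm_sub_le _ _
        _ ≤ _ := by rw [h6]; nlinarith
    have h4 : ((n : ℂ) + 1) * ((Complex.Gamma (w - (n + 1 : ℕ)))⁻¹ * ((n + 1).factorial : ℂ)⁻¹)
        = (w - (n + 1)) * ((Complex.Gamma (w - n))⁻¹ * (n.factorial : ℂ)⁻¹) := by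
      rw [inv_Gamma_eq (w - (n + 1 : ℕ)), Nat.factorial_succ]
      push_cast
      rw [show w - ((n : ℂ) + 1) + 1 = w - n by ring]
      have : (n : ℂ) + 1 ≠ 0 := by exact_mod_cast Nat.succ_ne_zero n
      field_simp
    have h5 := congrArg norm h4
    rw [norm_mul, norm_mul (w - ((n : ℂ) + 1)), h6] at h5
    refine le_of_mul_le_mul_left ?_ (by positivity : (0 : ℝ) < n + 1)
    calc _ = _ := h5
      _ ≤ q * (n + 1) * ‖(Complex.Gamma (w - n))⁻¹ * (n.factorial : ℂ)⁻¹‖ := by gcongr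
      _ = _ := by ring
  obtain ⟨C, hC, h⟩ := exists_bound_of_ratio (K := K) (n₀ := n₀)
    (f := fun n w => (Complex.Gamma (w - n))⁻¹ * (n.factorial : ℂ)⁻¹) hq.le
    (fun n => hK.exists_bound_of_continuousOn (Continuous.continuousOn
      ((continuous_inv_Gamma.comp (by fun_prop : Continuous fun w : ℂ => w - n)).mul
      continuous_const))) hr
  refine ⟨C, hC, fun n w hw => ?_⟩
  have := h n w hw
  rw [norm_mul, norm_inv (n.factorial : ℂ), Complex.norm_natCast, ← div_eq_mul_inv,
    div_le_iff₀ (by positivity)] at this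
  exact this

theorem factorial_div_eq_multinomial {m : ℕ} (n : Fin m → ℕ) :
    ((∑ k, n k).factorial : ℝ) / ∏ k, ((n k).factorial : ℝ) =
      (Nat.multinomial Finset.univ n : ℝ) := by
  rw [div_eq_iff (Finset.prod_ne_zero_iff.2 fun k _ => by positivity), mul_comm]
  exact_mod_cast (Nat.multinomial_spec Finset.univ n).symm

/-- By the multinomial theorem the unsquared terms of degree `N` add up to `(∑ ρ_k) ^ N ≤ 1`. So
each of them is at most 1, squaring does not increase them, and a geometric series dominates. With
`ρ_k` slightly above `√|x_k|` this is the majorant of the Frobenius series, which explains the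
square roots in `D_C`. -/
theorem summable_multinomial_sq {m : ℕ} {ρ : Fin m → ℝ} (h0 : ∀ k, 0 ≤ ρ k) (h1 : ∑ k, ρ k < 1) :
    Summable fun n : Fin m → ℕ =>
      (((∑ k, n k).factorial : ℝ) / (∏ k, ((n k).factorial : ℝ)) * ∏ k, ρ k ^ n k) ^ 2 := by
  simp only [factorial_div_eq_multinomial]
  set g : (Fin m → ℕ) → ℝ := fun n => (Nat.multinomial Finset.univ n : ℝ) * ∏ k, ρ k ^ n k
  have hg0 : ∀ n, 0 ≤ g n := fun n =>
    mul_nonneg (Nat.cast_nonneg _) (Finset.prod_nonneg fun k _ => pow_nonneg (h0 k) _)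
  have hS : 0 ≤ ∑ k, ρ k := Finset.sum_nonneg fun k _ => h0 k
  have hsum : ∀ N, ∑ n ∈ Finset.univ.piAntidiag N, g n = (∑ k, ρ k) ^ N := fun N =>
    (Finset.sum_pow_eq_sum_piAntidiag Finset.univ ρ N).symm
  have hmem : ∀ n : Fin m → ℕ, n ∈ Finset.univ.piAntidiag (∑ k, n k) := fun n => by
    simp [Finset.mem_piAntidiag]
  have hg1 : ∀ n, g n ≤ 1 := fun n => by
    calc g n ≤ ∑ n ∈ Finset.univ.piAntidiag (∑ k, n k), g n :=
          Finset.single_le_sum (fun n _ => hg0 n) (hmem n)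
      _ = _ := hsum _
      _ ≤ 1 := pow_le_one₀ hS h1.le
  have hgs : Summable g := by
    refine summable_of_sum_le hg0 (c := (1 - ∑ k, ρ k)⁻¹) fun u => ?_
    let N := u.sup fun n => ∑ k, n k
    calc ∑ n ∈ u, g n ≤ ∑ n ∈ (Finset.range (N + 1)).biUnion fun i =>
          Finset.univ.piAntidiag i, g n := by
          refine Finset.sum_le_sum_of_subset_of_nonneg (fun n hn => ?_) fun n _ _ => hg0 n
          rw [Finset.mem_biUnion]
          exact ⟨_, Finset.mem_range.2 (Nat.lt_succ_of_le
            (Finset.le_sup (f := fun n : Fin m → ℕ => ∑ k, n k) hn)), hmem n⟩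
      _ = ∑ i ∈ Finset.range (N + 1), (∑ k, ρ k) ^ i := by
          rw [Finset.sum_biUnion]
          · exact Finset.sum_congr rfl fun i _ => hsum i
          · intro i _ j _ hij
            rw [Function.onFun, Finset.disjoint_left]
            intro n h1 h2
            rw [Finset.mem_piAntidiag] at h1 h2
            exact hij (h1.1.symm.trans h2.1)
      _ ≤ ∑' i, (∑ k, ρ k) ^ i :=
          (summable_geometric_of_lt_one hS h1).sum_le_tsum _ fun i _ => pow_nonneg hS i
      _ = _ := tsum_geometric_of_lt_one hS h1
  refine Summable.of_nonneg_of_le (fun n => sq_nonneg _) (fun n => ?_) hgs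
  rw [sq]
  exact mul_le_of_le_one_left (hg0 n) (hg1 n)

/-! ### Frobenius series in logarithmic coordinates -/

/-- The domain `D_C` in the logarithmic coordinates `t_k = log x_k`. -/
def logDomain (m : ℕ) : Set (Fin m → ℂ) :=
  {t | ∑ k, Real.exp ((t k).re / 2) < 1}

/-- Pairs of a parameter vector and a point of `logDomain`. -/
def totalDomain (m : ℕ) : Set ((Fin m → ℂ) × (Fin m → ℂ)) :=
  {p | p.2 ∈ logDomain m}

theorem isOpen_logDomain (m : ℕ) : IsOpen (logDomain m) :=
  isOpen_lt (by fun_prop) continuous_const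

theorem isOpen_totalDomain (m : ℕ) : IsOpen (totalDomain m) :=
  (isOpen_logDomain m).preimage continuous_snd

/-- The exponents `s_k = n_k + j_k (1 - c_k)`. -/
def frobExp {m : ℕ} (J : Fin m → Fin 2) (n : Fin m → ℕ) (c : Fin m → ℂ) (k : Fin m) : ℂ :=
  n k + ((J k : ℕ) : ℂ) * (1 - c k)

/-- The coefficients of the normalized Frobenius series; they are entire in `c`. -/
def frobCoef {m : ℕ} (a b : ℂ) (J : Fin m → Fin 2) (n : Fin m → ℕ) (c : Fin m → ℂ) : ℂ :=
  (Complex.Gamma (1 - a - ∑ k, frobExp J n c k))⁻¹ *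
    (Complex.Gamma (1 - b - ∑ k, frobExp J n c k))⁻¹ *
    ∏ k, ((Complex.Gamma (c k + frobExp J n c k))⁻¹ * (Complex.Gamma (1 + frobExp J n c k))⁻¹)

/-- The terms of the normalized Frobenius series. -/
def frobTerm {m : ℕ} (a b : ℂ) (J : Fin m → Fin 2) (n : Fin m → ℕ)
    (p : (Fin m → ℂ) × (Fin m → ℂ)) : ℂ :=
  frobCoef a b J n p.1 * Complex.exp (∑ k, frobExp J n p.1 k * p.2 k)

/-- The normalized Frobenius series, as a function of the parameters and the logarithms of the
variables. -/
def frobSer {m : ℕ} (a b : ℂ) (J : Fin m → Fin 2) (p : (Fin m → ℂ) × (Fin m → ℂ)) : ℂ :=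
  ∑' n, frobTerm a b J n p

theorem analyticAt_inv_Gamma (s : ℂ) : AnalyticAt ℂ (fun s : ℂ => (Complex.Gamma s)⁻¹) s :=
  Complex.differentiable_one_div_Gamma.analyticAt s

theorem frobTerm_analyticAt {m : ℕ} (a b : ℂ) (J : Fin m → Fin 2) (n : Fin m → ℕ)
    (p : (Fin m → ℂ) × (Fin m → ℂ)) : AnalyticAt ℂ (frobTerm a b J n) p := by
  have h1 : ∀ k, AnalyticAt ℂ (fun p : (Fin m → ℂ) × (Fin m → ℂ) => p.1 k) p := fun k =>
    ((ContinuousLinearMap.proj (R := ℂ) (φ := fun _ : Fin m => ℂ) k).comp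
      (ContinuousLinearMap.fst ℂ _ _)).analyticAt p
  have h2 : ∀ k, AnalyticAt ℂ (fun p : (Fin m → ℂ) × (Fin m → ℂ) => p.2 k) p := fun k =>
    ((ContinuousLinearMap.proj (R := ℂ) (φ := fun _ : Fin m => ℂ) k).comp
      (ContinuousLinearMap.snd ℂ _ _)).analyticAt p
  have he : ∀ k, AnalyticAt ℂ
      (fun p : (Fin m → ℂ) × (Fin m → ℂ) => frobExp J n p.1 k) p := fun k =>
    analyticAt_const.add (analyticAt_const.mul (analyticAt_const.sub (h1 k)))
  have hs : AnalyticAt ℂ (fun p : (Fin m → ℂ) × (Fin m → ℂ) => ∑ k, frobExp J n p.1 k) p :=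
    Finset.analyticAt_fun_sum _ fun k _ => he k
  unfold frobTerm frobCoef
  refine AnalyticAt.fun_mul (AnalyticAt.fun_mul (AnalyticAt.fun_mul ?_ ?_) ?_) ?_
  · exact AnalyticAt.fun_comp (g := fun s : ℂ => (Complex.Gamma s)⁻¹) (analyticAt_inv_Gamma _) (analyticAt_const.sub hs)
  · exact AnalyticAt.fun_comp (g := fun s : ℂ => (Complex.Gamma s)⁻¹) (analyticAt_inv_Gamma _) (analyticAt_const.sub hs)
  · refine Finset.analyticAt_fun_prod _ fun k _ => AnalyticAt.fun_mul ?_ ?_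
    · exact AnalyticAt.fun_comp (g := fun s : ℂ => (Complex.Gamma s)⁻¹) (analyticAt_inv_Gamma _) ((h1 k).add (he k))
    · exact AnalyticAt.fun_comp (g := fun s : ℂ => (Complex.Gamma s)⁻¹) (analyticAt_inv_Gamma _) (analyticAt_const.add (he k))
  · exact (Finset.analyticAt_fun_sum _ fun k _ => (he k).mul (h2 k)).cexp

theorem sum_frobExp {m : ℕ} (J : Fin m → Fin 2) (n : Fin m → ℕ) (c : Fin m → ℂ) :
    ∑ k, frobExp J n c k = (∑ k, n k : ℕ) + ∑ k, ((J k : ℕ) : ℂ) * (1 - c k) := by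
  simp [frobExp, Finset.sum_add_distrib]

/-- The base point of the shifted reciprocal Gamma factor in one variable. -/
def gammaBase (j : Fin 2) (z : ℂ) : ℂ := if j = 0 then z else 2 - z

/-- For `j_k = 0` the argument `1 + s_k`, and for `j_k = 1` the argument `c_k + s_k`, equals `1 +
n_k` and contributes a factorial. -/
theorem gamma_factor_eq {m : ℕ} (J : Fin m → Fin 2) (n : Fin m → ℕ) (c : Fin m → ℂ) (k : Fin m) :
    (Complex.Gamma (c k + frobExp J n c k))⁻¹ * (Complex.Gamma (1 + frobExp J n c k))⁻¹
      = (Complex.Gamma (gammaBase (J k) (c k) + n k))⁻¹ * ((n k).factorial : ℂ)⁻¹ := by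
  have hfac : Complex.Gamma (1 + (n k : ℂ)) = (n k).factorial := by
    rw [add_comm, Complex.Gamma_nat_eq_factorial]
  unfold frobExp gammaBase
  generalize J k = j
  fin_cases j
  · simp [hfac]
  · have e1 : c k + (n k + ((1 : ℕ) : ℂ) * (1 - c k)) = 1 + n k := by push_cast; ring
    have e2 : 1 + (n k + ((1 : ℕ) : ℂ) * (1 - c k)) = 2 - c k + n k := by push_cast; ring
    simp only [Fin.mk_one, e1, e2, hfac, one_ne_zero, if_false]
    rw [mul_comm]

/-- The Gamma bounds reduce a term to `(N! / ∏ n_k!)² ∏ |x_k| ^ n_k`, with `N = ∑ n_k`, up to a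
factor that is geometric in `N`. The strict inequality in the domain leaves room for that factor,
uniformly near `(c, t)`. -/
theorem locNormal_frobTerm {m : ℕ} (a b : ℂ) (J : Fin m → Fin 2) :
    LocNormal (totalDomain m) (frobTerm a b J) := by
  intro p₀ hp₀
  set y : Fin m → ℝ := fun k => Real.exp ((p₀.2 k).re / 2) with hy
  have hy0 : ∀ k, 0 < y k := fun k => Real.exp_pos _
  have hS1 : ∑ k, y k < 1 := hp₀
  set S := ∑ k, y k
  have hS0 : 0 ≤ S := Finset.sum_nonneg fun k _ => (hy0 k).le
  -- The room is `ρ = σ ^ 2 = q ^ 4 > 1` with `ρ * S < 1`. One factor `σ` pays for moving `t` in the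
  -- ball of radius `2 log σ`, the other for the three Gamma bounds, which cost `q ^ (3 * N) ≤ (σ ^
  -- N) ^ 2`.
  set ρ : ℝ := 2 / (1 + S)
  have hρ1 : 1 < ρ := by rw [lt_div_iff₀ (by linarith)]; linarith
  have hρS : ρ * S < 1 := by
    rw [div_mul_eq_mul_div, div_lt_one (by linarith)]; linarith
  set σ := Real.sqrt ρ
  have hσ1 : 1 < σ := by rw [Real.lt_sqrt (by norm_num)]; linarith
  have hσ2 : σ ^ 2 = ρ := Real.sq_sqrt (by linarith)
  set q := Real.sqrt σ
  have hq1 : 1 < q := by rw [Real.lt_sqrt (by norm_num)]; linarith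
  have hq2 : q ^ 2 = σ := Real.sq_sqrt (by linarith)
  have hδ : 0 < 2 * Real.log σ := mul_pos two_pos (Real.log_pos hσ1)
  set K := Metric.closedBall p₀ (2 * Real.log σ)
  have hK : IsCompact K := isCompact_closedBall _ _
  obtain ⟨C₁, hC₁⟩ := hK.exists_bound_of_continuousOn
    (f := fun p : (Fin m → ℂ) × (Fin m → ℂ) =>
      Complex.exp (∑ k, ((J k : ℕ) : ℂ) * (1 - p.1 k) * p.2 k))
    (Continuous.continuousOn (by fun_prop))
  obtain ⟨Ca, hCa0, hCa⟩ := exists_bound_inv_Gamma_sub (hK.image (f :=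
    fun p : (Fin m → ℂ) × (Fin m → ℂ) => 1 - a - ∑ k, ((J k : ℕ) : ℂ) * (1 - p.1 k))
    (by fun_prop)) hq1
  obtain ⟨Cb, hCb0, hCb⟩ := exists_bound_inv_Gamma_sub (hK.image (f :=
    fun p : (Fin m → ℂ) × (Fin m → ℂ) => 1 - b - ∑ k, ((J k : ℕ) : ℂ) * (1 - p.1 k))
    (by fun_prop)) hq1
  have hCk : ∀ k, ∃ C ≥ 0, ∀ n : ℕ, ∀ p ∈ K,
      ‖(Complex.Gamma (gammaBase (J k) (p.1 k) + n))⁻¹‖ ≤ C * q ^ n / n.factorial := by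
    intro k
    obtain ⟨C, hC, h⟩ := exists_bound_inv_Gamma_add (hK.image (f :=
      fun p : (Fin m → ℂ) × (Fin m → ℂ) => gammaBase (J k) (p.1 k)) (by
        unfold gammaBase
        split_ifs <;> fun_prop)) hq1
    exact ⟨C, hC, fun n p hp => h n _ (Set.mem_image_of_mem _ hp)⟩
  choose Ck hCk0 hCk using hCk
  refine ⟨K, Metric.closedBall_mem_nhds _ hδ, fun n => Ca * Cb * (∏ k, Ck k) * C₁ *
    (((∑ k, n k).factorial : ℝ) / (∏ k, ((n k).factorial : ℝ)) * ∏ k, (ρ * y k) ^ n k) ^ 2,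
    (summable_multinomial_sq (fun k => by have := hy0 k; positivity) (by
      rw [← Finset.mul_sum]; exact hρS)).mul_left _, fun n p hp => ?_⟩
  set N := ∑ k, n k
  have hre : ∀ k, Real.exp ((p.2 k).re / 2) ≤ σ * y k := fun k => by
    have h1 : ‖p.2 k - p₀.2 k‖ ≤ 2 * Real.log σ := by
      have h2 : ‖p.2 - p₀.2‖ ≤ ‖p - p₀‖ := norm_snd_le (p - p₀)
      exact (norm_le_pi_norm (p.2 - p₀.2) k).trans (h2.trans (mem_closedBall_iff_norm.1 hp))
    have h3 := (Complex.abs_re_le_norm (p.2 k - p₀.2 k)).trans h1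
    have h4 := (abs_le.1 h3).2
    rw [Complex.sub_re] at h4
    calc _ ≤ Real.exp (Real.log σ + (p₀.2 k).re / 2) := Real.exp_le_exp.2 (by linarith)
      _ = _ := by rw [Real.exp_add, Real.exp_log (by linarith)]
  have hexp : Complex.exp (∑ k, frobExp J n p.1 k * p.2 k) =
      (∏ k, Complex.exp (p.2 k) ^ n k) *
        Complex.exp (∑ k, ((J k : ℕ) : ℂ) * (1 - p.1 k) * p.2 k) := by
    simp only [← Complex.exp_nat_mul, ← Complex.exp_sum, ← Complex.exp_add,
      ← Finset.sum_add_distrib, frobExp, add_mul]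
  have hexpn : ‖∏ k, Complex.exp (p.2 k) ^ n k‖ ≤ (∏ k, (σ * y k) ^ n k) ^ 2 := by
    rw [norm_prod, ← Finset.prod_pow]
    refine Finset.prod_le_prod (fun _ _ => norm_nonneg _) fun k _ => ?_
    have : ‖Complex.exp (p.2 k)‖ = Real.exp ((p.2 k).re / 2) ^ 2 := by
      rw [Complex.norm_exp, ← Real.exp_nat_mul]
      congr 1
      push_cast
      ring
    rw [norm_pow, this, ← pow_mul, ← pow_mul, mul_comm (n k)]
    exact pow_le_pow_left₀ (Real.exp_pos _).le (hre k) _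
  have hG : ‖∏ k, ((Complex.Gamma (p.1 k + frobExp J n p.1 k))⁻¹ *
      (Complex.Gamma (1 + frobExp J n p.1 k))⁻¹)‖ ≤
      (∏ k, Ck k) * q ^ N * (1 / ∏ k, ((n k).factorial : ℝ)) ^ 2 := by
    rw [norm_prod, ← Finset.prod_pow_eq_pow_sum, one_div, ← Finset.prod_inv_distrib,
      ← Finset.prod_pow, ← Finset.prod_mul_distrib, ← Finset.prod_mul_distrib]
    refine Finset.prod_le_prod (fun _ _ => norm_nonneg _) fun k _ => ?_
    rw [gamma_factor_eq, norm_mul, norm_inv (_ : ℂ), norm_inv (_ : ℂ), Complex.norm_natCast]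
    have := hCk k (n k) p hp
    rw [norm_inv] at this
    calc _ ≤ Ck k * q ^ n k / (n k).factorial * ((n k).factorial : ℝ)⁻¹ := by gcongr
      _ = _ := by ring
  have hA := hCa N _ (Set.mem_image_of_mem _ hp)
  have hB := hCb N _ (Set.mem_image_of_mem _ hp)
  have eA : ∀ z : ℂ, 1 - z - ∑ k, frobExp J n p.1 k
      = 1 - z - ∑ k, ((J k : ℕ) : ℂ) * (1 - p.1 k) - N := fun z => by
    rw [sum_frobExp]; ring
  have hC₁0 : 0 ≤ C₁ := (norm_nonneg _).trans (hC₁ p hp)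
  have hCkp : 0 ≤ ∏ k, Ck k := Finset.prod_nonneg fun k _ => hCk0 k
  have hq0 : 0 < q := by linarith
  have hσy : ∀ k, 0 ≤ σ * y k := fun k => by have := hy0 k; positivity
  have hP : 0 ≤ ∏ k, (σ * y k) ^ n k := Finset.prod_nonneg fun k _ => pow_nonneg (hσy k) _
  unfold frobTerm frobCoef
  rw [eA, eA, hexp, norm_mul, norm_mul, norm_mul, norm_mul]
  calc _ ≤ (Ca * q ^ N * N.factorial) * (Cb * q ^ N * N.factorial) *
        ((∏ k, Ck k) * q ^ N * (1 / ∏ k, ((n k).factorial : ℝ)) ^ 2) *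
        ((∏ k, (σ * y k) ^ n k) ^ 2 * C₁) := by
        gcongr
        exact hC₁ p hp
    _ = Ca * Cb * (∏ k, Ck k) * C₁ * (q ^ (3 * N) * (N.factorial / (∏ k, ((n k).factorial : ℝ))
        * ∏ k, (σ * y k) ^ n k) ^ 2) := by ring
    _ ≤ Ca * Cb * (∏ k, Ck k) * C₁ * (q ^ (4 * N) * (N.factorial / (∏ k, ((n k).factorial : ℝ))
        * ∏ k, (σ * y k) ^ n k) ^ 2) := by
        gcongr
        · exact hq1.le
        · norm_num
    _ = _ := by
        have h4 : q ^ (4 * N) = (σ ^ N) ^ 2 := by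
          rw [← hq2]; ring
        have h5 : ∏ k, (ρ * y k) ^ n k = σ ^ N * ∏ k, (σ * y k) ^ n k := by
          rw [← Finset.prod_pow_eq_pow_sum, ← Finset.prod_mul_distrib]
          refine Finset.prod_congr rfl fun k _ => ?_
          rw [← mul_pow, ← hσ2]
          ring
        rw [h4]
        simp only [h5]
        ring

theorem frobSer_analyticOnNhd {m : ℕ} (a b : ℂ) (J : Fin m → Fin 2) :
    AnalyticOnNhd ℂ (frobSer a b J) (totalDomain m) :=
  (locNormal_frobTerm a b J).analyticOnNhd_tsum (isOpen_totalDomain m)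
    fun n p _ => frobTerm_analyticAt a b J n p

/-! ### The differential equations in logarithmic coordinates -/

/-- The partial derivative in the `k`-th coordinate. -/
def pd {m : ℕ} (k : Fin m) (g : (Fin m → ℂ) → ℂ) (t : Fin m → ℂ) : ℂ :=
  fderiv ℂ g t (Pi.single k 1)

/-- The operators of the system `E_C(a, b, c)` in logarithmic coordinates. -/
def opLog {m : ℕ} (a b : ℂ) (c : Fin m → ℂ) (k : Fin m) (g : (Fin m → ℂ) → ℂ) (t : Fin m → ℂ) : ℂ :=
  pd k (pd k g) t + (c k - 1) * pd k g t
    - Complex.exp (t k) * ((∑ i, ∑ j, pd i (pd j g) t) + (a + b) * ∑ i, pd i g t + a * b * g t)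

section

variable {m : ℕ}

theorem pd_congr {f g : (Fin m → ℂ) → ℂ} {t : Fin m → ℂ} (h : f =ᶠ[𝓝 t] g) (k : Fin m) :
    pd k f t = pd k g t := by
  unfold pd
  rw [h.fderiv_eq]

theorem pd_eventuallyEq {f g : (Fin m → ℂ) → ℂ} {t : Fin m → ℂ} (h : f =ᶠ[𝓝 t] g) (k : Fin m) :
    pd k f =ᶠ[𝓝 t] pd k g :=
  h.eventually_nhds.mono fun _ hs => pd_congr hs k

theorem AnalyticAt.pd {g : (Fin m → ℂ) → ℂ} {t : Fin m → ℂ} (hg : AnalyticAt ℂ g t)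
    (k : Fin m) : AnalyticAt ℂ (pd k g) t :=
  ((ContinuousLinearMap.apply ℂ ℂ (Pi.single k (1 : ℂ) : Fin m → ℂ)).analyticAt _).comp hg.fderiv

theorem opLog_congr {f g : (Fin m → ℂ) → ℂ} {t : Fin m → ℂ} (h : f =ᶠ[𝓝 t] g) (a b : ℂ)
    (c : Fin m → ℂ) (k : Fin m) : opLog a b c k f t = opLog a b c k g t := by
  unfold opLog
  simp only [pd_congr h, fun i j => pd_congr (pd_eventuallyEq h j) i, h.self_of_nhds]

variable {ι : Type*} {Ω : Set (Fin m → ℂ)} {f : ι → (Fin m → ℂ) → ℂ}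

theorem LocNormal.hasSum_pd (hΩ : IsOpen Ω) (hf : ∀ i, AnalyticOnNhd ℂ (f i) Ω)
    (hn : LocNormal Ω f) {t : Fin m → ℂ} (ht : t ∈ Ω) (k : Fin m) :
    HasSum (fun i => pd k (f i) t) (pd k (fun t => ∑' i, f i t) t) :=
  hn.hasSum_fderiv hΩ hf ht _

theorem LocNormal.hasSum_pd_pd (hΩ : IsOpen Ω) (hf : ∀ i, AnalyticOnNhd ℂ (f i) Ω)
    (hn : LocNormal Ω f) {t : Fin m → ℂ} (ht : t ∈ Ω) (k l : Fin m) :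
    HasSum (fun i => pd k (pd l (f i)) t) (pd k (pd l fun t => ∑' i, f i t) t) := by
  have h1 : LocNormal Ω fun i => pd l (f i) := hn.fderiv hΩ hf _
  have h2 := h1.hasSum_pd hΩ (fun i t ht => AnalyticAt.pd (hf i t ht) l) ht k
  rwa [pd_congr (g := fun t => ∑' i, pd l (f i) t)]
  filter_upwards [hΩ.mem_nhds ht] with s hs
  exact (hn.hasSum_pd hΩ hf hs l).tsum_eq.symm

theorem tsum_shift {g : (Fin m → ℕ) → ℂ} (k : Fin m) (d : ℕ) (h : ∀ n, n k < d → g n = 0) :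
    ∑' n, g n = ∑' n : Fin m → ℕ, g (n + Pi.single k d) := by
  have hinj : Function.Injective fun n : Fin m → ℕ => n + Pi.single k d := add_left_injective _
  refine (hinj.tsum_eq fun n hn => ?_).symm
  have hd : d ≤ n k := by
    by_contra hlt
    exact hn (h n (not_le.1 hlt))
  refine ⟨n - Pi.single k d, ?_⟩
  ext j
  by_cases hj : j = k
  · subst hj; simp [hd]
  · simp [hj]

end

section

variable {m : ℕ} (a b : ℂ) (J : Fin m → Fin 2) (c : Fin m → ℂ)

theorem frobTerm_slice_analyticAt (n : Fin m → ℕ) (t : Fin m → ℂ) :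
    AnalyticAt ℂ (fun t => frobTerm a b J n (c, t)) t :=
  (frobTerm_analyticAt a b J n (c, t)).comp (analyticAt_const.prod analyticAt_id)

theorem locNormal_frobTerm_slice :
    LocNormal (logDomain m) fun n t => frobTerm a b J n (c, t) := by
  intro t ht
  obtain ⟨V, hV, u, hu, h⟩ := locNormal_frobTerm a b J (c, t) ht
  have hc : Continuous fun t : Fin m → ℂ => (c, t) := by fun_prop
  exact ⟨_, hc.continuousAt.preimage_mem_nhds hV, u, hu, fun n s hs => h n _ hs⟩

theorem pd_const_mul_cexp (A : ℂ) (s : Fin m → ℂ) (k : Fin m) :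
    pd k (fun t => A * Complex.exp (∑ j, s j * t j)) =
      fun t => A * s k * Complex.exp (∑ j, s j * t j) := by
  funext t
  have h1 : HasFDerivAt (fun t : Fin m → ℂ => ∑ j, s j * t j)
      (∑ j, s j • ContinuousLinearMap.proj (R := ℂ) (φ := fun _ : Fin m => ℂ) j) t :=
    HasFDerivAt.fun_sum fun j _ => (ContinuousLinearMap.proj (R := ℂ)
      (φ := fun _ : Fin m => ℂ) j).hasFDerivAt.const_mul (s j)
  unfold pd
  rw [(h1.cexp.const_mul A).fderiv]
  simp [_root_.sum_apply, Pi.single_apply]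
  ring

theorem opLog_left_const_mul_cexp (A : ℂ) (s : Fin m → ℂ) (k : Fin m) (t : Fin m → ℂ) :
    pd k (pd k fun t => A * Complex.exp (∑ j, s j * t j)) t +
      (c k - 1) * pd k (fun t => A * Complex.exp (∑ j, s j * t j)) t =
      s k * (s k + c k - 1) * (A * Complex.exp (∑ j, s j * t j)) := by
  simp only [pd_const_mul_cexp]
  ring

theorem opLog_right_const_mul_cexp (A : ℂ) (s : Fin m → ℂ) (t : Fin m → ℂ) :
    (∑ i, ∑ l, pd i (pd l fun t => A * Complex.exp (∑ j, s j * t j)) t) +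
      (a + b) * ∑ i, pd i (fun t => A * Complex.exp (∑ j, s j * t j)) t +
      a * b * (A * Complex.exp (∑ j, s j * t j)) =
      (∑ j, s j + a) * (∑ j, s j + b) * (A * Complex.exp (∑ j, s j * t j)) := by
  simp only [pd_const_mul_cexp]
  have h1 : ∑ i, A * s i * Complex.exp (∑ j, s j * t j) =
      (∑ i, s i) * (A * Complex.exp (∑ j, s j * t j)) := by
    rw [Finset.sum_mul]
    exact Finset.sum_congr rfl fun i _ => by ring
  have h2 : ∑ i, ∑ l, A * s l * s i * Complex.exp (∑ j, s j * t j) =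
      (∑ i, s i) * (∑ i, s i) * (A * Complex.exp (∑ j, s j * t j)) := by
    rw [Finset.sum_mul_sum, Finset.sum_mul]
    refine Finset.sum_congr rfl fun i _ => ?_
    rw [Finset.sum_mul]
    exact Finset.sum_congr rfl fun l _ => by ring
  rw [h1, h2]
  ring

theorem frobExp_add_single (n : Fin m → ℕ) (k j : Fin m) (d : ℕ) :
    frobExp J (n + Pi.single k d) c j = frobExp J n c j + (Pi.single k (d : ℂ) : Fin m → ℂ) j := by
  unfold frobExp
  by_cases h : j = k
  · subst h
    simp only [Pi.add_apply, Pi.single_eq_same]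
    push_cast
    ring
  · simp [h]

/-- The functional equation of `1 / Γ` in the four factors that change. Nothing is divided, so no
parameter is excluded. -/
theorem frobCoef_recurrence (n : Fin m → ℕ) (k : Fin m) :
    (frobExp J n c k + 1) * (frobExp J n c k + c k) * frobCoef a b J (n + Pi.single k 1) c =
      (∑ j, frobExp J n c j + a) * (∑ j, frobExp J n c j + b) * frobCoef a b J n c := by
  set s := frobExp J n c with hs
  have hexp : ∀ j, frobExp J (n + Pi.single k 1) c j = s j + (Pi.single k (1 : ℂ) : Fin m → ℂ) j :=
    fun j => by rw [frobExp_add_single]; simp [hs]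
  have hsum : ∑ j, frobExp J (n + Pi.single k 1) c j = ∑ j, s j + 1 := by
    simp only [hexp, Finset.sum_add_distrib]
    simp [Finset.sum_pi_single']
  unfold frobCoef
  rw [hsum, ← Finset.mul_prod_erase Finset.univ _ (Finset.mem_univ k),
    ← Finset.mul_prod_erase Finset.univ (fun k => (Complex.Gamma (c k + frobExp J n c k))⁻¹ *
      (Complex.Gamma (1 + frobExp J n c k))⁻¹) (Finset.mem_univ k)]
  have hprod : ∏ j ∈ Finset.univ.erase k,
      ((Complex.Gamma (c j + frobExp J (n + Pi.single k 1) c j))⁻¹ *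
        (Complex.Gamma (1 + frobExp J (n + Pi.single k 1) c j))⁻¹) =
      ∏ j ∈ Finset.univ.erase k, ((Complex.Gamma (c j + s j))⁻¹ *
        (Complex.Gamma (1 + s j))⁻¹) := by
    refine Finset.prod_congr rfl fun j hj => ?_
    rw [hexp, Pi.single_eq_of_ne (Finset.ne_of_mem_erase hj), add_zero]
  rw [hprod, hexp, Pi.single_eq_same, ← hs]
  have g1 : (Complex.Gamma (c k + s k))⁻¹ = (c k + s k) * (Complex.Gamma (c k + (s k + 1)))⁻¹ := by
    rw [inv_Gamma_eq, add_assoc]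
  have g2 : (Complex.Gamma (1 + s k))⁻¹ = (1 + s k) * (Complex.Gamma (1 + (s k + 1)))⁻¹ := by
    rw [inv_Gamma_eq, add_assoc]
  have g3 : ∀ z : ℂ, (Complex.Gamma (1 - z - (∑ j, s j + 1)))⁻¹ =
      -(∑ j, s j + z) * (Complex.Gamma (1 - z - ∑ j, s j))⁻¹ := fun z => by
    rw [inv_Gamma_eq]
    congr 2
    · ring
    · congr 1; ring
  rw [g1, g2, g3, g3]
  ring

/-- The starting exponents `0` and `1 - c_k` are the roots of the indicial polynomial. -/
theorem frobCoef_boundary {n : Fin m → ℕ} {k : Fin m} (hk : n k = 0) :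
    frobExp J n c k * (frobExp J n c k + c k - 1) = 0 := by
  unfold frobExp
  rw [hk]
  generalize J k = j
  fin_cases j <;> simp

/-- Termwise, the first part of the operator multiplies by `s_k (s_k + c_k - 1)`, the second by `(∑
s + a)(∑ s + b)` while raising `n_k` by one. The recurrence cancels them, and the terms with `n_k =
0` are killed by the indicial equation. -/
theorem opLog_frobSer (k : Fin m) {t : Fin m → ℂ} (ht : t ∈ logDomain m) :
    opLog a b c k (fun t => frobSer a b J (c, t)) t = 0 := by
  have hn := locNormal_frobTerm_slice a b J c
  have han : ∀ n, AnalyticOnNhd ℂ (fun t => frobTerm a b J n (c, t)) (logDomain m) :=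
    fun n t _ => frobTerm_slice_analyticAt a b J c n t
  have hΩ := isOpen_logDomain m
  have e0 : ∀ n, (fun t => frobTerm a b J n (c, t)) = fun t =>
      frobCoef a b J n c * Complex.exp (∑ j, frobExp J n c j * t j) := fun n => rfl
  have hA := (hn.hasSum_pd_pd hΩ han ht k k).add
    ((hn.hasSum_pd hΩ han ht k).mul_left (c k - 1))
  have hB := (((hasSum_sum fun i (_ : i ∈ Finset.univ) => hasSum_sum
    fun j (_ : j ∈ Finset.univ) => hn.hasSum_pd_pd hΩ han ht i j).add
    ((hasSum_sum fun i (_ : i ∈ Finset.univ) => hn.hasSum_pd hΩ han ht i).mul_left (a + b))).add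
    ((hn.summable ht).hasSum.mul_left (a * b))).mul_left (Complex.exp (t k))
  have key : opLog a b c k (fun t => frobSer a b J (c, t)) t = _ - _ :=
    congrArg₂ (· - ·) hA.tsum_eq.symm hB.tsum_eq.symm
  rw [key, sub_eq_zero]
  simp only [frobTerm, opLog_left_const_mul_cexp, opLog_right_const_mul_cexp]
  rw [tsum_shift k 1]
  · refine tsum_congr fun n => ?_
    have h1 : ∑ j, frobExp J (n + Pi.single k 1) c j * t j =
        ∑ j, frobExp J n c j * t j + t k := by
      simp only [frobExp_add_single, add_mul, Finset.sum_add_distrib]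
      simp [Pi.single_apply]
    have h2 : frobExp J (n + Pi.single k 1) c k = frobExp J n c k + 1 := by
      rw [frobExp_add_single]; simp
    have hrec := frobCoef_recurrence a b J c n k
    rw [h1, Complex.exp_add, h2]
    linear_combination
      (Complex.exp (∑ j, frobExp J n c j * t j) * Complex.exp (t k)) * hrec
  · intro n hnk
    rw [frobCoef_boundary J c (by omega), zero_mul]

/-! ### Symmetries of the Frobenius series -/

variable {J c}

theorem frobTerm_congr {J' : Fin m → Fin 2} {n n' : Fin m → ℕ}
    (h : ∀ k, frobExp J n c k = frobExp J' n' c k) (t : Fin m → ℂ) :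
    frobTerm a b J n (c, t) = frobTerm a b J' n' (c, t) := by
  unfold frobTerm frobCoef
  simp only [h]

theorem frobTerm_eq_zero {n : Fin m → ℕ} {k : Fin m} (N : ℕ)
    (h : c k + frobExp J n c k = -N ∨ 1 + frobExp J n c k = -N) (t : Fin m → ℂ) :
    frobTerm a b J n (c, t) = 0 := by
  unfold frobTerm frobCoef
  refine mul_eq_zero_of_left (mul_eq_zero_of_right _ ?_) _
  refine Finset.prod_eq_zero (Finset.mem_univ k) ?_
  -- `Complex.Gamma` takes the value `0` at its poles, so its inverse is `0` there, in accordance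
  -- with the entire function `1 / Γ`.
  rcases h with h | h
  · simp only [h, Complex.Gamma_neg_nat_eq_zero, inv_zero, zero_mul]
  · simp only [h, Complex.Gamma_neg_nat_eq_zero, inv_zero, mul_zero]

/-- A term depends on `J` and `n` only through its exponents. For integral `c_k` the exponents `n_k`
and `n_k + 1 - c_k` run over two half-lines in `ℤ`, and the terms on the longer one that are missing
from the shorter one contain `1 / Γ` at a nonpositive integer. -/
theorem frobSer_update {k : Fin m} {p : ℤ} (hp : c k = p) (hJ : J k = 0) (t : Fin m → ℂ) :
    frobSer a b (Function.update J k 1) (c, t) = frobSer a b J (c, t) := by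
  unfold frobSer
  rcases le_total p 1 with h | h
  · obtain ⟨d, hd⟩ := Int.eq_ofNat_of_zero_le (sub_nonneg.2 h)
    have hd' : (d : ℂ) = 1 - c k := by
      rw [hp]; exact_mod_cast hd.symm
    rw [tsum_shift (g := fun n => frobTerm a b J n (c, t)) k d]
    · refine tsum_congr fun n => frobTerm_congr a b (fun j => ?_) t
      rw [frobExp_add_single]
      unfold frobExp
      by_cases hj : j = k
      · subst hj
        simp [hJ, hd']
      · simp [hj]
    · intro n hn
      refine frobTerm_eq_zero a b (k := k) (d - 1 - n k) (Or.inl ?_) t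
      rw [Nat.cast_sub (by omega), Nat.cast_sub (by omega), hd', frobExp, hJ]
      push_cast
      simp
      ring
  · obtain ⟨d, hd⟩ := Int.eq_ofNat_of_zero_le (sub_nonneg.2 h)
    have hd' : (d : ℂ) = c k - 1 := by
      rw [hp]; exact_mod_cast hd.symm
    rw [tsum_shift (g := fun n => frobTerm a b (Function.update J k 1) n (c, t)) k d]
    · refine tsum_congr fun n => frobTerm_congr a b (fun j => ?_) t
      rw [frobExp_add_single]
      unfold frobExp
      by_cases hj : j = k
      · subst hj
        simp [hJ, hd']
        ring
      · simp [hj]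
    · intro n hn
      refine frobTerm_eq_zero a b (k := k) (d - 1 - n k) (Or.inr ?_) t
      rw [Nat.cast_sub (by omega), Nat.cast_sub (by omega), hd', frobExp,
        Function.update_self]
      push_cast
      simp
      ring

/-- The `k`-th exponents of one series differ by integers, so the loop multiplies all terms by the
same scalar `γ_k ^ (-j_k)`. -/
theorem frobSer_add_two_pi_I (J : Fin m → Fin 2) (c t : Fin m → ℂ) (k : Fin m) :
    frobSer a b J (c, t + Pi.single k (2 * Real.pi * Complex.I)) =
      Complex.exp (-(2 * Real.pi * Complex.I * (((J k : ℕ) : ℂ) * c k))) *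
        frobSer a b J (c, t) := by
  unfold frobSer
  rw [← tsum_mul_left]
  refine tsum_congr fun n => ?_
  unfold frobTerm
  have h1 : ∑ j, frobExp J n c j * (t + Pi.single k (2 * Real.pi * Complex.I) : Fin m → ℂ) j =
      ∑ j, frobExp J n c j * t j + frobExp J n c k * (2 * Real.pi * Complex.I) := by
    simp only [Pi.add_apply, mul_add, Finset.sum_add_distrib]
    simp [Pi.single_apply]
  have h2 : frobExp J n c k * (2 * Real.pi * Complex.I) =
      ((n k + (J k : ℕ) : ℕ) : ℂ) * (2 * Real.pi * Complex.I) +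
        -(2 * Real.pi * Complex.I * (((J k : ℕ) : ℂ) * c k)) := by
    unfold frobExp
    push_cast
    ring
  simp only
  rw [h1, h2, Complex.exp_add, Complex.exp_add, Complex.exp_nat_mul_two_pi_mul_I]
  ring

/-! ### Non-vanishing of the Frobenius series -/

/-- Along `t = (-R, …, -R)`, after removal of a common exponential, all terms but `n = 0` tend to 0
as `R → ∞`, so an identically vanishing sum would force the leading coefficient to be 0. -/
theorem exists_frobSer_ne_zero_of_frobCoef (h0 : frobCoef a b J 0 c ≠ 0) :
    ∃ t ∈ logDomain m, frobSer a b J (c, t) ≠ 0 := by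
  by_contra! hcon
  have hlim : Tendsto (fun R : ℝ => ∑ _k : Fin m, Real.exp (-R / 2)) atTop (𝓝 0) := by
    have : Tendsto (fun R : ℝ => Real.exp (-R / 2)) atTop (𝓝 0) :=
      Real.tendsto_exp_atBot.comp (tendsto_neg_atTop_atBot.atBot_div_const two_pos)
    simpa using tendsto_finsetSum Finset.univ fun (_ : Fin m) _ => this
  have hdom : ∀ᶠ R : ℝ in atTop, (fun _ : Fin m => (-R : ℂ)) ∈ logDomain m := by
    filter_upwards [hlim.eventually_lt_const zero_lt_one] with R hR
    simpa [logDomain] using hR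
  obtain ⟨R₀, hR₀⟩ := hdom.exists
  have hterm : ∀ (R : ℝ) n, frobTerm a b J n (c, fun _ => (-R : ℂ)) =
      Complex.exp (-R * ∑ k, ((J k : ℕ) : ℂ) * (1 - c k)) *
        (frobCoef a b J n c * Complex.exp (-R) ^ (∑ k, n k)) := fun R n => by
    unfold frobTerm
    simp only
    rw [← Finset.sum_mul, sum_frobExp, add_mul, Complex.exp_add, ← Complex.exp_nat_mul]
    rw [mul_comm (-(R : ℂ)) (∑ k, ((J k : ℕ) : ℂ) * (1 - c k))]
    ring
  have hzero : ∀ᶠ R : ℝ in atTop,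
      ∑' n, frobCoef a b J n c * Complex.exp (-R) ^ (∑ k, n k) = 0 := by
    filter_upwards [hdom] with R hR
    have := hcon _ hR
    unfold frobSer at this
    simp only [hterm, tsum_mul_left] at this
    exact (mul_eq_zero.1 this).resolve_left (Complex.exp_ne_zero _)
  have hsum : Summable fun n => ‖frobCoef a b J n c * Complex.exp (-R₀) ^ (∑ k, n k)‖ := by
    have := ((locNormal_frobTerm_slice a b J c).summable hR₀)
    simp only [hterm] at this
    exact ((summable_mul_left_iff (Complex.exp_ne_zero _)).1 this).norm
  have hconv := tendsto_tsum_of_dominated_convergence (𝓕 := (atTop : Filter ℝ))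
    (f := fun R n => frobCoef a b J n c * Complex.exp (-R) ^ (∑ k, n k))
    (g := fun n => if n = 0 then frobCoef a b J 0 c else 0) hsum (fun n => ?_) ?_
  · rw [tsum_ite_eq] at hconv
    exact h0 (tendsto_nhds_unique (hconv.congr' hzero) tendsto_const_nhds)
  · split_ifs with hn
    · subst hn; simp
    · have hN : ∑ k, n k ≠ 0 := fun h => hn (funext fun k => by
        simpa using (Finset.sum_eq_zero_iff.1 h) k (Finset.mem_univ k))
      have : Tendsto (fun R : ℝ => Complex.exp (-R)) atTop (𝓝 0) := by
        rw [tendsto_zero_iff_norm_tendsto_zero]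
        simp only [Complex.norm_exp, Complex.neg_re, Complex.ofReal_re]
        exact Real.tendsto_exp_atBot.comp tendsto_neg_atTop_atBot
      simpa [hN] using (this.pow (∑ k, n k)).const_mul (frobCoef a b J n c)
  · filter_upwards [eventually_ge_atTop R₀] with R hR n
    rw [norm_mul, norm_mul, norm_pow, norm_pow, Complex.norm_exp, Complex.norm_exp]
    refine mul_le_mul_of_nonneg_left (pow_le_pow_left₀ (Real.exp_pos _).le ?_ _) (norm_nonneg _)
    simpa using hR

/-- Nonintegrality keeps the arguments containing `a` and `b` away from the zeros of `1 / Γ`. -/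
theorem frobCoef_zero_ne_zero (ha : ∀ n : ℤ, a - ∑ k, ((J k : ℕ) : ℂ) * c k ≠ n)
    (hb : ∀ n : ℤ, b - ∑ k, ((J k : ℕ) : ℂ) * c k ≠ n)
    (hc : ∀ k, ∀ n : ℕ, gammaBase (J k) (c k) ≠ -n) : frobCoef a b J 0 c ≠ 0 := by
  have key : ∀ z : ℂ, (∀ n : ℤ, z - ∑ k, ((J k : ℕ) : ℂ) * c k ≠ n) →
      (Complex.Gamma (1 - z - ∑ k, frobExp J 0 c k))⁻¹ ≠ 0 := fun z hz => by
    refine inv_ne_zero (Complex.Gamma_ne_zero fun n hn => hz (1 + n - ∑ k, (J k : ℕ)) ?_)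
    rw [sum_frobExp] at hn
    simp only [mul_sub, mul_one, Finset.sum_sub_distrib] at hn
    push_cast
    simp at hn
    linear_combination -hn
  unfold frobCoef
  refine mul_ne_zero (mul_ne_zero (key a ha) (key b hb)) ?_
  refine Finset.prod_ne_zero_iff.2 fun k _ => ?_
  rw [gamma_factor_eq]
  refine mul_ne_zero (inv_ne_zero (Complex.Gamma_ne_zero fun n hn => hc k n ?_)) (by simp)
  simpa using hn

/-- The leading coefficient can vanish only through `1 / Γ(c_k)` with `j_k = 0` and `c_k` a
nonpositive integer. There the index 0 may be switched to 1 without changing the series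
(`frobSer_update`), and `1 / Γ(2 - c_k)` is nonzero. -/
theorem exists_frobSer_ne_zero
    (ha : ∀ (I : Fin m → Fin 2) (n : ℤ), a - ∑ k, ((I k : ℕ) : ℂ) * c k ≠ n)
    (hb : ∀ (I : Fin m → Fin 2) (n : ℤ), b - ∑ k, ((I k : ℕ) : ℂ) * c k ≠ n)
    (hJ : ∀ k, J k = 1 → ∀ n : ℤ, c k ≠ n) : ∃ t ∈ logDomain m, frobSer a b J (c, t) ≠ 0 := by
  classical
  let J' : Fin m → Fin 2 := fun k => if ∃ n : ℕ, c k = -n then 1 else J k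
  have hswitch : ∀ (S : Finset (Fin m)) (t : Fin m → ℂ),
      frobSer a b (fun k => if k ∈ S then J' k else J k) (c, t) = frobSer a b J (c, t) := by
    intro S t
    induction S using Finset.induction_on with
    | empty => simp
    | insert k S hk ih =>
      rw [← ih]
      by_cases hn : ∃ n : ℕ, c k = -n
      · obtain ⟨n, hn⟩ := hn
        have hJk : J k = 0 := by
          have := hJ k
          by_contra h1
          exact this (by omega) (-n) (by rw [hn]; push_cast; rfl)
        rw [← frobSer_update a b (J := fun k => if k ∈ S then J' k else J k) (k := k) (p := -n)
          (by rw [hn]; push_cast; rfl) (by simp [hk, hJk])]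
        congr 2
        ext j
        by_cases hj : j = k
        · subst hj
          have : ∃ N : ℕ, c j = -N := ⟨n, hn⟩
          simp [J', this]
        · simp [hj]
      · congr 2
        ext j
        by_cases hj : j = k
        · subst hj
          simp [J', hn, hk]
        · simp [hj]
  have h0 : frobCoef a b J' 0 c ≠ 0 := by
    refine frobCoef_zero_ne_zero a b (ha J') (hb J') fun k n h => ?_
    unfold gammaBase at h
    by_cases hn : ∃ n : ℕ, c k = -n
    · have hJ' : J' k = 1 := if_pos hn
      rw [hJ', if_neg one_ne_zero] at h
      obtain ⟨N, hN⟩ := hn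
      rw [hN] at h
      have : (2 + N + n : ℕ) = (0 : ℂ) := by push_cast; linear_combination h
      have := Nat.cast_eq_zero.1 this
      omega
    · have hJ' : J' k = J k := if_neg hn
      rw [hJ'] at h
      split_ifs at h with h1
      · exact hn ⟨n, h⟩
      · exact hJ k (by omega) (2 + n) (by push_cast; linear_combination -h)
  obtain ⟨t, ht, hne⟩ := exists_frobSer_ne_zero_of_frobCoef a b h0
  refine ⟨t, ht, fun h => hne ?_⟩
  have := hswitch Finset.univ t
  simp only [Finset.mem_univ, if_true] at this
  rw [← h, ← this]

end

/-! ### The vector of series solutions in logarithmic coordinates -/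

theorem ascPochhammer_mul_inv_Gamma_add (w : ℂ) (n : ℕ) :
    (ascPochhammer ℂ n).eval w * (Complex.Gamma (w + n))⁻¹ = (Complex.Gamma w)⁻¹ := by
  induction n with
  | zero => simp
  | succ n ih =>
    rw [← ih, ascPochhammer_succ_eval, inv_Gamma_eq (w + n)]
    push_cast
    rw [add_assoc]
    ring

theorem ascPochhammer_mul_inv_Gamma_sub (A : ℂ) (n : ℕ) :
    (ascPochhammer ℂ n).eval A * (Complex.Gamma (1 - A))⁻¹ =
      (-1) ^ n * (Complex.Gamma (1 - A - n))⁻¹ := by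
  induction n with
  | zero => simp
  | succ n ih =>
    rw [ascPochhammer_succ_eval, mul_right_comm, ih, inv_Gamma_eq (1 - A - (n + 1 : ℕ))]
    push_cast
    rw [show (1 : ℂ) - A - (n + 1) + 1 = 1 - A - n by ring]
    ring

/-- Reflection formula at `z` for `j = 0` and at `z - 1` for `j = 1`. All poles at integral `z` are
collected in `π / sin (π z)`; the remaining factor is entire. -/
theorem Gamma_div_ascPochhammer {z : ℂ} (hz : ∀ n : ℤ, z ≠ n) (j : Fin 2) (n : ℕ) :
    Complex.Gamma ((-1) ^ (j : ℕ) * (1 - z)) *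
        ((ascPochhammer ℂ n).eval (z + 2 * ((j : ℕ) : ℂ) * (1 - z)))⁻¹ =
      (-1) ^ (j : ℕ) * (Real.pi / Complex.sin (Real.pi * z)) *
        (Complex.Gamma (gammaBase j z + n))⁻¹ := by
  have key : ∀ w : ℂ, (∀ n : ℕ, w ≠ -n) →
      ((ascPochhammer ℂ n).eval w)⁻¹ = Complex.Gamma w * (Complex.Gamma (w + n))⁻¹ := fun w hw => by
    have h1 := ascPochhammer_mul_inv_Gamma_add w n
    have h2 := Complex.Gamma_ne_zero hw
    have h3 : (ascPochhammer ℂ n).eval w ≠ 0 := fun h => by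
      rw [h, zero_mul] at h1
      exact inv_ne_zero h2 h1.symm
    have h4 : (Complex.Gamma (w + n))⁻¹ = (Complex.Gamma w)⁻¹ *
        ((ascPochhammer ℂ n).eval w)⁻¹ := by
      rw [← h1]; field_simp
    rw [h4, mul_inv_cancel_left₀ h2]
  fin_cases j
  · have h1 := Complex.Gamma_mul_Gamma_one_sub z
    simp only [Fin.zero_eta, pow_zero, one_mul, Nat.cast_zero, mul_zero, zero_mul,
      add_zero, gammaBase, if_true]
    rw [key z fun n h => hz (-n) (by rw [h]; push_cast; rfl), ← h1]
    ring
  · have h1 := Complex.Gamma_mul_Gamma_one_sub (z - 1)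
    have h2 : Complex.sin (Real.pi * (z - 1)) = -Complex.sin (Real.pi * z) := by
      rw [mul_sub, mul_one, Complex.sin_sub_pi]
    have e1 : z + 2 * ((1 : ℕ) : ℂ) * (1 - z) = 2 - z := by push_cast; ring
    have e2 : (-1 : ℂ) ^ 1 * (1 - z) = z - 1 := by ring
    have e3 : 1 - (z - 1) = 2 - z := by ring
    simp only [Fin.mk_one, gammaBase, one_ne_zero, if_false]
    rw [h2, e3] at h1
    rw [e1, e2, key (2 - z) fun n h => hz (2 + n) (by push_cast; linear_combination -h),
      ← mul_assoc, h1]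
    ring

/-- The chosen branches of the logarithms as a map. -/
def logCoord {m : ℕ} (x₀ ℓ x : Fin m → ℂ) : Fin m → ℂ := fun k => logBr x₀ ℓ k x

section

variable {m : ℕ} {a b : ℂ} {x₀ ℓ : Fin m → ℂ}

/-- The reciprocal Gamma values at `1 - a^J` and `1 - b^J` absorb the rising factorials of the
numerator at the cost of a sign `(-1) ^ N` each, and the two signs cancel. -/
theorem vecF_eq {c x : Fin m → ℂ} (hc : c ∈ nonInt m)
    (hx : ∀ k, Complex.exp (logCoord x₀ ℓ x k) = x k) (J : Fin m → Fin 2) :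
    vecF a b x₀ ℓ c x J = (∏ k, ((-1) ^ (J k : ℕ) * (Real.pi / Complex.sin (Real.pi * c k)))) *
      frobSer a b J (c, logCoord x₀ ℓ x) := by
  unfold vecF FC frobSer
  rw [← tsum_mul_left, ← tsum_mul_left]
  refine tsum_congr fun n => ?_
  set τ := logCoord x₀ ℓ x
  set N := ∑ k, n k with hN
  have hshift : ∀ z : ℂ, 1 - z - ∑ k, frobExp J n c k = 1 - shiftPar z c J - N := fun z => by
    rw [sum_frobExp, shiftPar]; ring
  have hexp : Complex.exp (∑ k, frobExp J n c k * τ k) =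
      (∏ k, Complex.exp (((J k : ℕ) : ℂ) * (1 - c k) * logBr x₀ ℓ k x)) * ∏ k, x k ^ n k := by
    simp only [← hx, ← Complex.exp_nat_mul, ← Complex.exp_sum, ← Complex.exp_add,
      ← Finset.sum_add_distrib, frobExp, add_mul]
    congr 1
    exact Finset.sum_congr rfl fun k _ => add_comm _ _
  have hprod : (∏ k, Complex.Gamma ((-1) ^ (J k : ℕ) * (1 - c k))) *
      ((∏ k, (ascPochhammer ℂ (n k)).eval (shiftC c J k)) * ∏ k, ((n k).factorial : ℂ))⁻¹ =
      (∏ k, ((-1) ^ (J k : ℕ) * (Real.pi / Complex.sin (Real.pi * c k)))) *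
        ∏ k, ((Complex.Gamma (c k + frobExp J n c k))⁻¹ *
          (Complex.Gamma (1 + frobExp J n c k))⁻¹) := by
    rw [mul_inv, ← Finset.prod_inv_distrib, ← Finset.prod_inv_distrib, ← mul_assoc,
      ← Finset.prod_mul_distrib, ← Finset.prod_mul_distrib, ← Finset.prod_mul_distrib]
    refine Finset.prod_congr rfl fun k _ => ?_
    rw [gamma_factor_eq, ← mul_assoc, ← Gamma_div_ascPochhammer (hc k), shiftC]
  have hneg : ((-1 : ℂ) ^ N) * (-1) ^ N = 1 := by rw [← mul_pow]; simp
  have hA := ascPochhammer_mul_inv_Gamma_sub (shiftPar a c J) N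
  have hB := ascPochhammer_mul_inv_Gamma_sub (shiftPar b c J) N
  unfold frobTerm frobCoef
  simp only
  rw [hshift, hshift, hexp]
  calc _ = ((∏ k, Complex.Gamma ((-1) ^ (J k : ℕ) * (1 - c k))) *
      ((∏ k, (ascPochhammer ℂ (n k)).eval (shiftC c J k)) * ∏ k, ((n k).factorial : ℂ))⁻¹) *
      ((ascPochhammer ℂ N).eval (shiftPar a c J) * (Complex.Gamma (1 - shiftPar a c J))⁻¹) *
      ((ascPochhammer ℂ N).eval (shiftPar b c J) * (Complex.Gamma (1 - shiftPar b c J))⁻¹) *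
      ((∏ k, Complex.exp (((J k : ℕ) : ℂ) * (1 - c k) * logBr x₀ ℓ k x)) * ∏ k, x k ^ n k) := by
        simp only [div_eq_mul_inv, mul_inv]
        ring
    _ = _ := by
        rw [hprod, hA, hB]
        linear_combination ((∏ k, ((-1) ^ (J k : ℕ) * (Real.pi / Complex.sin (Real.pi * c k)))) *
          (∏ k, ((Complex.Gamma (c k + frobExp J n c k))⁻¹ *
          (Complex.Gamma (1 + frobExp J n c k))⁻¹)) *
          (Complex.Gamma (1 - shiftPar a c J - N))⁻¹ * (Complex.Gamma (1 - shiftPar b c J - N))⁻¹ *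
          ((∏ k, Complex.exp (((J k : ℕ) : ℂ) * (1 - c k) * logBr x₀ ℓ k x)) *
            ∏ k, x k ^ n k)) * hneg

variable (a b) in
/-- Combinations of the Frobenius series with decomposable coefficients. -/
def frobComb (u : Fin m → Fin 2 → ℂ) (p : (Fin m → ℂ) × (Fin m → ℂ)) : ℂ :=
  ∑ J : Fin m → Fin 2, (∏ k, u k (J k)) * frobSer a b J p

/-- The factors of the coefficients of `𝐅 · P_m` with respect to the normalized series. -/
def projCoef (c : Fin m → ℂ) (k : Fin m) (i j : Fin 2) : ℂ :=
  (-1) ^ (j : ℕ) * (Real.pi / Complex.sin (Real.pi * c k)) * matQ c k j i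

theorem vecFP_eq {c x : Fin m → ℂ} (hc : c ∈ nonInt m)
    (hx : ∀ k, Complex.exp (logCoord x₀ ℓ x k) = x k) (I : Fin m → Fin 2) :
    vecFP a b x₀ ℓ c x I = frobComb a b (fun k => projCoef c k (I k)) (c, logCoord x₀ ℓ x) := by
  unfold vecFP frobComb Matrix.vecMul dotProduct
  refine Finset.sum_congr rfl fun J _ => ?_
  have h : matP c J I = ∏ k, matQ c k (J k) (I k) := rfl
  change vecF a b x₀ ℓ c x J * matP c J I = _
  rw [vecF_eq hc hx, h]
  simp only [projCoef, Finset.prod_mul_distrib]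
  ring

theorem frobComb_update_linear (u : Fin m → Fin 2 → ℂ) (k : Fin m) (α : ℂ) (v w : Fin 2 → ℂ)
    (p : (Fin m → ℂ) × (Fin m → ℂ)) :
    frobComb a b (Function.update u k fun j => α * (v j - w j)) p =
      α * (frobComb a b (Function.update u k v) p - frobComb a b (Function.update u k w) p) := by
  unfold frobComb
  rw [← Finset.sum_sub_distrib, Finset.mul_sum]
  refine Finset.sum_congr rfl fun J _ => ?_
  have h : ∀ v : Fin 2 → ℂ, ∏ k', Function.update u k v k' (J k') =
      v (J k) * ∏ k' ∈ Finset.univ.erase k, u k' (J k') := fun v => by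
    rw [← Finset.mul_prod_erase _ _ (Finset.mem_univ k), Function.update_self]
    congr 1
    exact Finset.prod_congr rfl fun k' hk' => by
      rw [Function.update_of_ne (Finset.ne_of_mem_erase hk')]
  rw [h, h, h]
  ring

theorem frobComb_add_two_pi_I (u : Fin m → Fin 2 → ℂ) (c t : Fin m → ℂ) (k : Fin m) :
    frobComb a b u (c, t + Pi.single k (2 * Real.pi * Complex.I)) =
      frobComb a b (Function.update u k fun j =>
        Complex.exp (-(2 * Real.pi * Complex.I * (((j : ℕ) : ℂ) * c k))) * u k j) (c, t) := by
  unfold frobComb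
  refine Finset.sum_congr rfl fun J _ => ?_
  rw [frobSer_add_two_pi_I, ← Finset.mul_prod_erase _ _ (Finset.mem_univ k),
    ← Finset.mul_prod_erase _ (fun k' => Function.update u k _ k' (J k')) (Finset.mem_univ k),
    Function.update_self]
  have : ∀ v : Fin 2 → ℂ, ∏ k' ∈ Finset.univ.erase k, Function.update u k v k' (J k') =
      ∏ k' ∈ Finset.univ.erase k, u k' (J k') := fun v =>
    Finset.prod_congr rfl fun k' hk' => by
      rw [Function.update_of_ne (Finset.ne_of_mem_erase hk')]
  rw [this]
  ring

theorem sin_ne_zero_of_nonInt {c : Fin m → ℂ} (hc : c ∈ nonInt m) (k : Fin m) :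
    Complex.sin (Real.pi * c k) ≠ 0 := fun h => by
  obtain ⟨n, hn⟩ := (sin_pi_mul_eq_zero_iff _).1 h
  exact hc k n hn

/-- The factors of the coefficients of `𝐅 · P_m`, cleared of the denominators `sin (π c_k)`. -/
def regCoef (c : Fin m → ℂ) (k : Fin m) (i j : Fin 2) : ℂ :=
  if i = 0 then
    if j = 0 then -(2 * Real.pi * Complex.I) * Complex.exp (Real.pi * Complex.I * c k) else 0
  else (-1) ^ (j : ℕ) * Real.pi

theorem one_sub_gam (c : Fin m → ℂ) (k : Fin m) :
    1 - gam c k = -(2 * Complex.I) * Complex.exp (Real.pi * Complex.I * c k) *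
      Complex.sin (Real.pi * c k) := by
  have h1 : gam c k = Complex.exp (Real.pi * Complex.I * c k) *
      Complex.exp (Real.pi * c k * Complex.I) := by
    rw [gam, ← Complex.exp_add]; congr 1; ring
  have h2 : (1 : ℂ) = Complex.exp (Real.pi * Complex.I * c k) *
      Complex.exp (-(Real.pi * c k) * Complex.I) := by
    rw [← Complex.exp_add, eq_comm, ← Complex.exp_zero]; congr 1; ring
  rw [h1, Complex.sin]
  nth_rw 1 [h2]
  linear_combination ((Complex.exp (Real.pi * Complex.I * c k)) *
    (Complex.exp (-(Real.pi * c k) * Complex.I) - Complex.exp (Real.pi * c k * Complex.I))) *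
    Complex.I_sq

/-- The entry `1 - γ_k` has a factor `sin (π c_k)`, which cancels the pole. -/
theorem projCoef_zero {c : Fin m → ℂ} (hc : c ∈ nonInt m) (k : Fin m) (j : Fin 2) :
    projCoef c k 0 j = regCoef c k 0 j := by
  have hs := sin_ne_zero_of_nonInt hc k
  unfold projCoef regCoef matQ
  fin_cases j
  · simp [one_sub_gam]
    field_simp
  · simp

theorem projCoef_one {c : Fin m → ℂ} (hc : c ∈ nonInt m) (k : Fin m) (j : Fin 2) :
    Complex.sin (Real.pi * c k) * projCoef c k 1 j = regCoef c k 1 j := by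
  have hs := sin_ne_zero_of_nonInt hc k
  unfold projCoef regCoef matQ
  fin_cases j
  · simp
    field_simp
  · simp
    field_simp

/-! ### The modified vector as an analytic function of all variables -/

theorem frobComb_regCoef_analyticOnNhd (I : Fin m → Fin 2) :
    AnalyticOnNhd ℂ (fun p : (Fin m → ℂ) × (Fin m → ℂ) =>
      frobComb a b (fun k => regCoef p.1 k (I k)) p) (totalDomain m) := by
  intro p hp
  have h1 : ∀ k, AnalyticAt ℂ (fun p : (Fin m → ℂ) × (Fin m → ℂ) => p.1 k) p := fun k =>
    ((ContinuousLinearMap.proj (R := ℂ) (φ := fun _ : Fin m => ℂ) k).comp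
      (ContinuousLinearMap.fst ℂ _ _)).analyticAt p
  unfold frobComb
  refine Finset.analyticAt_fun_sum _ fun J _ => AnalyticAt.fun_mul
    (Finset.analyticAt_fun_prod _ fun k _ => ?_) (frobSer_analyticOnNhd a b J p hp)
  simp only [regCoef]
  split_ifs
  · exact analyticAt_const.mul (analyticAt_const.mul (h1 k)).cexp
  · exact analyticAt_const
  · exact analyticAt_const

/-- For `i_k = 1` the coefficients for `j_k = 0` and `j_k = 1` are opposite, while the two series
coincide at integral `c_k`. The terms cancel in pairs. -/
theorem frobComb_regCoef_eq_zero {I : Fin m → Fin 2} {k : Fin m} (hk : I k = 1)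
    {p : (Fin m → ℂ) × (Fin m → ℂ)} {n : ℤ} (hn : p.1 k = n) :
    frobComb a b (fun k => regCoef p.1 k (I k)) p = 0 := by
  obtain ⟨c, t⟩ := p
  unfold frobComb
  have hflip : ∀ J : Fin m → Fin 2,
      frobSer a b (Function.update J k (1 - J k)) (c, t) = frobSer a b J (c, t) := by
    intro J
    rcases (show J k = 0 ∨ J k = 1 by omega) with h | h
    · rw [h]
      exact frobSer_update a b hn h t
    · have h2 := frobSer_update a b (J := Function.update J k 0) hn (by simp) t
      rw [Function.update_idem, ← h, Function.update_eq_self] at h2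
      rw [h2, h]
      rfl
  refine Finset.sum_involution (fun J _ => Function.update J k (1 - J k)) (fun J _ => ?_)
    (fun J _ _ h => ?_) (fun J _ => Finset.mem_univ _) fun J _ => ?_
  · rw [hflip, ← add_mul, ← Finset.mul_prod_erase _ _ (Finset.mem_univ k),
      ← Finset.mul_prod_erase _ (fun k' => regCoef c k' (I k') _) (Finset.mem_univ k)]
    have : ∏ k' ∈ Finset.univ.erase k, regCoef c k' (I k') (Function.update J k (1 - J k) k') =
        ∏ k' ∈ Finset.univ.erase k, regCoef c k' (I k') (J k') :=
      Finset.prod_congr rfl fun k' hk' => by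
        rw [Function.update_of_ne (Finset.ne_of_mem_erase hk')]
    rw [this, ← add_mul, Function.update_self]
    simp only [hk]
    have h0 : regCoef c k 1 (J k) + regCoef c k 1 (1 - J k) = 0 := by
      unfold regCoef
      generalize J k = j
      fin_cases j <;> simp
    simp only [h0, zero_mul]
  · have := congrFun h k
    rw [Function.update_self] at this
    omega
  · ext k'
    by_cases hk' : k' = k
    · subst hk'
      simp
    · simp [hk']

/-- The sines are divided out one at a time. The quotient must still vanish on the next hyperplanes;
this is clear off the zeros of the previous sines, and the rest follows by continuity. -/
theorem exists_div_prod_sin {f : (Fin m → ℂ) × (Fin m → ℂ) → ℂ}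
    (hf : AnalyticOnNhd ℂ f (totalDomain m)) (S : Finset (Fin m))
    (h0 : ∀ k ∈ S, ∀ p ∈ totalDomain m, ∀ n : ℤ, p.1 k = n → f p = 0) :
    ∃ G : (Fin m → ℂ) × (Fin m → ℂ) → ℂ, AnalyticOnNhd ℂ G (totalDomain m) ∧
      ∀ p ∈ totalDomain m, f p = (∏ k ∈ S, Complex.sin (Real.pi * p.1 k)) * G p := by
  induction S using Finset.induction_on with
  | empty => exact ⟨f, hf, fun p _ => by simp⟩
  | insert j S hj ih =>
    obtain ⟨G, hG, hfG⟩ := ih fun k hk => h0 k (Finset.mem_insert_of_mem hk)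
    let φ : (Fin m → ℂ) × (Fin m → ℂ) →L[ℂ] ℂ :=
      (ContinuousLinearMap.proj (R := ℂ) (φ := fun _ : Fin m => ℂ) j).comp
      (ContinuousLinearMap.fst ℂ _ _)
    have hG0 : ∀ p ∈ totalDomain m, ∀ n : ℤ, φ p = n → G p = 0 := fun p hp n hn => by
      by_contra hne
      -- Moves the coordinates in `S` off the integers and keeps `c_j` fixed, as `j ∉ S`.
      let w : Fin m → ℂ := fun k => if k ∈ S then 1 else 0
      have hcont : Continuous fun z : ℂ => (p.1 + z • w, p.2) := by fun_prop
      have hlim : Tendsto (fun z : ℂ => (p.1 + z • w, p.2)) (𝓝 0) (𝓝 p) := by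
        simpa using hcont.tendsto 0
      have h1 : ∀ᶠ z in 𝓝[≠] (0 : ℂ), G (p.1 + z • w, p.2) ≠ 0 :=
        (hlim.eventually ((hG p hp).continuousAt.eventually_ne hne)).filter_mono
          nhdsWithin_le_nhds
      have h2 : ∀ᶠ z in 𝓝[≠] (0 : ℂ), ∀ k, Complex.sin (Real.pi * (p.1 k + z)) ≠ 0 :=
        eventually_all.2 fun k => eventually_sin_pi_mul_add_ne_zero _
      obtain ⟨z, hz1, hz2⟩ := (h1.and h2).exists
      have hz : (p.1 + z • w, p.2) ∈ totalDomain m := hp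
      have h3 := hfG _ hz
      rw [h0 j (Finset.mem_insert_self _ _) _ hz n (by
        have : p.1 j = n := hn
        simp [w, hj, this])] at h3
      refine mul_ne_zero (Finset.prod_ne_zero_iff.2 fun k hk => ?_) hz1 h3.symm
      simpa [w, hk] using hz2 k
    obtain ⟨H, hH, hGH⟩ := exists_analyticOnNhd_div_sin (φ := φ) (v := (Pi.single j 1, 0))
      (isOpen_totalDomain m) (by simp [φ]) hG hG0
    refine ⟨H, hH, fun p hp => ?_⟩
    rw [hfG p hp, hGH p hp, Finset.prod_insert hj]
    change _ * (Complex.sin (Real.pi * p.1 j) * _) = _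
    ring

variable (a b) in
theorem exists_modSol (I : Fin m → Fin 2) :
    ∃ G : (Fin m → ℂ) × (Fin m → ℂ) → ℂ, AnalyticOnNhd ℂ G (totalDomain m) ∧
      ∀ p ∈ totalDomain m, frobComb a b (fun k => regCoef p.1 k (I k)) p =
        (∏ k ∈ Finset.univ.filter fun k => I k = 1, Complex.sin (Real.pi * p.1 k)) * G p :=
  exists_div_prod_sin (frobComb_regCoef_analyticOnNhd I) _ fun _ hk _ _ _ hn =>
    frobComb_regCoef_eq_zero (Finset.mem_filter.1 hk).2 hn

variable (a b) in
/-- The entries of the modified vector, as functions of the parameters and the logarithms of the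
variables. -/
def modSol (I : Fin m → Fin 2) : (Fin m → ℂ) × (Fin m → ℂ) → ℂ :=
  Classical.choose (exists_modSol a b I)

theorem modSol_analyticOnNhd (I : Fin m → Fin 2) :
    AnalyticOnNhd ℂ (modSol a b I) (totalDomain m) :=
  (Classical.choose_spec (exists_modSol a b I)).1

theorem modSol_eq (I : Fin m → Fin 2) {c t : Fin m → ℂ} (hc : c ∈ nonInt m)
    (ht : t ∈ logDomain m) :
    modSol a b I (c, t) = frobComb a b (fun k => projCoef c k (I k)) (c, t) := by
  have h1 := (Classical.choose_spec (exists_modSol a b I)).2 (c, t) ht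
  have h2 : (∏ k ∈ Finset.univ.filter fun k => I k = 1, Complex.sin (Real.pi * c k)) ≠ 0 :=
    Finset.prod_ne_zero_iff.2 fun k _ => sin_ne_zero_of_nonInt hc k
  refine mul_left_cancel₀ h2 (h1.symm.trans ?_)
  unfold frobComb
  rw [Finset.mul_sum]
  refine Finset.sum_congr rfl fun J _ => ?_
  rw [← mul_assoc, Finset.prod_filter, ← Finset.prod_mul_distrib]
  congr 1
  refine Finset.prod_congr rfl fun k _ => ?_
  rcases (show I k = 0 ∨ I k = 1 by omega) with h | h
  · simp [h, projCoef_zero hc]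
  · simp [h, projCoef_one hc]

/-! ### Density of the non-integral parameters -/

/-- Adding one small `z ≠ 0` to all coordinates avoids the integers. This makes the limit unique and
lets identities pass from nonintegral to arbitrary `c`. -/
instance nhdsWithin_nonInt_neBot (c : Fin m → ℂ) : (𝓝[nonInt m] c).NeBot := by
  have h1 : ∀ᶠ z in 𝓝[≠] (0 : ℂ), ∀ k, Complex.sin (Real.pi * (c k + z)) ≠ 0 :=
    eventually_all.2 fun k => eventually_sin_pi_mul_add_ne_zero _
  have h2 : Tendsto (fun (z : ℂ) k => c k + z) (𝓝[≠] 0) (𝓝[nonInt m] c) := by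
    refine tendsto_nhdsWithin_iff.2 ⟨?_, h1.mono fun z hz k n hn => hz k ?_⟩
    · have : Continuous fun (z : ℂ) (k : Fin m) => c k + z := by fun_prop
      simpa using (this.tendsto 0).mono_left nhdsWithin_le_nhds
    · exact (sin_pi_mul_eq_zero_iff _).2 ⟨n, hn⟩
  exact h2.neBot

theorem eq_of_eq_on_nonInt {f g : (Fin m → ℂ) → ℂ} {c : Fin m → ℂ} (hf : ContinuousAt f c)
    (hg : ContinuousAt g c) (h : ∀ c' ∈ nonInt m, f c' = g c') : f c = g c := by
  have h1 := hf.tendsto.mono_left (nhdsWithin_le_nhds (s := nonInt m))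
  have h2 := hg.tendsto.mono_left (nhdsWithin_le_nhds (s := nonInt m))
  refine tendsto_nhds_unique (h1.congr' ?_) h2
  filter_upwards [self_mem_nhdsWithin] with c' hc'
  exact h c' hc'

theorem modSol_continuousAt_param (I : Fin m → Fin 2) (c : Fin m → ℂ) {t : Fin m → ℂ}
    (ht : t ∈ logDomain m) : ContinuousAt (fun c => modSol a b I (c, t)) c :=
  ContinuousAt.comp (f := fun c : Fin m → ℂ => (c, t)) (modSol_analyticOnNhd I (c, t) ht).continuousAt
    (by fun_prop)

/-! ### Monodromy -/

theorem add_two_pi_I_mem_logDomain {t : Fin m → ℂ} (ht : t ∈ logDomain m) (k : Fin m) (z : ℂ)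
    (hz : z.re = 0) : t + Pi.single k z ∈ logDomain m := by
  have : ∀ j, ((t + Pi.single k z : Fin m → ℂ) j).re = (t j).re := fun j => by
    by_cases h : j = k
    · subst h; simp [hz]
    · simp [h]
  simpa only [logDomain, Set.mem_ofPred_eq, this] using ht

theorem two_pi_I_re : (2 * Real.pi * Complex.I : ℂ).re = 0 := by simp

theorem gam_ne_zero (c : Fin m → ℂ) (k : Fin m) : gam c k ≠ 0 := Complex.exp_ne_zero _

theorem continuous_gam (k : Fin m) : Continuous fun c : Fin m → ℂ => gam c k := by
  unfold gam
  fun_prop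

/-- Column 0 of `Q_k` involves only the series with `j_k = 0`, which are single-valued in `x_k`. -/
theorem modSol_monodromy_zero {I : Fin m → Fin 2} {k : Fin m} (hk : I k = 0) (c : Fin m → ℂ)
    {t : Fin m → ℂ} (ht : t ∈ logDomain m) :
    modSol a b I (c, t + Pi.single k (2 * Real.pi * Complex.I)) = modSol a b I (c, t) := by
  have ht' := add_two_pi_I_mem_logDomain ht k _ two_pi_I_re
  refine eq_of_eq_on_nonInt (modSol_continuousAt_param I c ht') (modSol_continuousAt_param I c ht)
    fun c' hc' => ?_
  rw [modSol_eq I hc' ht', modSol_eq I hc' ht, frobComb_add_two_pi_I]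
  congr 1
  rw [Function.update_eq_self_iff]
  ext j
  rw [hk]
  fin_cases j
  · simp
  · simp [projCoef, matQ]

/-- Conjugation by `Q_k` turns `diag(1, γ_k⁻¹)` into the matrix with rows `(1, -γ_k⁻¹)` and `(0,
γ_k⁻¹)`. It stays regular at `γ_k = 1`, although `Q_k` becomes singular there. -/
theorem modSol_monodromy_one {I : Fin m → Fin 2} {k : Fin m} (hk : I k = 1) (c : Fin m → ℂ)
    {t : Fin m → ℂ} (ht : t ∈ logDomain m) :
    modSol a b I (c, t + Pi.single k (2 * Real.pi * Complex.I)) =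
      (gam c k)⁻¹ * (modSol a b I (c, t) - modSol a b (Function.update I k 0) (c, t)) := by
  have ht' := add_two_pi_I_mem_logDomain ht k _ two_pi_I_re
  refine eq_of_eq_on_nonInt (g := fun c => (gam c k)⁻¹ * (modSol a b I (c, t) -
    modSol a b (Function.update I k 0) (c, t))) (modSol_continuousAt_param I c ht')
    (((continuous_gam k).continuousAt.inv₀ (gam_ne_zero c k)).mul
      ((modSol_continuousAt_param I c ht).sub (modSol_continuousAt_param _ c ht)))
    fun c' hc' => ?_
  rw [modSol_eq I hc' ht', modSol_eq I hc' ht, modSol_eq _ hc' ht, frobComb_add_two_pi_I]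
  have h1 : (fun j : Fin 2 => Complex.exp (-(2 * Real.pi * Complex.I * (((j : ℕ) : ℂ) * c' k))) *
      projCoef c' k (I k) j) = fun j => (gam c' k)⁻¹ * (projCoef c' k 1 j - projCoef c' k 0 j) := by
    ext j
    rw [hk]
    have hγ : (gam c' k)⁻¹ * gam c' k = 1 := inv_mul_cancel₀ (gam_ne_zero c' k)
    fin_cases j
    · simp [projCoef, matQ]
      linear_combination (-(Real.pi / Complex.sin (Real.pi * c' k))) * hγ
    · simp [projCoef, matQ]
      left
      rw [gam, ← Complex.exp_neg]
  have h2 : ∀ i : Fin 2, Function.update (fun k => projCoef c' k (I k)) k (projCoef c' k i) =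
      fun k' => projCoef c' k' (Function.update I k i k') := fun i => by
    ext k' j
    by_cases h : k' = k
    · subst h; simp
    · simp [h]
  rw [h1, frobComb_update_linear, h2, h2, ← hk, Function.update_eq_self]

end

/-! ### The modified vector solves the system -/

section

variable {m : ℕ} {a b : ℂ}

theorem pd_sum {ι : Type*} (s : Finset ι) (A : ι → ℂ) {f : ι → (Fin m → ℂ) → ℂ} {t : Fin m → ℂ}
    (hf : ∀ i ∈ s, AnalyticAt ℂ (f i) t) (k : Fin m) :
    pd k (fun t => ∑ i ∈ s, A i * f i t) t = ∑ i ∈ s, A i * pd k (f i) t := by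
  have h : HasFDerivAt (fun t => ∑ i ∈ s, A i * f i t) (∑ i ∈ s, A i • fderiv ℂ (f i) t) t :=
    HasFDerivAt.fun_sum fun i hi => (hf i hi).differentiableAt.hasFDerivAt.const_mul (A i)
  unfold pd
  rw [h.fderiv]
  simp [_root_.sum_apply]

theorem pd_pd_sum {ι : Type*} (s : Finset ι) (A : ι → ℂ) {f : ι → (Fin m → ℂ) → ℂ} {t : Fin m → ℂ}
    (hf : ∀ i ∈ s, AnalyticAt ℂ (f i) t) (k l : Fin m) :
    pd k (pd l fun t => ∑ i ∈ s, A i * f i t) t = ∑ i ∈ s, A i * pd k (pd l (f i)) t := by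
  rw [pd_congr (g := fun t => ∑ i ∈ s, A i * pd l (f i) t), pd_sum s A fun i hi => AnalyticAt.pd (hf i hi) l]
  have h : ∀ᶠ u in 𝓝 t, ∀ i ∈ s, AnalyticAt ℂ (f i) u :=
    (eventually_all_finset s).2 fun i hi => (hf i hi).eventually_analyticAt
  exact h.mono fun u hu => pd_sum s A hu l

theorem opLog_sum {ι : Type*} (s : Finset ι) (A : ι → ℂ) {f : ι → (Fin m → ℂ) → ℂ} {t : Fin m → ℂ}
    (hf : ∀ i ∈ s, AnalyticAt ℂ (f i) t) (c : Fin m → ℂ) (k : Fin m) :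
    opLog a b c k (fun t => ∑ i ∈ s, A i * f i t) t = ∑ i ∈ s, A i * opLog a b c k (f i) t := by
  unfold opLog
  simp only [pd_sum s A hf, pd_pd_sum s A hf]
  have h1 : ∑ x : Fin m, ∑ y : Fin m, ∑ i ∈ s, A i * pd x (pd y (f i)) t =
      ∑ i ∈ s, A i * ∑ x, ∑ y, pd x (pd y (f i)) t := by
    simp only [Finset.mul_sum]
    rw [Finset.sum_comm]
    rw [Finset.sum_congr rfl fun y _ => Finset.sum_comm, Finset.sum_comm]
    exact Finset.sum_congr rfl fun i _ => Finset.sum_comm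
  have h2 : ∑ x : Fin m, ∑ i ∈ s, A i * pd x (f i) t = ∑ i ∈ s, A i * ∑ x, pd x (f i) t := by
    simp only [Finset.mul_sum]
    exact Finset.sum_comm
  rw [h1, h2]
  have : ∀ (p q r u v : ι → ℂ) (α β γ δ : ℂ), ∑ i ∈ s, A i * p i + α * ∑ i ∈ s, A i * q i -
      β * (∑ i ∈ s, A i * u i + γ * ∑ i ∈ s, A i * v i + δ * ∑ i ∈ s, A i * r i) =
      ∑ i ∈ s, A i * (p i + α * q i - β * (u i + γ * v i + δ * r i)) := by
    intro p q r u v α β γ δ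
    simp only [Finset.mul_sum, ← Finset.sum_add_distrib, ← Finset.sum_sub_distrib]
    exact Finset.sum_congr rfl fun i _ => by ring
  exact this _ _ _ _ _ _ _ _ _

/-- Partial derivatives with respect to the second group of variables. -/
def pdSnd (k : Fin m) (G : (Fin m → ℂ) × (Fin m → ℂ) → ℂ) (p : (Fin m → ℂ) × (Fin m → ℂ)) : ℂ :=
  fderiv ℂ G p (0, Pi.single k 1)

theorem pdSnd_analyticAt {G : (Fin m → ℂ) × (Fin m → ℂ) → ℂ} {p : (Fin m → ℂ) × (Fin m → ℂ)}
    (hG : AnalyticAt ℂ G p) (k : Fin m) : AnalyticAt ℂ (pdSnd k G) p :=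
  ((ContinuousLinearMap.apply ℂ ℂ
    ((0, Pi.single k (1 : ℂ)) : (Fin m → ℂ) × (Fin m → ℂ))).analyticAt _).comp hG.fderiv

theorem pd_slice {G : (Fin m → ℂ) × (Fin m → ℂ) → ℂ} {c t : Fin m → ℂ}
    (hG : AnalyticAt ℂ G (c, t)) (k : Fin m) :
    pd k (fun t => G (c, t)) t = pdSnd k G (c, t) := by
  have h := hG.differentiableAt.hasFDerivAt.comp t (hasFDerivAt_prodMk_right c t)
  change fderiv ℂ (G ∘ fun t => (c, t)) t _ = _
  rw [h.fderiv]
  simp [pdSnd]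

theorem analyticAt_slice {G : (Fin m → ℂ) × (Fin m → ℂ) → ℂ} {c t : Fin m → ℂ}
    (hG : AnalyticAt ℂ G (c, t)) : AnalyticAt ℂ (fun t => G (c, t)) t :=
  AnalyticAt.comp (f := fun t => (c, t)) hG (analyticAt_const.prod analyticAt_id)

theorem opLog_slice {G : (Fin m → ℂ) × (Fin m → ℂ) → ℂ} (hG : AnalyticOnNhd ℂ G (totalDomain m))
    (c : Fin m → ℂ) {t : Fin m → ℂ} (ht : t ∈ logDomain m) (k : Fin m) :
    opLog a b c k (fun t => G (c, t)) t =
      pdSnd k (pdSnd k G) (c, t) + (c k - 1) * pdSnd k G (c, t) -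
      Complex.exp (t k) * ((∑ i, ∑ j, pdSnd i (pdSnd j G) (c, t)) +
        (a + b) * ∑ i, pdSnd i G (c, t) + a * b * G (c, t)) := by
  have h1 : ∀ {t}, t ∈ logDomain m → ∀ k, pd k (fun t => G (c, t)) t = pdSnd k G (c, t) :=
    fun {t} ht k => pd_slice (hG (c, t) ht) k
  have h2 : ∀ i j, pd i (pd j fun t => G (c, t)) t = pdSnd i (pdSnd j G) (c, t) := fun i j => by
    rw [← pd_slice (pdSnd_analyticAt (hG (c, t) ht) j)]
    refine pd_congr ?_ i
    filter_upwards [(isOpen_logDomain m).mem_nhds ht] with u hu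
    exact h1 hu j
  unfold opLog
  simp only [h1 ht, h2]

/-- For nonintegral `c` this is a finite combination of Frobenius series. The `t`-derivatives of a
jointly analytic function are continuous in `c`, so the equation survives the limit. -/
theorem opLog_modSol (I : Fin m → Fin 2) (c : Fin m → ℂ) {t : Fin m → ℂ} (ht : t ∈ logDomain m)
    (k : Fin m) : opLog a b c k (fun t => modSol a b I (c, t)) t = 0 := by
  have hcont : ContinuousAt
      (fun c => opLog a b c k (fun t => modSol a b I (c, t)) t) c := by
    simp only [opLog_slice (modSol_analyticOnNhd I) _ ht]
    have hc : ∀ {G : (Fin m → ℂ) × (Fin m → ℂ) → ℂ}, AnalyticAt ℂ G (c, t) →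
        ContinuousAt (fun c => G (c, t)) c := fun {G} hG =>
      ContinuousAt.comp (f := fun c : Fin m → ℂ => (c, t)) hG.continuousAt (by fun_prop)
    have h0 := modSol_analyticOnNhd (a := a) (b := b) I (c, t) ht
    have h1 := fun i => pdSnd_analyticAt h0 i
    have h2 := fun i j => pdSnd_analyticAt (h1 j) i
    refine ((hc (h2 k k)).add (((continuous_apply k).continuousAt.sub continuousAt_const).mul
      (hc (h1 k)))).sub (continuousAt_const.mul ?_)
    refine ContinuousAt.add (ContinuousAt.add ?_ (continuousAt_const.mul ?_))
      (continuousAt_const.mul (hc h0))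
    · exact tendsto_finsetSum _ fun i _ => tendsto_finsetSum _ fun j _ => hc (h2 i j)
    · exact tendsto_finsetSum _ fun i _ => hc (h1 i)
  refine eq_of_eq_on_nonInt (f := fun c => opLog a b c k (fun t => modSol a b I (c, t)) t)
    (g := fun _ => 0) hcont continuousAt_const fun c' hc' => ?_
  rw [opLog_congr (g := fun t => ∑ J : Fin m → Fin 2, (∏ k, projCoef c' k (I k) (J k)) *
    frobSer a b J (c', t)), opLog_sum]
  · exact Finset.sum_eq_zero fun J _ => by rw [opLog_frobSer a b J c' k ht, mul_zero]
  · exact fun J _ => analyticAt_slice (frobSer_analyticOnNhd a b J (c', t) ht)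
  · filter_upwards [(isOpen_logDomain m).mem_nhds ht] with u hu
    exact modSol_eq I hc' hu

end

/-! ### Logarithmic coordinates -/

section

variable {m : ℕ} {a b : ℂ} {x₀ ℓ x : Fin m → ℂ}

theorem exp_logCoord (hℓ : ∀ k, Complex.exp (ℓ k) = x₀ k) {k : Fin m} (hx : x k ≠ 0) :
    Complex.exp (logCoord x₀ ℓ x k) = x k := by
  have h0 : x₀ k ≠ 0 := by rw [← hℓ k]; exact Complex.exp_ne_zero _
  rw [logCoord, logBr, Complex.exp_add, hℓ, Complex.exp_log (div_ne_zero hx h0),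
    mul_div_cancel₀ _ h0]

theorem ne_zero_of_mem_slitDomain (hx : x ∈ slitDomain x₀) (k : Fin m) : x k ≠ 0 := fun h => by
  have := Complex.slitPlane_ne_zero (hx.2 k)
  rw [h, zero_div] at this
  exact this rfl

theorem mem_logDomain_of_exp (hx : x ∈ convDomain m) {t : Fin m → ℂ}
    (ht : ∀ k, Complex.exp (t k) = x k) : t ∈ logDomain m := by
  have : ∀ k, Real.exp ((t k).re / 2) = Real.sqrt ‖x k‖ := fun k => by
    rw [Real.exp_half, ← ht k, Complex.norm_exp]
  change ∑ k, Real.exp ((t k).re / 2) < 1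
  simp only [this]
  exact hx

theorem logCoord_mem_logDomain (hℓ : ∀ k, Complex.exp (ℓ k) = x₀ k) (hx : x ∈ slitDomain x₀) :
    logCoord x₀ ℓ x ∈ logDomain m :=
  mem_logDomain_of_exp hx.1 fun _ => exp_logCoord hℓ (ne_zero_of_mem_slitDomain hx _)

theorem isOpen_slitDomain (x₀ : Fin m → ℂ) : IsOpen (slitDomain x₀) := by
  have h1 : IsOpen (convDomain m) := isOpen_lt (by fun_prop) continuous_const
  have h2 : IsOpen {x : Fin m → ℂ | ∀ k, x k / x₀ k ∈ Complex.slitPlane} := by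
    simp only [Set.ofPred_forall]
    exact isOpen_iInter_of_finite fun k => Complex.isOpen_slitPlane.preimage (by fun_prop)
  exact h1.inter h2

theorem logBr_analyticAt {k : Fin m} (hx : x k / x₀ k ∈ Complex.slitPlane) :
    AnalyticAt ℂ (logBr x₀ ℓ k) x := by
  have h1 : AnalyticAt ℂ (fun y : Fin m → ℂ => y k / x₀ k) x := by
    simp only [div_eq_mul_inv]
    exact ((ContinuousLinearMap.proj (R := ℂ) (φ := fun _ : Fin m => ℂ) k).analyticAt x).mul
      analyticAt_const
  exact analyticAt_const.add (h1.clog hx)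

theorem logCoord_analyticAt (hx : x ∈ slitDomain x₀) : AnalyticAt ℂ (logCoord x₀ ℓ) x :=
  analyticAt_pi_iff.2 fun k => logBr_analyticAt (hx.2 k)

theorem theta_comp_logCoord {g : (Fin m → ℂ) → ℂ} (hx : x ∈ slitDomain x₀)
    (hg : AnalyticAt ℂ g (logCoord x₀ ℓ x)) (k : Fin m) :
    theta k (fun x => g (logCoord x₀ ℓ x)) x = pd k g (logCoord x₀ ℓ x) := by
  have hd : ∀ j, HasFDerivAt (logBr x₀ ℓ j)
      ((x j)⁻¹ • ContinuousLinearMap.proj (R := ℂ) (φ := fun _ : Fin m => ℂ) j) x := fun j => by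
    have h0 : x j ≠ 0 := ne_zero_of_mem_slitDomain hx j
    have h00 : x₀ j ≠ 0 := fun h => by
      have := Complex.slitPlane_ne_zero (hx.2 j)
      rw [h, div_zero] at this
      exact this rfl
    have h1 : HasFDerivAt (fun y : Fin m → ℂ => y j / x₀ j)
        ((x₀ j)⁻¹ • ContinuousLinearMap.proj (R := ℂ) (φ := fun _ : Fin m => ℂ) j) x := by
      simp only [div_eq_mul_inv]
      exact (ContinuousLinearMap.proj (R := ℂ) (φ := fun _ : Fin m => ℂ) j).hasFDerivAt.mul_const _
    have h2 := (h1.clog (hx.2 j)).const_add (ℓ j)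
    refine h2.congr_fderiv ?_
    rw [smul_smul]
    congr 1
    field_simp
  have hL : HasFDerivAt (logCoord x₀ ℓ) (ContinuousLinearMap.pi fun j =>
      (x j)⁻¹ • ContinuousLinearMap.proj (R := ℂ) (φ := fun _ : Fin m => ℂ) j) x :=
    hasFDerivAt_pi.2 hd
  have h := hg.differentiableAt.hasFDerivAt.comp x hL
  have hdir : (ContinuousLinearMap.pi fun j =>
      (x j)⁻¹ • ContinuousLinearMap.proj (R := ℂ) (φ := fun _ : Fin m => ℂ) j) (Pi.single k 1) =
      (x k)⁻¹ • (Pi.single k 1 : Fin m → ℂ) := by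
    ext j
    by_cases hj : j = k
    · subst hj; simp
    · simp [hj]
  unfold theta pd
  change x k * fderiv ℂ (g ∘ logCoord x₀ ℓ) x _ = _
  rw [h.fderiv, ContinuousLinearMap.comp_apply, hdir, map_smul, smul_eq_mul,
    mul_inv_cancel_left₀ (ne_zero_of_mem_slitDomain hx k)]

theorem theta_congr {f g : (Fin m → ℂ) → ℂ} (h : f =ᶠ[𝓝 x] g) (k : Fin m) :
    theta k f x = theta k g x := by
  unfold theta
  rw [h.fderiv_eq]

theorem theta_sum {ι : Type*} (s : Finset ι) {f : ι → (Fin m → ℂ) → ℂ}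
    (hf : ∀ i ∈ s, AnalyticAt ℂ (f i) x) (k : Fin m) :
    theta k (fun x => ∑ i ∈ s, f i x) x = ∑ i ∈ s, theta k (f i) x := by
  have h : HasFDerivAt (fun x => ∑ i ∈ s, f i x) (∑ i ∈ s, fderiv ℂ (f i) x) x :=
    HasFDerivAt.fun_sum fun i hi => (hf i hi).differentiableAt.hasFDerivAt
  unfold theta
  rw [h.fderiv]
  simp [_root_.sum_apply, Finset.mul_sum]

theorem opEC_eq {f : (Fin m → ℂ) → ℂ} (hf : AnalyticAt ℂ f x) (c : Fin m → ℂ) (k : Fin m) :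
    opEC a b c k f x = theta k (theta k f) x + (c k - 1) * theta k f x -
      x k * ((∑ i, ∑ j, theta i (theta j f) x) + (a + b) * ∑ i, theta i f x + a * b * f x) := by
  have h1 : euler (euler f) x = ∑ i, ∑ j, theta i (theta j f) x :=
    Finset.sum_congr rfl fun i _ => theta_sum _ (fun j _ => theta_analyticAt j hf) i
  unfold opEC
  rw [theta_lin k (theta_analyticAt k hf) hf, euler_lin (euler_analyticAt hf) hf, h1]
  simp only [euler]
  ring

theorem opEC_comp_logCoord {g : (Fin m → ℂ) → ℂ} (hℓ : ∀ k, Complex.exp (ℓ k) = x₀ k)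
    (hx : x ∈ slitDomain x₀) (hg : AnalyticAt ℂ g (logCoord x₀ ℓ x)) (c : Fin m → ℂ) (k : Fin m) :
    opEC a b c k (fun x => g (logCoord x₀ ℓ x)) x = opLog a b c k g (logCoord x₀ ℓ x) := by
  have hL := logCoord_analyticAt (ℓ := ℓ) hx
  have h2 : ∀ i j, theta i (theta j fun x => g (logCoord x₀ ℓ x)) x =
      pd i (pd j g) (logCoord x₀ ℓ x) := fun i j => by
    rw [← theta_comp_logCoord (g := pd j g) hx (AnalyticAt.pd hg j)]
    refine theta_congr ?_ i
    filter_upwards [(isOpen_slitDomain x₀).mem_nhds hx,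
      hL.continuousAt.eventually hg.eventually_analyticAt] with y hy hgy
    exact theta_comp_logCoord hy hgy j
  rw [opEC_eq (AnalyticAt.fun_comp hg hL)]
  unfold opLog
  simp only [h2, theta_comp_logCoord hx hg, exp_logCoord hℓ (ne_zero_of_mem_slitDomain hx k)]

theorem add_int_two_pi_I_periodic {Φ : (Fin m → ℂ) → ℂ} {k : Fin m}
    (hper : ∀ t ∈ logDomain m, Φ (t + Pi.single k (2 * Real.pi * Complex.I)) = Φ t)
    {t : Fin m → ℂ} (ht : t ∈ logDomain m) (n : ℤ) :
    Φ (t + Pi.single k (n * (2 * Real.pi * Complex.I))) = Φ t := by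
  have hstep : ∀ n : ℤ, Φ (t + Pi.single k ((n + 1 : ℤ) * (2 * Real.pi * Complex.I))) =
      Φ (t + Pi.single k (n * (2 * Real.pi * Complex.I))) := fun n => by
    rw [← hper _ (add_two_pi_I_mem_logDomain ht k (n * (2 * Real.pi * Complex.I)) (by simp)),
      add_assoc, ← Pi.single_add]
    congr 3
    push_cast
    ring
  induction n using Int.induction_on with
  | zero => simp
  | succ n ih => rw [hstep, ih]
  | pred n ih => rw [← ih, ← hstep]; simp

/-- With period `2πi` in `t_k`, the choice of branch of `log x_k` is immaterial; near the cut the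
given branch is exchanged for one that is analytic there. -/
theorem analyticOnNhd_loopDomain {Φ : (Fin m → ℂ) → ℂ} (hℓ : ∀ k, Complex.exp (ℓ k) = x₀ k)
    {k : Fin m} (hΦ : AnalyticOnNhd ℂ Φ (logDomain m))
    (hper : ∀ t ∈ logDomain m, Φ (t + Pi.single k (2 * Real.pi * Complex.I)) = Φ t) :
    AnalyticOnNhd ℂ (fun x => Φ (logCoord x₀ ℓ x)) (loopDomain x₀ k) := by
  have h00 : x₀ k ≠ 0 := by rw [← hℓ k]; exact Complex.exp_ne_zero _
  have hne : ∀ {x}, x ∈ loopDomain x₀ k → ∀ j, x j ≠ 0 := fun {x} hx j => by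
    by_cases hj : j = k
    · rw [hj]; exact hx.2.1
    · intro h
      have := Complex.slitPlane_ne_zero (hx.2.2 j hj)
      rw [h, zero_div] at this
      exact this rfl
  intro x hx
  by_cases hk : x k / x₀ k ∈ Complex.slitPlane
  · have hx' : x ∈ slitDomain x₀ := ⟨hx.1, fun j => by
      by_cases hj : j = k
      · rw [hj]; exact hk
      · exact hx.2.2 j hj⟩
    exact AnalyticAt.fun_comp (hΦ _ (logCoord_mem_logDomain hℓ hx')) (logCoord_analyticAt hx')
  · have hneg : -(x k / x₀ k) ∈ Complex.slitPlane := by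
      rw [Complex.mem_slitPlane_iff] at hk ⊢
      push Not at hk
      left
      have h1 : x k / x₀ k ≠ 0 := div_ne_zero hx.2.1 h00
      rw [Complex.neg_re, neg_pos]
      refine lt_of_le_of_ne hk.1 fun h => h1 (Complex.ext h hk.2)
    -- A branch of `log y_k` whose cut is the ray through `x₀ k`; the term `π i` compensates the
    -- sign inside the logarithm.
    let β : (Fin m → ℂ) → ℂ := fun y => ℓ k + (Complex.log (-(y k / x₀ k)) + Real.pi * Complex.I)
    let τ : (Fin m → ℂ) → Fin m → ℂ := fun y => Function.update (logCoord x₀ ℓ y) k (β y)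
    have hβ : AnalyticAt ℂ β x := by
      have h1 : AnalyticAt ℂ (fun y : Fin m → ℂ => -(y k / x₀ k)) x := by
        simp only [div_eq_mul_inv]
        exact (((ContinuousLinearMap.proj (R := ℂ) (φ := fun _ : Fin m => ℂ) k).analyticAt x).mul
          analyticAt_const).neg
      exact analyticAt_const.add ((h1.clog hneg).add analyticAt_const)
    have hτ : AnalyticAt ℂ τ x := by
      refine analyticAt_pi_iff.2 fun j => ?_
      by_cases hj : j = k
      · subst hj
        simpa [τ] using hβ
      · simpa [τ, hj, logCoord] using logBr_analyticAt (hx.2.2 j hj)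
    have hβe : ∀ y : Fin m → ℂ, y k ≠ 0 → Complex.exp (β y) = y k := fun y hy => by
      simp only [β]
      rw [Complex.exp_add, Complex.exp_add, hℓ, Complex.exp_log (neg_ne_zero.2 (div_ne_zero hy h00)),
        Complex.exp_pi_mul_I]
      field_simp
    have hτe : ∀ {y : Fin m → ℂ}, (∀ j, y j ≠ 0) → ∀ j, Complex.exp (τ y j) = y j :=
      fun {y} hy j => by
        by_cases hj : j = k
        · subst hj
          simpa [τ] using hβe y (hy j)
        · simpa [τ, hj] using exp_logCoord hℓ (hy j)
    have hτd : τ x ∈ logDomain m := mem_logDomain_of_exp hx.1 (hτe (hne hx))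
    refine (AnalyticAt.fun_comp (hΦ _ hτd) hτ).congr ?_
    have hev : ∀ᶠ y in 𝓝 x, ∀ j, y j ≠ 0 :=
      eventually_all.2 fun j => (continuous_apply j).continuousAt.eventually_ne (hne hx j)
    filter_upwards [hev, hτ.continuousAt.eventually ((isOpen_logDomain m).mem_nhds hτd)]
      with y hy hyd
    obtain ⟨n, hn⟩ := Complex.exp_eq_exp_iff_exists_int.1
      ((exp_logCoord hℓ (hy k)).trans (hτe hy k).symm)
    have : logCoord x₀ ℓ y = τ y + Pi.single k (n * (2 * Real.pi * Complex.I)) := by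
      ext j
      by_cases hj : j = k
      · subst hj
        simpa using hn
      · simp [τ, hj]
    change Φ (τ y) = Φ (logCoord x₀ ℓ y)
    rw [this, add_int_two_pi_I_periodic hper hyd]

/-! ### The limit that defines the modified vector -/

theorem vecFP_eq_modSol (hℓ : ∀ k, Complex.exp (ℓ k) = x₀ k) {c : Fin m → ℂ} (hc : c ∈ nonInt m)
    (hx : x ∈ slitDomain x₀) (I : Fin m → Fin 2) :
    vecFP a b x₀ ℓ c x I = modSol a b I (c, logCoord x₀ ℓ x) := by
  rw [vecFP_eq hc fun k => exp_logCoord hℓ (ne_zero_of_mem_slitDomain hx k),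
    modSol_eq I hc (logCoord_mem_logDomain hℓ hx)]

theorem vecFt_eq_modSol (hℓ : ∀ k, Complex.exp (ℓ k) = x₀ k) (c : Fin m → ℂ)
    (hx : x ∈ slitDomain x₀) (I : Fin m → Fin 2) :
    vecFt a b x₀ ℓ c x I = modSol a b I (c, logCoord x₀ ℓ x) := by
  refine Tendsto.limUnder_eq ?_
  refine ((modSol_continuousAt_param I c (logCoord_mem_logDomain hℓ hx)).tendsto.mono_left
    nhdsWithin_le_nhds).congr' ?_
  filter_upwards [self_mem_nhdsWithin] with c' hc'
  exact (vecFP_eq_modSol hℓ hc' hx I).symm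

/-- Joint continuity of `modSol` at `(c, x)` puts both functions close to one number on a product
neighbourhood. -/
theorem tendstoLocallyUniformlyOn_vecFP (hℓ : ∀ k, Complex.exp (ℓ k) = x₀ k) (c : Fin m → ℂ)
    (I : Fin m → Fin 2) :
    TendstoLocallyUniformlyOn (fun c' x => vecFP a b x₀ ℓ c' x I)
      (fun x => vecFt a b x₀ ℓ c x I) (𝓝[nonInt m] c) (slitDomain x₀) := by
  rw [Metric.tendstoLocallyUniformlyOn_iff]
  intro ε hε x hx
  have hcont : ContinuousAt (fun q : (Fin m → ℂ) × (Fin m → ℂ) =>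
      modSol a b I (q.1, logCoord x₀ ℓ q.2)) (c, x) := by
    refine ContinuousAt.comp (f := fun q : (Fin m → ℂ) × (Fin m → ℂ) => (q.1, logCoord x₀ ℓ q.2))
      (modSol_analyticOnNhd I _ (logCoord_mem_logDomain hℓ hx)).continuousAt ?_
    refine continuousAt_fst.prodMk ?_
    exact ContinuousAt.comp (f := Prod.snd) (g := logCoord x₀ ℓ)
      (logCoord_analyticAt (ℓ := ℓ) hx).continuousAt continuousAt_snd
  obtain ⟨V, hV, W, hW, hVW⟩ := mem_nhds_prod_iff.1
    (Metric.continuousAt_iff'.1 hcont (ε / 2) (half_pos hε))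
  refine ⟨W ∩ slitDomain x₀, inter_mem (mem_nhdsWithin_of_mem_nhds hW) self_mem_nhdsWithin, ?_⟩
  filter_upwards [self_mem_nhdsWithin, mem_nhdsWithin_of_mem_nhds hV] with c' hc' hV' y hy
  rw [vecFt_eq_modSol hℓ c hy.2, vecFP_eq_modSol hℓ hc' hy.2]
  have h1 : dist (modSol a b I (c, logCoord x₀ ℓ y)) (modSol a b I (c, logCoord x₀ ℓ x)) < ε / 2 :=
    hVW (Set.mk_mem_prod (mem_of_mem_nhds hV) hy.1)
  have h2 : dist (modSol a b I (c', logCoord x₀ ℓ y)) (modSol a b I (c, logCoord x₀ ℓ x)) < ε / 2 :=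
    hVW (Set.mk_mem_prod hV' hy.1)
  calc _ ≤ _ := dist_triangle_right _ _ _
    _ < ε / 2 + ε / 2 := add_lt_add h1 h2
    _ = ε := add_halves ε

end

/-! ### Iterated partial derivatives along words -/

section

variable {m : ℕ}

/-- The iterated partial derivative along a word of indices. -/
def pdWord : List (Fin m) → ((Fin m → ℂ) → ℂ) → (Fin m → ℂ) → ℂ
  | [], g => g
  | k :: w, g => pdWord w (pd k g)

variable {ℓ : Fin m → ℂ}

theorem pdWord_congr (w : List (Fin m)) {f g : (Fin m → ℂ) → ℂ} (h : f =ᶠ[𝓝 ℓ] g) :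
    pdWord w f ℓ = pdWord w g ℓ := by
  induction w generalizing f g with
  | nil => exact h.self_of_nhds
  | cons k w ih => exact ih (pd_eventuallyEq h k)

theorem pdWord_sum (w : List (Fin m)) {ι : Type*} (s : Finset ι) (A : ι → ℂ)
    {f : ι → (Fin m → ℂ) → ℂ} (hf : ∀ i ∈ s, AnalyticAt ℂ (f i) ℓ) :
    pdWord w (fun t => ∑ i ∈ s, A i * f i t) ℓ = ∑ i ∈ s, A i * pdWord w (f i) ℓ := by
  induction w generalizing f with
  | nil => rfl
  | cons k w ih =>
    change pdWord w (pd k _) ℓ = ∑ i ∈ s, A i * pdWord w (pd k (f i)) ℓ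
    rw [← ih fun i hi => AnalyticAt.pd (hf i hi) k]
    refine pdWord_congr w ?_
    have h : ∀ᶠ u in 𝓝 ℓ, ∀ i ∈ s, AnalyticAt ℂ (f i) u :=
      (eventually_all_finset s).2 fun i hi => (hf i hi).eventually_analyticAt
    exact h.mono fun u hu => pd_sum s A hu k

theorem pdWord_add_mul (w : List (Fin m)) {f g : (Fin m → ℂ) → ℂ} (hf : AnalyticAt ℂ f ℓ)
    (hg : AnalyticAt ℂ g ℓ) (r : ℂ) :
    pdWord w (fun t => f t + r * g t) ℓ = pdWord w f ℓ + r * pdWord w g ℓ := by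
  have h := pdWord_sum w Finset.univ ![1, r] (f := ![f, g]) (ℓ := ℓ) fun i _ => by
    fin_cases i
    · exact hf
    · exact hg
  simpa using h

theorem pd_comm {g : (Fin m → ℂ) → ℂ} {t : Fin m → ℂ} (hg : AnalyticAt ℂ g t) (k l : Fin m) :
    pd k (pd l g) t = pd l (pd k g) t := by
  have hs : IsSymmSndFDerivAt ℂ g t := hg.contDiffAt.isSymmSndFDerivAt (n := ⊤) (by simp)
  have h : ∀ v w : Fin m → ℂ, fderiv ℂ (fun y => fderiv ℂ g y v) t w = fderiv ℂ (fderiv ℂ g) t w v :=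
    fun v w => by
      have h1 := ((ContinuousLinearMap.apply ℂ ℂ v).hasFDerivAt (x := fderiv ℂ g t)).comp t
        hg.fderiv.differentiableAt.hasFDerivAt
      change fderiv ℂ (⇑(ContinuousLinearMap.apply ℂ ℂ v) ∘ fderiv ℂ g) t w = _
      rw [h1.fderiv]
      rfl
  change fderiv ℂ (fun y => fderiv ℂ g y _) t _ = fderiv ℂ (fun y => fderiv ℂ g y _) t _
  rw [h, h]
  exact hs _ _

theorem pdWord_perm {w w' : List (Fin m)} (hw : w.Perm w') {g : (Fin m → ℂ) → ℂ}
    (hg : AnalyticAt ℂ g ℓ) : pdWord w g ℓ = pdWord w' g ℓ := by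
  induction hw generalizing g with
  | nil => rfl
  | cons k _ ih => exact ih (AnalyticAt.pd hg k)
  | swap k l w =>
    exact pdWord_congr w (hg.eventually_analyticAt.mono fun u hu => pd_comm hu k l)
  | trans _ _ ih₁ ih₂ => exact (ih₁ hg).trans (ih₂ hg)

theorem pd_cexp_mul {h : (Fin m → ℂ) → ℂ} {t : Fin m → ℂ} (hh : AnalyticAt ℂ h t) (j k : Fin m) :
    pd j (fun t => Complex.exp (t k) * h t) t =
      Complex.exp (t k) * (pd j h t + (Pi.single j (1 : ℂ) : Fin m → ℂ) k * h t) := by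
  have h1 : HasFDerivAt (fun t : Fin m → ℂ => t k)
      (ContinuousLinearMap.proj (R := ℂ) (φ := fun _ : Fin m => ℂ) k) t :=
    (ContinuousLinearMap.proj (R := ℂ) (φ := fun _ : Fin m => ℂ) k).hasFDerivAt
  unfold pd
  rw [(h1.cexp.fun_mul hh.differentiableAt.hasFDerivAt).fderiv]
  simp
  ring

/-- In Leibniz' rule, every term in which the exponential is differentiated contains a shorter
derivative of `h`, and these vanish at `ℓ`. -/
theorem pdWord_cexp_mul (w : List (Fin m)) {h : (Fin m → ℂ) → ℂ} (hh : AnalyticAt ℂ h ℓ)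
    (hw : ∀ u : List (Fin m), u.length < w.length → pdWord u h ℓ = 0) (k : Fin m) :
    pdWord w (fun t => Complex.exp (t k) * h t) ℓ = Complex.exp (ℓ k) * pdWord w h ℓ := by
  induction w generalizing h with
  | nil => rfl
  | cons j w ih =>
    have hj := AnalyticAt.pd hh j
    set r := (Pi.single j (1 : ℂ) : Fin m → ℂ) k
    have h0 : pdWord w h ℓ = 0 := hw w (by simp)
    change pdWord w (pd j _) ℓ = Complex.exp (ℓ k) * pdWord w (pd j h) ℓ
    rw [pdWord_congr w (hh.eventually_analyticAt.mono fun u hu => pd_cexp_mul hu j k),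
      ih (h := fun t => pd j h t + r * h t) (hj.add (analyticAt_const.mul hh)), pdWord_add_mul w hj hh, h0, mul_zero, add_zero]
    intro u hu
    rw [pdWord_add_mul u hj hh, hw u (by simp; omega), mul_zero, add_zero]
    exact hw (j :: u) (by simpa using hu)

/-- An analytic function all of whose partial derivatives vanish at a point vanishes near it. -/
theorem eventually_eq_zero_of_pdWord {g : (Fin m → ℂ) → ℂ} (hg : AnalyticAt ℂ g ℓ)
    (h0 : ∀ w, pdWord w g ℓ = 0) : ∀ᶠ t in 𝓝 ℓ, g t = 0 := by
  -- On the diagonal, iterated Fréchet derivatives are combinations of derivatives along words, and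
  -- the diagonal values give the terms of the Taylor series.
  have key : ∀ (v : Fin m → ℂ) (n : ℕ) {h : (Fin m → ℂ) → ℂ}, AnalyticAt ℂ h ℓ →
      (∀ w, pdWord w h ℓ = 0) → iteratedFDeriv ℂ n h ℓ (fun _ => v) = 0 := by
    intro v n
    induction n with
    | zero => intro h _ hw; exact hw []
    | succ n ih =>
      intro h hh hw
      rw [iteratedFDeriv_succ_apply_right]
      have hv : (fun t => fderiv ℂ h t v) = fun t => ∑ k, v k * pd k h t := by
        funext t
        conv_lhs => rw [pi_eq_sum_univ' v]
        simp [pd, map_sum]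
      have h1 := (ContinuousLinearMap.apply ℂ ℂ v).iteratedFDeriv_comp_left (i := n) (n := n)
        (hh.fderiv.contDiffAt) le_rfl
      have h2 : iteratedFDeriv ℂ n (fun t => fderiv ℂ h t v) ℓ (fun _ => v) = 0 := by
        refine ih ?_ fun w => ?_
        · rw [hv]
          exact Finset.analyticAt_fun_sum _ fun k _ => analyticAt_const.mul (AnalyticAt.pd hh k)
        · rw [hv, pdWord_sum w _ _ fun k _ => AnalyticAt.pd hh k]
          exact Finset.sum_eq_zero fun k _ => by
            rw [show pdWord w (pd k h) ℓ = 0 from hw (k :: w), mul_zero]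
      have h3 := congrArg (fun M => M fun _ => v) h1
      exact h3.symm.trans h2
  obtain ⟨p, r, hp⟩ := hg
  filter_upwards [Metric.eball_mem_nhds ℓ hp.r_pos] with t ht
  have h1 := hp.hasSum_sub ht
  have h2 : ∀ n, p n (fun _ => t - ℓ) = 0 := fun n => by
    have := hp.factorial_smul (t - ℓ) n
    rw [key _ _ hp.analyticAt h0, smul_eq_zero] at this
    exact this.resolve_left (Nat.factorial_ne_zero n)
  simp only [h2] at h1
  exact h1.unique hasSum_zero

end

/-! ### The rank of the system is at most `2 ^ m` -/

section

variable {m : ℕ} {a b : ℂ} {c x₀ ℓ : Fin m → ℂ}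

theorem exists_perm_cons_cons_of_not_nodup {α : Type*} [DecidableEq α] {w : List α} (hw : ¬ w.Nodup) :
    ∃ k v, w.Perm (k :: k :: v) := by
  rw [List.nodup_iff_count_le_one] at hw
  push Not at hw
  obtain ⟨k, hk⟩ := hw
  have h1 : k ∈ w := List.count_pos_iff.1 (by omega)
  have h2 : k ∈ w.erase k := List.count_pos_iff.1 (by rw [List.count_erase_self]; omega)
  exact ⟨k, (w.erase k).erase k,
    (List.perm_cons_erase h1).trans ((List.perm_cons_erase h2).cons k)⟩

/-- Only the second-order part of the equation, differentiated along `v`, survives: every other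
contribution contains a derivative of lower order, which vanishes at `ℓ`. -/
theorem pdWord_cons_cons_of_opLog {g : (Fin m → ℂ) → ℂ} (hg : AnalyticAt ℂ g ℓ) {k : Fin m}
    (hk : ∀ᶠ t in 𝓝 ℓ, opLog a b c k g t = 0) (v : List (Fin m))
    (h0 : ∀ u : List (Fin m), u.length < v.length + 2 → pdWord u g ℓ = 0) :
    pdWord (k :: k :: v) g ℓ = Complex.exp (ℓ k) * ∑ i, ∑ j, pdWord (i :: j :: v) g ℓ := by
  set h : (Fin m → ℂ) → ℂ := fun t =>
    (∑ p : Fin m × Fin m, 1 * pd p.2 (pd p.1 g) t) + 1 * ((∑ i, (a + b) * pd i g t) + a * b * g t)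
    with hh
  have hp : ∀ p : Fin m × Fin m, AnalyticAt ℂ (pd p.2 (pd p.1 g)) ℓ :=
    fun p => AnalyticAt.pd (AnalyticAt.pd hg _) _
  have hs1 : AnalyticAt ℂ (fun t => ∑ p : Fin m × Fin m, 1 * pd p.2 (pd p.1 g) t) ℓ :=
    Finset.analyticAt_fun_sum _ fun p _ => analyticAt_const.mul (hp p)
  have hs2 : AnalyticAt ℂ (fun t => ∑ i, (a + b) * pd i g t) ℓ :=
    Finset.analyticAt_fun_sum _ fun i _ => analyticAt_const.mul (AnalyticAt.pd hg i)
  have hs3 : AnalyticAt ℂ (fun t => (∑ i, (a + b) * pd i g t) + a * b * g t) ℓ :=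
    hs2.add (analyticAt_const.mul hg)
  have hhan : AnalyticAt ℂ h ℓ := hs1.add (analyticAt_const.mul hs3)
  have hword : ∀ u : List (Fin m), u.length ≤ v.length →
      pdWord u h ℓ = ∑ p : Fin m × Fin m, pdWord (p.1 :: p.2 :: u) g ℓ := fun u hu => by
    rw [hh, pdWord_add_mul u hs1 hs3, pdWord_add_mul u hs2 hg, pdWord_sum u _ _ fun p _ => hp p,
      pdWord_sum u _ _ fun i _ => AnalyticAt.pd hg i, h0 u (by omega),
      Finset.sum_eq_zero (s := Finset.univ) (f := fun i => (a + b) * pdWord u (pd i g) ℓ)]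
    · simp [pdWord]
    · intro i _
      rw [show pdWord u (pd i g) ℓ = 0 from h0 (i :: u) (by simp; omega), mul_zero]
  have hE : AnalyticAt ℂ (fun t : Fin m → ℂ => Complex.exp (t k) * h t) ℓ :=
    ((ContinuousLinearMap.proj (R := ℂ) (φ := fun _ : Fin m => ℂ) k).analyticAt ℓ).cexp.mul hhan
  have heq : pd k (pd k g) =ᶠ[𝓝 ℓ] fun t => Complex.exp (t k) * h t + (1 - c k) * pd k g t := by
    filter_upwards [hk] with t ht
    unfold opLog at ht
    simp only [hh, Fintype.sum_prod_type, one_mul]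
    rw [Finset.sum_comm, ← Finset.mul_sum]
    linear_combination ht
  change pdWord v (pd k (pd k g)) ℓ = _
  rw [pdWord_congr v heq, pdWord_add_mul v hE (AnalyticAt.pd hg k),
    show pdWord v (pd k g) ℓ = 0 from h0 (k :: v) (by simp),
    pdWord_cexp_mul v hhan fun u hu => ?_, hword v le_rfl, Fintype.sum_prod_type, mul_zero, add_zero]
  rw [hword u hu.le]
  exact Finset.sum_eq_zero fun p _ => h0 _ (by simp; omega)

/-- A solution near a point of the domain of convergence is determined by its square-free partial
derivatives at this point. -/
theorem pdWord_eq_zero_of_nodup (hℓ : ℓ ∈ logDomain m) {g : (Fin m → ℂ) → ℂ}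
    (hg : AnalyticAt ℂ g ℓ) (hsol : ∀ k, ∀ᶠ t in 𝓝 ℓ, opLog a b c k g t = 0)
    (h0 : ∀ w : List (Fin m), w.Nodup → pdWord w g ℓ = 0) (w : List (Fin m)) :
    pdWord w g ℓ = 0 := by
  induction hd : w.length using Nat.strong_induction_on generalizing w with
  | _ d ih =>
  -- With the weights `s_k = √|x_k|` the equation bounds a weighted derivative along a word with a
  -- repeated letter by `(∑ s_k) ^ 2 * M`, where `M` is the maximum over words of this length. As `∑
  -- s_k < 1`, a maximum attained at such a word is 0; at a square-free word it is 0 by hypothesis.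
  set s : Fin m → ℝ := fun k => Real.exp ((ℓ k).re / 2) with hs
  have hspos : ∀ k, 0 < s k := fun k => Real.exp_pos _
  have hs1 : ∑ k, s k < 1 := hℓ
  have hs0 : 0 ≤ ∑ k, s k := Finset.sum_nonneg fun k _ => (hspos k).le
  set W : List (Fin m) → ℝ := fun w => (w.map s).prod with hW
  have hWpos : ∀ w, 0 < W w := fun w => List.prod_pos (by simp [hspos])
  obtain ⟨w₁, hw₁, hmax⟩ := Set.exists_max_image {l : List (Fin m) | l.length = d}
    (fun w => ‖pdWord w g ℓ‖ / W w) (List.finite_length_eq _ d) ⟨w, hd⟩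
  set M := ‖pdWord w₁ g ℓ‖ / W w₁ with hM
  have hM0 : 0 ≤ M := div_nonneg (norm_nonneg _) (hWpos _).le
  have hle : ∀ w : List (Fin m), w.length = d → ‖pdWord w g ℓ‖ ≤ M * W w := fun w hw =>
    (div_le_iff₀ (hWpos w)).1 (hmax w hw)
  have hMz : M = 0 := by
    by_cases hnd : w₁.Nodup
    · rw [hM, h0 _ hnd, norm_zero, zero_div]
    obtain ⟨k, v, hkv⟩ := exists_perm_cons_cons_of_not_nodup hnd
    have hlen : v.length + 2 = d := by
      have := hkv.length_eq
      rw [show w₁.length = d from hw₁] at this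
      simpa using this.symm
    have h1 : ‖pdWord w₁ g ℓ‖ ≤ (∑ k, s k) ^ 2 * M * W w₁ := by
      rw [pdWord_perm hkv hg, pdWord_cons_cons_of_opLog hg (hsol k) v
        (fun u hu => ih u.length (by omega) u rfl), norm_mul, Complex.norm_exp,
        show W w₁ = s k * (s k * W v) by rw [hW]; simp only; rw [(hkv.map s).prod_eq]; simp]
      have h2 : Real.exp (ℓ k).re = s k * s k := by rw [hs, ← Real.exp_add]; ring_nf
      have h3 : ‖∑ i, ∑ j, pdWord (i :: j :: v) g ℓ‖ ≤ ∑ i, ∑ j, s i * s j * (M * W v) := by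
        refine (norm_sum_le _ _).trans (Finset.sum_le_sum fun i _ => (norm_sum_le _ _).trans
          (Finset.sum_le_sum fun j _ => (hle _ (by simpa using hlen)).trans_eq ?_))
        simp [hW]
        ring
      have h4 : ∑ i, ∑ j, s i * s j * (M * W v) = (∑ k, s k) ^ 2 * (M * W v) := by
        rw [sq, Finset.sum_mul_sum, Finset.sum_mul]
        exact Finset.sum_congr rfl fun i _ => (Finset.sum_mul _ _ _).symm
      rw [h2]
      calc _ ≤ s k * s k * ((∑ k, s k) ^ 2 * (M * W v)) := by
            rw [← h4]
            exact mul_le_mul_of_nonneg_left h3 (mul_self_nonneg _)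
        _ = _ := by ring
    have h5 : M ≤ (∑ k, s k) ^ 2 * M := (div_le_iff₀ (hWpos _)).2 h1
    have h6 : (∑ k, s k) ^ 2 < 1 := by nlinarith
    nlinarith
  have := hle w hd
  rw [hMz, zero_mul] at this
  exact norm_le_zero_iff.1 this

/-! ### Transfer of the rank bound to germs at the base point. -/

/-- Exponentials of all coordinates. -/
def expCoord (t : Fin m → ℂ) : Fin m → ℂ := fun k => Complex.exp (t k)

theorem expCoord_analyticAt (t : Fin m → ℂ) : AnalyticAt ℂ expCoord t :=
  analyticAt_pi_iff.2 fun k =>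
    ((ContinuousLinearMap.proj (R := ℂ) (φ := fun _ : Fin m => ℂ) k).analyticAt t).cexp

theorem mem_slitDomain_self (hx₀ : x₀ ∈ convDomain m) (hℓ : ∀ k, Complex.exp (ℓ k) = x₀ k) :
    x₀ ∈ slitDomain x₀ :=
  ⟨hx₀, fun k => by
    rw [div_self (by rw [← hℓ k]; exact Complex.exp_ne_zero _)]
    exact Complex.one_mem_slitPlane⟩

theorem logCoord_self (hℓ : ∀ k, Complex.exp (ℓ k) = x₀ k) : logCoord x₀ ℓ x₀ = ℓ := by
  ext k
  rw [logCoord, logBr, div_self (by rw [← hℓ k]; exact Complex.exp_ne_zero _), Complex.log_one,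
    add_zero]

theorem eventually_logCoord_expCoord (hℓ : ∀ k, Complex.exp (ℓ k) = x₀ k) :
    ∀ᶠ t in 𝓝 ℓ, logCoord x₀ ℓ (expCoord t) = t := by
  have h : ∀ᶠ t in 𝓝 ℓ, ∀ k, |(t k - ℓ k).im| < Real.pi := by
    refine eventually_all.2 fun k => ?_
    have hc : ContinuousAt (fun t : Fin m → ℂ => |(t k - ℓ k).im|) ℓ :=
      (continuous_abs.comp (Complex.continuous_im.comp (by fun_prop))).continuousAt
    exact hc.eventually_lt continuousAt_const (by simp [Real.pi_pos])
  filter_upwards [h] with t ht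
  ext k
  rw [logCoord, logBr, expCoord, ← hℓ, ← Complex.exp_sub, Complex.log_exp (abs_lt.1 (ht k)).1
    (abs_lt.1 (ht k)).2.le, add_sub_cancel]

theorem expCoord_base (hℓ : ∀ k, Complex.exp (ℓ k) = x₀ k) : expCoord ℓ = x₀ := funext hℓ

theorem opEC_congr {f g : (Fin m → ℂ) → ℂ} {x : Fin m → ℂ} (h : f =ᶠ[𝓝 x] g)
    (hg : AnalyticAt ℂ g x) (k : Fin m) : opEC a b c k f x = opEC a b c k g x := by
  have h2 : ∀ i, theta i f =ᶠ[𝓝 x] theta i g := fun i =>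
    h.eventually_nhds.mono fun _ hs => theta_congr hs i
  rw [opEC_eq (hg.congr h.symm), opEC_eq hg]
  simp only [theta_congr h, fun i j => theta_congr (h2 j) i, h.self_of_nhds]

/-- A local solution in the original coordinates gives one in logarithmic coordinates. -/
theorem opLog_comp_expCoord (hx₀ : x₀ ∈ convDomain m) (hℓ : ∀ k, Complex.exp (ℓ k) = x₀ k)
    {f : (Fin m → ℂ) → ℂ} (hf : AnalyticAt ℂ f x₀) {k : Fin m}
    (hk : ∀ᶠ x in 𝓝 x₀, opEC a b c k f x = 0) :
    ∀ᶠ t in 𝓝 ℓ, opLog a b c k (fun t => f (expCoord t)) t = 0 := by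
  have hexp : Tendsto expCoord (𝓝 ℓ) (𝓝 x₀) := by
    have := (expCoord_analyticAt ℓ).continuousAt.tendsto
    rwa [expCoord_base hℓ] at this
  have hslit := (isOpen_slitDomain x₀).mem_nhds (mem_slitDomain_self hx₀ hℓ)
  filter_upwards [hexp.eventually hk, hexp.eventually hf.eventually_analyticAt,
    hexp.eventually hslit, eventually_logCoord_expCoord hℓ] with t h1 h2 h3 h4
  have hg : AnalyticAt ℂ (fun t => f (expCoord t)) (logCoord x₀ ℓ (expCoord t)) := by
    rw [h4]
    exact AnalyticAt.fun_comp h2 (expCoord_analyticAt t)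
  have h5 := opEC_comp_logCoord (a := a) (b := b) hℓ h3 hg c k
  rw [h4] at h5
  rw [← h5, ← h1]
  refine opEC_congr ?_ h2 k
  filter_upwards [(isOpen_slitDomain x₀).mem_nhds h3] with y hy
  congr 1
  ext j
  exact exp_logCoord hℓ (ne_zero_of_mem_slitDomain hy j)

/-- Square-free partial derivatives at the base point, in logarithmic coordinates. -/
def jetMap (a b : ℂ) (c : Fin m → ℂ) {x₀ ℓ : Fin m → ℂ} (hℓ : ∀ k, Complex.exp (ℓ k) = x₀ k) :
    localSol a b c x₀ →ₗ[ℂ] (Finset (Fin m) → ℂ) where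
  toFun φ s := Germ.liftOn φ.1 (fun f => pdWord s.toList (fun t => f (expCoord t)) ℓ) fun f g h =>
    pdWord_congr _ <| by
      have := (expCoord_analyticAt ℓ).continuousAt.tendsto
      rw [expCoord_base hℓ] at this
      exact this.eventually h
  map_add' := by
    rintro ⟨_, f, rfl, hf, _⟩ ⟨_, g, rfl, hg, _⟩
    rw [← expCoord_base hℓ] at hf hg
    ext s
    have := pdWord_add_mul s.toList (AnalyticAt.fun_comp hf (expCoord_analyticAt ℓ))
      (AnalyticAt.fun_comp hg (expCoord_analyticAt ℓ)) 1
    simp only [one_mul] at this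
    exact this
  map_smul' := by
    rintro r ⟨_, f, rfl, hf, _⟩
    rw [← expCoord_base hℓ] at hf
    ext s
    have := pdWord_sum s.toList Finset.univ (fun _ : Unit => r) (f := fun _ t => f (expCoord t))
      fun _ _ => AnalyticAt.fun_comp hf (expCoord_analyticAt ℓ)
    simp only [Finset.univ_unique, Finset.sum_singleton] at this
    exact this

theorem jetMap_injective (hx₀ : x₀ ∈ convDomain m) (hℓ : ∀ k, Complex.exp (ℓ k) = x₀ k) :
    Function.Injective (jetMap a b c hℓ) := by
  rw [← LinearMap.ker_eq_bot, LinearMap.ker_eq_bot']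
  rintro ⟨_, f, rfl, hf, hsol⟩ h0
  have hf' : AnalyticAt ℂ (fun t => f (expCoord t)) ℓ := by
    rw [← expCoord_base hℓ] at hf
    exact AnalyticAt.fun_comp hf (expCoord_analyticAt ℓ)
  have hz := eventually_eq_zero_of_pdWord hf' <| pdWord_eq_zero_of_nodup
    (mem_logDomain_of_exp hx₀ hℓ) hf' (fun k => opLog_comp_expCoord hx₀ hℓ hf (hsol k))
    fun w hw => (pdWord_perm (List.toFinset_toList hw).symm hf').trans (congrFun h0 w.toFinset)
  refine Subtype.ext (Germ.coe_eq.2 ?_)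
  have hslit := mem_slitDomain_self hx₀ hℓ
  have hL := (logCoord_analyticAt (ℓ := ℓ) hslit).continuousAt.tendsto
  rw [logCoord_self hℓ] at hL
  filter_upwards [hL.eventually hz, (isOpen_slitDomain x₀).mem_nhds hslit] with x hx hxs
  have : expCoord (logCoord x₀ ℓ x) = x :=
    funext fun k => exp_logCoord hℓ (ne_zero_of_mem_slitDomain hxs k)
  rwa [this] at hx

theorem localSol_finite (hx₀ : x₀ ∈ convDomain m) (hℓ : ∀ k, Complex.exp (ℓ k) = x₀ k) :
    Module.Finite ℂ (localSol a b c x₀) :=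
  Module.Finite.of_injective (jetMap a b c hℓ) (jetMap_injective hx₀ hℓ)

theorem finrank_localSol_le (hx₀ : x₀ ∈ convDomain m) (hℓ : ∀ k, Complex.exp (ℓ k) = x₀ k) :
    Module.finrank ℂ (localSol a b c x₀) ≤ 2 ^ m := by
  have h := LinearMap.finrank_le_finrank_of_injective (jetMap_injective (a := a) (b := b) (c := c) hx₀ hℓ)
  simpa using h

end

/-! ### Linear independence -/

section

variable {m : ℕ} {a b : ℂ}

theorem convex_logDomain (m : ℕ) : Convex ℝ (logDomain m) := by
  intro x hx y hy α β hα hβ hαβ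
  change ∑ k, Real.exp (((α • x + β • y) k).re / 2) < 1
  have hx' : ∑ k, Real.exp ((x k).re / 2) < 1 := hx
  have hy' : ∑ k, Real.exp ((y k).re / 2) < 1 := hy
  have h1 : ∀ k, Real.exp (((α • x + β • y) k).re / 2) ≤
      α * Real.exp ((x k).re / 2) + β * Real.exp ((y k).re / 2) := fun k => by
    have := convexOn_exp.2 (Set.mem_univ ((x k).re / 2)) (Set.mem_univ ((y k).re / 2)) hα hβ hαβ
    simp only [smul_eq_mul] at this
    refine le_trans (le_of_eq ?_) this
    congr 1
    simp
    ring
  have h2 := Finset.sum_le_sum fun k (_ : k ∈ Finset.univ) => h1 k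
  rw [Finset.sum_add_distrib, ← Finset.mul_sum, ← Finset.mul_sum] at h2
  rcases hα.eq_or_lt with h | h
  · have : β = 1 := by linarith
    subst h this
    linarith
  · nlinarith

/-- The two types of eigenvectors of a triangular matrix of size two that occur as local
monodromy. -/
def eigVec (γ : ℂ) (j i : Fin 2) : ℂ :=
  if j = 0 then if i = 0 then 1 else 0 else if i = 0 then (γ - 1)⁻¹ else 1

/-- The coefficients of the eigenfunctions of the monodromy with respect to the Frobenius series. -/
def eigCoef (c : Fin m → ℂ) (k : Fin m) (j : Fin 2) : ℂ :=
  if j = 0 then -(2 * Real.pi * Complex.I) * Complex.exp (Real.pi * Complex.I * c k)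
  else -(Real.pi / Complex.sin (Real.pi * c k))

/-- For `γ_k ≠ 1` the eigenvectors invert `Q_k` up to scalars, so each of them isolates one
Frobenius series. -/
theorem sum_eigVec_mul_projCoef {c : Fin m → ℂ} (hc : c ∈ nonInt m) (k : Fin m) (j i : Fin 2) :
    ∑ l, eigVec (gam c k) j l * projCoef c k l i = if i = j then eigCoef c k j else 0 := by
  have hs := sin_ne_zero_of_nonInt hc k
  have hγ : gam c k - 1 = 2 * Complex.I * Complex.exp (Real.pi * Complex.I * c k) *
      Complex.sin (Real.pi * c k) := by linear_combination -one_sub_gam c k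
  have hE := Complex.exp_ne_zero (Real.pi * Complex.I * c k)
  rw [Fin.sum_univ_two, projCoef_zero hc]
  unfold eigVec eigCoef regCoef projCoef matQ
  fin_cases j <;> fin_cases i
  · simp
  · simp
  · simp [hγ]
    field_simp
    linear_combination (Real.pi : ℂ) * Complex.I_sq
  · simp

theorem sum_eigVec_mul_modSol_of_nonInt {c t : Fin m → ℂ} (hc : c ∈ nonInt m) (ht : t ∈ logDomain m)
    (J : Fin m → Fin 2) :
    ∑ I : Fin m → Fin 2, (∏ k, eigVec (gam c k) (J k) (I k)) * modSol a b I (c, t) =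
      (∏ k, eigCoef c k (J k)) * frobSer a b J (c, t) := by
  simp only [modSol_eq _ hc ht, frobComb, Finset.mul_sum]
  rw [Finset.sum_comm]
  have h : ∀ K : Fin m → Fin 2, ∑ I : Fin m → Fin 2, (∏ k, eigVec (gam c k) (J k) (I k)) *
      ((∏ k, projCoef c k (I k) (K k)) * frobSer a b K (c, t)) =
      if K = J then (∏ k, eigCoef c k (J k)) * frobSer a b J (c, t) else 0 := fun K => by
    have h1 : ∑ I : Fin m → Fin 2, ∏ k, (eigVec (gam c k) (J k) (I k) * projCoef c k (I k) (K k)) =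
        ∏ k, if K k = J k then eigCoef c k (J k) else 0 := by
      rw [← Fintype.prod_sum fun k l => eigVec (gam c k) (J k) l * projCoef c k l (K k)]
      exact Finset.prod_congr rfl fun k _ => sum_eigVec_mul_projCoef hc k (J k) (K k)
    simp only [← mul_assoc, ← Finset.prod_mul_distrib, ← Finset.sum_mul]
    rw [h1]
    split_ifs with hK
    · subst hK
      simp
    · obtain ⟨k, hk⟩ := Function.ne_iff.1 hK
      rw [Finset.prod_eq_zero (Finset.mem_univ k) (if_neg hk), zero_mul]
  rw [Finset.sum_congr rfl fun K _ => h K]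
  simp

theorem gam_eq_one_iff (c : Fin m → ℂ) (k : Fin m) : gam c k = 1 ↔ ∃ n : ℤ, c k = n := by
  rw [gam, Complex.exp_eq_one_iff]
  refine exists_congr fun n => ?_
  rw [mul_comm (n : ℂ)]
  exact mul_right_inj' Complex.two_pi_I_ne_zero

/-- At integral `c_k` the eigenvector with `j_k = 0` and its coefficient stay finite, so continuity
extends the identity to all eigenvectors that persist there. -/
theorem sum_eigVec_mul_modSol {c t : Fin m → ℂ} (ht : t ∈ logDomain m) {J : Fin m → Fin 2}
    (hJ : ∀ k, J k = 1 → gam c k ≠ 1) :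
    ∑ I : Fin m → Fin 2, (∏ k, eigVec (gam c k) (J k) (I k)) * modSol a b I (c, t) =
      (∏ k, eigCoef c k (J k)) * frobSer a b J (c, t) := by
  refine eq_of_eq_on_nonInt
    (f := fun c => ∑ I : Fin m → Fin 2, (∏ k, eigVec (gam c k) (J k) (I k)) * modSol a b I (c, t))
    (g := fun c => (∏ k, eigCoef c k (J k)) * frobSer a b J (c, t)) ?_ ?_
    fun c' hc' => sum_eigVec_mul_modSol_of_nonInt hc' ht J
  · refine tendsto_finsetSum _ fun I _ => ContinuousAt.mul (tendsto_finsetProd _ fun k _ => ?_)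
      (modSol_continuousAt_param I c ht)
    change ContinuousAt (fun c => eigVec (gam c k) (J k) (I k)) c
    unfold eigVec
    split_ifs with h1 h2 h2
    · exact continuousAt_const
    · exact continuousAt_const
    · exact ((continuous_gam k).continuousAt.sub continuousAt_const).inv₀
        (sub_ne_zero.2 (hJ k (by omega)))
    · exact continuousAt_const
  · refine ContinuousAt.mul (tendsto_finsetProd _ fun k _ => ?_)
      (ContinuousAt.comp (f := fun c : Fin m → ℂ => (c, t))
        (frobSer_analyticOnNhd a b J (c, t) ht).continuousAt (by fun_prop))
    change ContinuousAt (fun c => eigCoef c k (J k)) c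
    unfold eigCoef
    split_ifs with h1
    · exact continuousAt_const.mul
        (Complex.continuous_exp.comp (by fun_prop : Continuous _)).continuousAt
    · refine (continuousAt_const.div
        (Complex.continuous_sin.comp (by fun_prop : Continuous _)).continuousAt fun h => ?_).neg
      exact hJ k (by omega) ((gam_eq_one_iff c k).2 ((sin_pi_mul_eq_zero_iff _).1 h))

theorem eigCoef_ne_zero {c : Fin m → ℂ} {k : Fin m} {j : Fin 2} (hj : j = 1 → gam c k ≠ 1) :
    eigCoef c k j ≠ 0 := by
  unfold eigCoef
  split_ifs with h1
  · exact mul_ne_zero (neg_ne_zero.2 Complex.two_pi_I_ne_zero) (Complex.exp_ne_zero _)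
  · refine neg_ne_zero.2 (div_ne_zero (by exact_mod_cast Real.pi_ne_zero) fun h => ?_)
    exact hj (by omega) ((gam_eq_one_iff c k).2 ((sin_pi_mul_eq_zero_iff _).1 h))

/-- One step of the monodromy around `x_k = 0`, minus the scalar `γ_k⁻¹`, on the coefficients of a
combination of the entries of the modified vector. -/
def monStep (c : Fin m → ℂ) (k : Fin m) (v : (Fin m → Fin 2) → ℂ) (I : Fin m → Fin 2) : ℂ :=
  if I k = 0 then (1 - (gam c k)⁻¹) * v I - (gam c k)⁻¹ * v (Function.update I k 1) else 0

/-- The monodromy acts on coefficients by the transposed matrix; flipping the `k`-th index moves the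
off-diagonal term of `modSol_monodromy_one` to the index with `I k = 0`. -/
theorem sum_monStep_mul_modSol (c : Fin m → ℂ) (k : Fin m) (v : (Fin m → Fin 2) → ℂ) {t : Fin m → ℂ}
    (ht : t ∈ logDomain m) :
    ∑ I, monStep c k v I * modSol a b I (c, t) =
      ∑ I, v I * modSol a b I (c, t + Pi.single k (2 * Real.pi * Complex.I)) -
        (gam c k)⁻¹ * ∑ I, v I * modSol a b I (c, t) := by
  have hinv : Function.Involutive fun I : Fin m → Fin 2 => Function.update I k (1 - I k) := fun I => by
    ext k'
    by_cases hk' : k' = k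
    · subst hk'
      simp
    · simp [hk']
  set F : (Fin m → Fin 2) → ℂ := fun I =>
    if I k = 0 then v (Function.update I k 1) * modSol a b I (c, t) else 0 with hF
  have hflip : ∑ I, F (Function.update I k (1 - I k)) = ∑ I, F I :=
    Equiv.sum_comp hinv.toPerm F
  have hterm : ∀ I, monStep c k v I * modSol a b I (c, t) -
      (v I * modSol a b I (c, t + Pi.single k (2 * Real.pi * Complex.I)) -
        (gam c k)⁻¹ * (v I * modSol a b I (c, t))) =
      (gam c k)⁻¹ * F (Function.update I k (1 - I k)) - (gam c k)⁻¹ * F I := fun I => by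
    unfold monStep
    rcases (show I k = 0 ∨ I k = 1 by omega) with h | h
    · rw [modSol_monodromy_zero h c ht]
      simp [hF, h]
      ring
    · rw [modSol_monodromy_one h c ht]
      have h1 : Function.update I k 1 = I := by rw [← h, Function.update_eq_self]
      simp [hF, h, h1]
      ring
  rw [← sub_eq_zero, Finset.mul_sum, ← Finset.sum_sub_distrib, ← Finset.sum_sub_distrib,
    Finset.sum_congr rfl fun I _ => hterm I, Finset.sum_sub_distrib, ← Finset.mul_sum,
    ← Finset.mul_sum, hflip, sub_self]

/-- A nontrivial relation yields one whose coefficients are a common eigenvector of the local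
monodromies. -/
theorem exists_eigVec_relation {c : Fin m → ℂ} {v : (Fin m → Fin 2) → ℂ} (hv : v ≠ 0)
    (hrel : ∀ t ∈ logDomain m, ∑ I, v I * modSol a b I (c, t) = 0) (S : Finset (Fin m)) :
    ∃ (u : (Fin m → Fin 2) → ℂ) (J : Fin m → Fin 2), u ≠ 0 ∧
      (∀ t ∈ logDomain m, ∑ I, u I * modSol a b I (c, t) = 0) ∧
      (∀ k, J k = 1 → gam c k ≠ 1) ∧
      ∀ k ∈ S, ∀ I, u I = eigVec (gam c k) (J k) (I k) * u (Function.update I k (J k)) := by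
  induction S using Finset.induction_on with
  | empty => exact ⟨v, 0, hv, hrel, fun k hk => by simp at hk, by simp⟩
  | insert k S hk ih =>
    obtain ⟨u, J, hu, hurel, hJ, hS⟩ := ih
    have hne : ∀ k' ∈ S, k' ≠ k := fun k' hk' h => hk (h ▸ hk')
    have hγ0 := gam_ne_zero c k
    have hJ' : ∀ j : Fin 2, (j = 1 → gam c k ≠ 1) →
        ∀ k', Function.update J k j k' = 1 → gam c k' ≠ 1 := fun j hj k' hk' => by
      by_cases h : k' = k
      · subst h
        exact hj (by simpa using hk')
      · exact hJ k' (by simpa [h] using hk')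
    -- The monodromy `T` satisfies `(T - 1)(T - γ_k⁻¹) = 0`. If `T - γ_k⁻¹` kills `u`, then `u` is
    -- an eigenvector for `γ_k⁻¹`, of type 1, or of type 0 if `γ_k = 1`. Otherwise the image of `u`
    -- is an eigenvector for 1, of type 0.
    by_cases hμ : monStep c k u = 0
    · have hrelk : ∀ I : Fin m → Fin 2, I k = 0 →
          (gam c k - 1) * u I = u (Function.update I k 1) := fun I hI => by
        have := congrFun hμ I
        simp only [monStep, hI, if_true, Pi.zero_apply] at this
        field_simp at this
        linear_combination this
      by_cases hγ : gam c k = 1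
      · refine ⟨u, Function.update J k 0, hu, hurel, hJ' 0 (by simp), fun k' hk' I => ?_⟩
        rcases Finset.mem_insert.1 hk' with rfl | hk'
        · rcases (show I k' = 0 ∨ I k' = 1 by omega) with h | h
          · have h1 : Function.update I k' 0 = I := by rw [← h, Function.update_eq_self]
            simp [eigVec, h, h1]
          · have h1 := hrelk (Function.update I k' 0) (by simp)
            rw [hγ, sub_self, zero_mul, Function.update_idem] at h1
            have h2 : Function.update I k' 1 = I := by rw [← h, Function.update_eq_self]
            rw [h2] at h1
            simp [eigVec, h, ← h1]
        · rw [Function.update_of_ne (hne k' hk')]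
          exact hS k' hk' I
      · refine ⟨u, Function.update J k 1, hu, hurel, hJ' 1 fun _ => hγ, fun k' hk' I => ?_⟩
        rcases Finset.mem_insert.1 hk' with rfl | hk'
        · rcases (show I k' = 0 ∨ I k' = 1 by omega) with h | h
          · have h1 := hrelk I h
            have h2 := sub_ne_zero.2 hγ
            simp [eigVec, h, ← h1, h2]
          · have h2 : Function.update I k' 1 = I := by rw [← h, Function.update_eq_self]
            simp [eigVec, h, h2]
        · rw [Function.update_of_ne (hne k' hk')]
          exact hS k' hk' I
    · refine ⟨monStep c k u, Function.update J k 0, hμ, fun t ht => ?_, hJ' 0 (by simp),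
        fun k' hk' I => ?_⟩
      · rw [sum_monStep_mul_modSol c k u ht, hurel t ht,
          hurel _ (add_two_pi_I_mem_logDomain ht k _ two_pi_I_re), mul_zero, sub_zero]
      · rcases Finset.mem_insert.1 hk' with rfl | hk'
        · rcases (show I k' = 0 ∨ I k' = 1 by omega) with h | h
          · have h1 : Function.update I k' 0 = I := by rw [← h, Function.update_eq_self]
            simp [eigVec, h, h1]
          · simp [eigVec, h, monStep]
        · have hkk := hne k' hk'
          rw [Function.update_of_ne hkk]
          unfold monStep
          rw [Function.update_of_ne hkk.symm]
          split_ifs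
          -- Steps in different directions commute, so the eigenvector condition for `k'` is
          -- preserved.
          · rw [hS k' hk' I, hS k' hk' (Function.update I k 1), Function.update_of_ne hkk,
              Function.update_comm hkk]
            ring
          · rw [mul_zero]

/-- The coefficients of a common eigenvector are products over `k`. The relation then says that a
nonzero multiple of one Frobenius series vanishes identically. -/
theorem eq_zero_of_sum_mul_modSol {c : Fin m → ℂ}
    (ha : ∀ (I : Fin m → Fin 2) (n : ℤ), a - ∑ k, ((I k : ℕ) : ℂ) * c k ≠ n)
    (hb : ∀ (I : Fin m → Fin 2) (n : ℤ), b - ∑ k, ((I k : ℕ) : ℂ) * c k ≠ n)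
    {v : (Fin m → Fin 2) → ℂ}
    (hrel : ∀ t ∈ logDomain m, ∑ I, v I * modSol a b I (c, t) = 0) : v = 0 := by
  by_contra hv
  obtain ⟨u, J, hu, hurel, hJ, hS⟩ := exists_eigVec_relation hv hrel Finset.univ
  have hprod : ∀ I, u I = (∏ k, eigVec (gam c k) (J k) (I k)) * u J := fun I => by
    have key : ∀ S : Finset (Fin m), u I = (∏ k ∈ S, eigVec (gam c k) (J k) (I k)) *
        u (fun k => if k ∈ S then J k else I k) := fun S => by
      induction S using Finset.induction_on with
      | empty => simp
      | insert k S hk ih =>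
        rw [ih, hS k (Finset.mem_univ k) fun k => if k ∈ S then J k else I k,
          Finset.prod_insert hk]
        have h1 : Function.update (fun k => if k ∈ S then J k else I k) k (J k) =
            fun k' => if k' ∈ insert k S then J k' else I k' := by
          ext k'
          by_cases h : k' = k
          · subst h; simp
          · simp [h]
        rw [h1]
        simp only [hk, if_false]
        ring
    simpa using key Finset.univ
  have huJ : u J ≠ 0 := fun h => hu (funext fun I => by rw [hprod I, h, mul_zero]; rfl)
  obtain ⟨t, ht, hne⟩ := exists_frobSer_ne_zero a b (J := J) ha hb fun k hk n hn =>
    hJ k hk ((gam_eq_one_iff c k).2 ⟨n, hn⟩)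
  have h1 := sum_eigVec_mul_modSol (a := a) (b := b) ht hJ
  have h2 := hurel t ht
  rw [Finset.sum_congr rfl fun I _ => show u I * modSol a b I (c, t) =
    u J * ((∏ k, eigVec (gam c k) (J k) (I k)) * modSol a b I (c, t)) by rw [hprod I]; ring,
    ← Finset.mul_sum, h1] at h2
  exact mul_ne_zero huJ (mul_ne_zero (Finset.prod_ne_zero_iff.2 fun k _ => eigCoef_ne_zero (hJ k))
    hne) h2

end

/-! ### The basis of local solutions -/

section

variable {m : ℕ} {a b : ℂ} {c x₀ ℓ : Fin m → ℂ}

theorem vecFt_eventuallyEq (hx₀ : x₀ ∈ convDomain m) (hℓ : ∀ k, Complex.exp (ℓ k) = x₀ k)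
    (I : Fin m → Fin 2) : ∀ᶠ x in 𝓝 x₀,
      vecFt a b x₀ ℓ c x I = modSol a b I (c, logCoord x₀ ℓ x) := by
  filter_upwards [(isOpen_slitDomain x₀).mem_nhds (mem_slitDomain_self hx₀ hℓ)] with x hx
  exact vecFt_eq_modSol hℓ c hx I

theorem modSol_comp_logCoord_analyticAt (hℓ : ∀ k, Complex.exp (ℓ k) = x₀ k) {x : Fin m → ℂ}
    (hx : x ∈ slitDomain x₀) (I : Fin m → Fin 2) :
    AnalyticAt ℂ (fun x => modSol a b I (c, logCoord x₀ ℓ x)) x :=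
  AnalyticAt.fun_comp (g := fun t => modSol a b I (c, t))
    (analyticAt_slice (modSol_analyticOnNhd I _ (logCoord_mem_logDomain hℓ hx)))
    (logCoord_analyticAt hx)

theorem vecFt_mem_localSol (hx₀ : x₀ ∈ convDomain m) (hℓ : ∀ k, Complex.exp (ℓ k) = x₀ k)
    (I : Fin m → Fin 2) :
    (((fun x => vecFt a b x₀ ℓ c x I) : (Fin m → ℂ) → ℂ) : Germ (𝓝 x₀) ℂ) ∈
      localSol a b c x₀ := by
  have hself := mem_slitDomain_self hx₀ hℓ
  refine ⟨fun x => modSol a b I (c, logCoord x₀ ℓ x),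
    Germ.coe_eq.2 (vecFt_eventuallyEq hx₀ hℓ I), modSol_comp_logCoord_analyticAt hℓ hself I,
    fun k => ?_⟩
  filter_upwards [(isOpen_slitDomain x₀).mem_nhds hself] with x hx
  have ht := logCoord_mem_logDomain hℓ hx
  rw [opEC_comp_logCoord (g := fun t => modSol a b I (c, t)) hℓ hx
    (analyticAt_slice (modSol_analyticOnNhd I _ ht)), opLog_modSol I c ht k]

/-- By the identity theorem a relation between germs holds on the whole convex `logDomain m`, where
translations by `2πi` can be applied. -/
theorem linearIndependent_vecFt
    (ha : ∀ (I : Fin m → Fin 2) (n : ℤ), a - ∑ k, ((I k : ℕ) : ℂ) * c k ≠ n)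
    (hb : ∀ (I : Fin m → Fin 2) (n : ℤ), b - ∑ k, ((I k : ℕ) : ℂ) * c k ≠ n)
    (hx₀ : x₀ ∈ convDomain m) (hℓ : ∀ k, Complex.exp (ℓ k) = x₀ k) :
    LinearIndependent ℂ fun I : Fin m → Fin 2 =>
      (⟨_, vecFt_mem_localSol hx₀ hℓ I⟩ : localSol a b c x₀) := by
  rw [Fintype.linearIndependent_iff]
  intro v hv
  refine congrFun (eq_zero_of_sum_mul_modSol ha hb (v := v) ?_)
  have h1 : ((fun x => ∑ I, v I * vecFt a b x₀ ℓ c x I : (Fin m → ℂ) → ℂ) : Germ (𝓝 x₀) ℂ) = 0 := by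
    have h2 := congrArg (Submodule.subtype _) hv
    rw [map_sum, map_zero] at h2
    rw [← h2]
    have h3 : (fun x => ∑ I, v I * vecFt a b x₀ ℓ c x I : (Fin m → ℂ) → ℂ) =
        ∑ I, fun x => v I * vecFt a b x₀ ℓ c x I := by
      ext x
      rw [Finset.sum_apply]
    rw [h3]
    exact map_sum (Germ.coeAddHom (𝓝 x₀)) _ _
  have h2 : ∀ᶠ x in 𝓝 x₀, ∑ I, v I * vecFt a b x₀ ℓ c x I = 0 := Germ.coe_eq.1 h1
  have hexp := (expCoord_analyticAt ℓ).continuousAt.tendsto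
  rw [expCoord_base hℓ] at hexp
  have h3 : ∀ᶠ t in 𝓝 ℓ, ∑ I, v I * modSol a b I (c, t) = 0 := by
    filter_upwards [hexp.eventually h2, hexp.eventually
      (eventually_all.2 fun I => vecFt_eventuallyEq (a := a) (b := b) (c := c) hx₀ hℓ I),
      eventually_logCoord_expCoord hℓ] with t ht1 ht2 ht3
    simpa only [ht2, ht3] using ht1
  have han : AnalyticOnNhd ℂ (fun t => ∑ I, v I * modSol a b I (c, t)) (logDomain m) := fun t ht =>
    Finset.analyticAt_fun_sum _ fun I _ => analyticAt_const.mul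
      (analyticAt_slice (modSol_analyticOnNhd I _ ht))
  exact han.eqOn_zero_of_preconnected_of_eventuallyEq_zero (convex_logDomain m).isPreconnected
    (mem_logDomain_of_exp hx₀ hℓ) h3

theorem exists_basis_vecFt
    (ha : ∀ (I : Fin m → Fin 2) (n : ℤ), a - ∑ k, ((I k : ℕ) : ℂ) * c k ≠ n)
    (hb : ∀ (I : Fin m → Fin 2) (n : ℤ), b - ∑ k, ((I k : ℕ) : ℂ) * c k ≠ n)
    (hx₀ : x₀ ∈ convDomain m) (hℓ : ∀ k, Complex.exp (ℓ k) = x₀ k) :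
    ∃ B : Module.Basis (Fin m → Fin 2) ℂ (localSol a b c x₀), ∀ I : Fin m → Fin 2,
      (B I : Germ (𝓝 x₀) ℂ) = ((fun x => vecFt a b x₀ ℓ c x I) : (Fin m → ℂ) → ℂ) := by
  have hli := linearIndependent_vecFt ha hb hx₀ hℓ
  have := localSol_finite (a := a) (b := b) (c := c) hx₀ hℓ
  have hcard : Fintype.card (Fin m → Fin 2) = Module.finrank ℂ (localSol a b c x₀) :=
    le_antisymm hli.fintype_card_le_finrank (by simpa using finrank_localSol_le hx₀ hℓ)
  exact ⟨basisOfLinearIndependentOfCardEqFinrank hli hcard, fun I => by simp⟩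

/-- The logarithmic terms for integral entries of `c`. -/
theorem exists_log_decomposition
    (ha : ∀ (I : Fin m → Fin 2) (n : ℤ), a - ∑ k, ((I k : ℕ) : ℂ) * c k ≠ n)
    (hb : ∀ (I : Fin m → Fin 2) (n : ℤ), b - ∑ k, ((I k : ℕ) : ℂ) * c k ≠ n)
    (hx₀ : x₀ ∈ convDomain m) (hℓ : ∀ k, Complex.exp (ℓ k) = x₀ k) {k : Fin m}
    (hk : ∃ n : ℤ, c k = n) {I : Fin m → Fin 2} (hI : I k = 1) :
    ∃ g h : (Fin m → ℂ) → ℂ,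
      AnalyticOnNhd ℂ g (loopDomain x₀ k) ∧ AnalyticOnNhd ℂ h (loopDomain x₀ k) ∧
      ¬ (∀ᶠ x in 𝓝 x₀, g x = 0) ∧
      ∀ x ∈ slitDomain x₀, vecFt a b x₀ ℓ c x I = h x + logBr x₀ ℓ k x * g x := by
  have hγ : gam c k = 1 := (gam_eq_one_iff c k).2 hk
  have hpi := Complex.two_pi_I_ne_zero
  have han : ∀ I : Fin m → Fin 2, AnalyticOnNhd ℂ (fun t => modSol a b I (c, t)) (logDomain m) :=
    fun I t ht => analyticAt_slice (modSol_analyticOnNhd I _ ht)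
  set I₀ := Function.update I k 0 with hI₀
  -- For `γ_k = 1` the loop adds `-modSol a b I₀` to the entry `I`, and `2πi G` to `t_k G`. This `G`
  -- makes the two jumps equal, so that `H` is periodic.
  let G : (Fin m → ℂ) → ℂ := fun t => -(2 * Real.pi * Complex.I)⁻¹ * modSol a b I₀ (c, t)
  let H : (Fin m → ℂ) → ℂ := fun t => modSol a b I (c, t) - t k * G t
  have hG : AnalyticOnNhd ℂ G (logDomain m) := fun t ht => analyticAt_const.mul (han I₀ t ht)
  have hH : AnalyticOnNhd ℂ H (logDomain m) := fun t ht => (han I t ht).sub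
    (((ContinuousLinearMap.proj (R := ℂ) (φ := fun _ : Fin m => ℂ) k).analyticAt t).mul (hG t ht))
  have hGper : ∀ t ∈ logDomain m, G (t + Pi.single k (2 * Real.pi * Complex.I)) = G t :=
    fun t ht => by
      simp only [G]
      rw [modSol_monodromy_zero (by simp [hI₀]) c ht]
  have hHper : ∀ t ∈ logDomain m, H (t + Pi.single k (2 * Real.pi * Complex.I)) = H t :=
    fun t ht => by
      simp only [H, hGper t ht]
      rw [modSol_monodromy_one hI c ht, hγ, inv_one, one_mul, ← hI₀]
      simp only [G, Pi.add_apply, Pi.single_eq_same]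
      field_simp
      ring
  refine ⟨fun x => G (logCoord x₀ ℓ x), fun x => H (logCoord x₀ ℓ x),
    analyticOnNhd_loopDomain hℓ hG hGper, analyticOnNhd_loopDomain hℓ hH hHper, fun h0 => ?_,
    fun x hx => ?_⟩
  -- `g` is a nonzero multiple of the entry `I₀`, a member of a linearly independent family.
  · refine (linearIndependent_vecFt ha hb hx₀ hℓ).ne_zero I₀ (Subtype.ext (Germ.coe_eq.2 ?_))
    filter_upwards [h0, vecFt_eventuallyEq hx₀ hℓ I₀] with x hx1 hx2
    rw [hx2]
    exact (mul_eq_zero.1 hx1).resolve_left (neg_ne_zero.2 (inv_ne_zero hpi))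
  · rw [vecFt_eq_modSol hℓ c hx I]
    simp only [H, logCoord]
    ring

end

end

end LauricellaFC

open LauricellaFC

theorem mainTheorem3 (m : ℕ) (a b : ℂ) (c : Fin m → ℂ)
    (ha : ∀ (I : Fin m → Fin 2) (n : ℤ), a - ∑ k, ((I k : ℕ) : ℂ) * c k ≠ n)
    (hb : ∀ (I : Fin m → Fin 2) (n : ℤ), b - ∑ k, ((I k : ℕ) : ℂ) * c k ≠ n)
    (x₀ : Fin m → ℂ) (hx₀ : x₀ ∈ convDomain m \ singularLocus m)
    (ℓ : Fin m → ℂ) (hℓ : ∀ k, Complex.exp (ℓ k) = x₀ k) :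
    -- the limit that defines the modified vector exists
    (∀ I : Fin m → Fin 2,
      TendstoLocallyUniformlyOn (fun c' x => vecFP a b x₀ ℓ c' x I)
        (fun x => vecFt a b x₀ ℓ c x I) (𝓝[nonInt m] c) (slitDomain x₀)) ∧
    -- it is the product itself if no entry of `c` is an integer
    (c ∈ nonInt m → ∀ x ∈ slitDomain x₀, ∀ I : Fin m → Fin 2,
      vecFt a b x₀ ℓ c x I = vecFP a b x₀ ℓ c x I) ∧
    -- its entries form a basis of the local solution space
    (∃ B : Module.Basis (Fin m → Fin 2) ℂ (localSol a b c x₀), ∀ I : Fin m → Fin 2,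
      (B I : Germ (𝓝 x₀) ℂ) = ((fun x => vecFt a b x₀ ℓ c x I) : (Fin m → ℂ) → ℂ)) ∧
    -- logarithmic terms appear for integral entries of `c`
    (∀ k : Fin m, (∃ n : ℤ, c k = n) → ∀ I : Fin m → Fin 2, I k = 1 →
      ∃ g h : (Fin m → ℂ) → ℂ,
        AnalyticOnNhd ℂ g (loopDomain x₀ k) ∧ AnalyticOnNhd ℂ h (loopDomain x₀ k) ∧
        ¬ (∀ᶠ x in 𝓝 x₀, g x = 0) ∧
        ∀ x ∈ slitDomain x₀, vecFt a b x₀ ℓ c x I = h x + logBr x₀ ℓ k x * g x) := by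
  exact ⟨tendstoLocallyUniformlyOn_vecFP hℓ c,
    fun hc x hx I => by rw [vecFt_eq_modSol hℓ c hx, vecFP_eq_modSol hℓ hc hx],
    exists_basis_vecFt ha hb hx₀.1 hℓ,
    fun _ hk _ hI => exists_log_decomposition ha hb hx₀.1 hℓ hk hI⟩
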